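/- Let $\Sigma=\{\mathrm L,\mathrm X,\mathrm R\}$ with $\mathrm L<\mathrm X<\mathrm R$, let $\Sigma^*$ be the set of finite words over $\Sigma$, with letters indexed from $0$, and let $\le_{\mathrm{lex}}$ be the lexicographic order on $\Sigma^*$. For $w,w'\in\Sigma^*$ put $w\prec w'$ if for some $i<\min(|w|,|w'|)$ we have $(w_i,w'_i)=(\mathrm L,\mathrm R)$ and $w_j\le w'_j$ for all $j<i$; let $w\preceq w'$ mean $w=w'$ or $w\prec w'$. Put $w\perp w'$ if $w_i<w'_i$ and $w'_j<w_j$ for some $i,j<\min(|w|,|w'|)$. Words are *related* if $w\preceq w'$, $w'\preceq w$ or $w\perp w'$, and *unrelated* otherwise. Words $u\le_{\mathrm{lex}}v$ are *compatible* if $(u_i,v_i)=(\mathrm R,\mathrm L)$ for no $i$, and the existence of $j$ with $(u_j,v_j)=(\mathrm L,\mathrm R)$ implies $u\prec v$ and not $u\perp v$. For $S\subseteq\Sigma^*$ let $\overline S$ be the set of initial segments of words of $S$, $S_i$ the set of words of length $i$ in $S$, $L(S)$ the set of words of $S$ with no proper extension in $S$, and $S^\frown c=\{w^\frown c:w\in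 S\}$, where $w^\frown c$ is $w$ with the letter $c$ added at the end. A set $S\subseteq\Sigma^*$ is a *poset-type* if $S=\overline S$ and for every $i$ with $S_i\neq\emptyset$ precisely one of the following holds. 1. (Leaf) There is $w\in S_i$ related to every $u\in S_i\setminus\{w\}$, and $S_{i+1}=(S_i\setminus\{w\})^\frown\mathrm X$. 2. (Branching) There is $w\in S_i$ with $S_{i+1}=\{z\in S_i:z<_{\mathrm{lex}}w\}^\frown\mathrm X\cup\{w^\frown\mathrm X,w^\frown\mathrm R\}\cup\{z\in S_i:w<_{\mathrm{lex}}z\}^\frown\mathrm R$. 3. (New $\perp$) There are unrelated $v<_{\mathrm{lex}}w$ in $S_i$ with $S_{i+1}=\{z\in S_i:z<_{\mathrm{lex}}v\}^\frown\mathrm X\cup\{v^\frown\mathrm R\}\cup\{z\in S_i:v<_{\mathrm{lex}}z<_{\mathrm{lex}}w,\ z\perp v\}^\frown\mathrm X\cup\{z\in S_i:v<_{\mathrm{lex}}z<_{\mathrm{lex}}w,\ z\not\perp v\}^\frown\mathrm R\cup\{w^\frown\mathrm X\}\cup\{z\in S_i:w<_{\mathrm{lex}}z\}^\frown\mathrm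 R$, and every $u\in S_i$ with $v<_{\mathrm{lex}}u<_{\mathrm{lex}}w$ satisfies $u\perp v$ or $u\perp w$. 4. (New $\preceq$) There are unrelated $v<_{\mathrm{lex}}w$ in $S_i$ with $S_{i+1}=\{z\in S_i:z<_{\mathrm{lex}}v,\ z\perp v\}^\frown\mathrm X\cup\{z\in S_i:z<_{\mathrm{lex}}v,\ z\not\perp v\}^\frown\mathrm L\cup\{v^\frown\mathrm L\}\cup\{z\in S_i:v<_{\mathrm{lex}}z<_{\mathrm{lex}}w\}^\frown\mathrm X\cup\{w^\frown\mathrm R\}\cup\{z\in S_i:w<_{\mathrm{lex}}z,\ w\perp z\}^\frown\mathrm X\cup\{z\in S_i:w<_{\mathrm{lex}}z,\ w\not\perp z\}^\frown\mathrm R$; every $u\in S_i$ with $u<_{\mathrm{lex}}v$ satisfies $u\preceq w$ or $u\perp v$; and every $u\in S_i$ with $w<_{\mathrm{lex}}u$ satisfies $v\preceq u$ or $w\perp u$. For a finite partial order $A$ let $T(A)$ be the set of all finite poset-types $S$ such that $(L(S),\preceq)$ is isomorphic to $A$. For $S\subseteq\Sigma^*$, call $i$ *interesting* if the structures $(\overline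 S_i,\le_{\mathrm{lex}},\preceq,\perp)$ and $(\overline S_{i+1},\le_{\mathrm{lex}},\preceq,\perp)$ are not isomorphic, or there are incompatible $u,v\in\overline S_{i+1}$ whose initial segments of length $i$ are compatible. The *embedding type* $\tau(S)$ is the set of words obtained from the words of $S$ by deleting every letter whose index is not interesting for $S$. Let $P$ be the generic partial order, i.e. the countable homogeneous partial order (every isomorphism between finite suborders extends to an automorphism) into which every countable partial order embeds. **Theorem.** There exists an embedding $\psi:P\to(\Sigma^*,\preceq)$ such that $\overline{\psi[P]}$ is a poset-type and $\psi(p)$ is a leaf of $\overline{\psi[P]}$ for every $p\in P$. Moreover, for every such $\psi$, every finite partial order $A$ and every embedding $f:P\to P$, $$\{\chi_A(f\circ g): g \text{ an embedding } A\to P\}=T(A),$$ where the colour of an embedding $g:A\to P$ is $\chi_A(g)=\overline{\tau(\psi[g[A]])}$. -/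

import Mathlib

namespace PosetType

/-! ### Words over the alphabet `L < X < R` -/

/-- The three-letter alphabet. -/
inductive Letter : Type where
  | L
  | X
  | R
  deriving DecidableEq

/-- The position of a letter in the order `L < X < R`. -/
def Letter.rank : Letter → ℕ
  | .L => 0
  | .X => 1
  | .R => 2

theorem Letter.rank_injective : Function.Injective Letter.rank := by
  intro a b h
  cases a <;> cases b <;> first | rfl | simp [Letter.rank] at h

/-- The alphabet is ordered by `L < X < R`. -/
instance : LinearOrder Letter := LinearOrder.lift' Letter.rank Letter.rank_injective

/-- Finite words. The orders `≤` and `<` on words are Mathlib's orders on lists, that is, the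
lexicographic orders, in which a proper initial segment of a word comes before the word. -/
abbrev Word : Type := List Letter

/-- `w ≺ w'`: at some common position `w` has `L` and `w'` has `R`, and at all earlier positions
the letter of `w` is at most the letter of `w'`. -/
def Prec (w w' : Word) : Prop :=
  ∃ (i : ℕ) (h : i < w.length) (h' : i < w'.length),
    w[i] = Letter.L ∧ w'[i] = Letter.R ∧ ∀ (j : ℕ) (hj : j < i), w[j] ≤ w'[j]

/-- `w ≼ w'`: the reflexive version of `w ≺ w'`. -/
def PrecEq (w w' : Word) : Prop := w = w' ∨ Prec w w'

/-- `w ⊥ w'`: the letters of the two words are strictly ordered one way at some common position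
and strictly ordered the other way at another. -/
def Perp (w w' : Word) : Prop :=
  (∃ (i : ℕ) (h : i < w.length) (h' : i < w'.length), w[i] < w'[i]) ∧
    ∃ (j : ℕ) (h : j < w.length) (h' : j < w'.length), w'[j] < w[j]

/-- Two words are related if one of `w ≼ w'`, `w' ≼ w`, `w ⊥ w'` holds. -/
def Related (w w' : Word) : Prop := PrecEq w w' ∨ PrecEq w' w ∨ Perp w w'

/-- Compatibility of two words `u`, `v`, to be used when `u ≤ v` lexicographically. -/
def CompatibleOfLE (u v : Word) : Prop :=
  (¬ ∃ (i : ℕ) (h : i < u.length) (h' : i < v.length), u[i] = Letter.R ∧ v[i] = Letter.L) ∧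
    ((∃ (j : ℕ) (h : j < u.length) (h' : j < v.length), u[j] = Letter.L ∧ v[j] = Letter.R) →
      Prec u v ∧ ¬ Perp u v)

/-- Compatibility of two words, listed in any order. -/
def Compatible (u v : Word) : Prop :=
  (u ≤ v ∧ CompatibleOfLE u v) ∨ (v ≤ u ∧ CompatibleOfLE v u)

/-! ### Sets of words as trees -/

/-- The set of all initial segments of words of `S`. -/
def initialSegments (S : Set Word) : Set Word := {u | ∃ w ∈ S, u <+: w}

/-- The words of `S` of length `i`. -/
def level (S : Set Word) (i : ℕ) : Set Word := {w | w ∈ S ∧ w.length = i}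

/-- The leaves of `S`: the words of `S` with no proper extension in `S`. -/
def leaves (S : Set Word) : Set Word := {w | w ∈ S ∧ ∀ w' ∈ S, w <+: w' → w' = w}

/-- `S⌢c`: add the letter `c` to the end of every word of `S`. -/
def snocSet (S : Set Word) (c : Letter) : Set Word := (fun w => w ++ [c]) '' S

/-! ### Poset-types

In the next four definitions `S` and `S'` stand for two consecutive levels of a tree. -/

/-- A leaf is dropped. -/
def LeafStep (S S' : Set Word) : Prop :=
  ∃ w ∈ S, (∀ u ∈ S \ {w}, Related w u) ∧ S' = snocSet (S \ {w}) .X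

/-- A word branches. -/
def BranchingStep (S S' : Set Word) : Prop :=
  ∃ w ∈ S,
    S' = snocSet {z | z ∈ S ∧ z < w} .X ∪ {w ++ [.X], w ++ [.R]} ∪
      snocSet {z | z ∈ S ∧ w < z} .R

/-- A new pair is added to the relation `⊥`. -/
def NewPerpStep (S S' : Set Word) : Prop :=
  ∃ v ∈ S, ∃ w ∈ S, v < w ∧ ¬ Related v w ∧
    S' = snocSet {z | z ∈ S ∧ z < v} .X ∪ {v ++ [.R]} ∪
      snocSet {z | z ∈ S ∧ v < z ∧ z < w ∧ Perp z v} .X ∪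
      snocSet {z | z ∈ S ∧ v < z ∧ z < w ∧ ¬ Perp z v} .R ∪
      {w ++ [.X]} ∪ snocSet {z | z ∈ S ∧ w < z} .R ∧
    ∀ u ∈ S, v < u → u < w → Perp u v ∨ Perp u w

/-- A new pair is added to the relation `≼`. -/
def NewPrecStep (S S' : Set Word) : Prop :=
  ∃ v ∈ S, ∃ w ∈ S, v < w ∧ ¬ Related v w ∧
    S' = snocSet {z | z ∈ S ∧ z < v ∧ Perp z v} .X ∪
      snocSet {z | z ∈ S ∧ z < v ∧ ¬ Perp z v} .L ∪
      {v ++ [.L]} ∪ snocSet {z | z ∈ S ∧ v < z ∧ z < w} .X ∪ {w ++ [.R]} ∪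
      snocSet {z | z ∈ S ∧ w < z ∧ Perp w z} .X ∪
      snocSet {z | z ∈ S ∧ w < z ∧ ¬ Perp w z} .R ∧
    (∀ u ∈ S, u < v → PrecEq u w ∨ Perp u v) ∧
    (∀ u ∈ S, w < u → PrecEq v u ∨ Perp w u)

/-- The four kinds of levels. -/
inductive StepKind : Type where
  | leaf
  | branching
  | newPerp
  | newPrec

/-- The condition that belongs to a kind of level. -/
def StepKind.Holds (S S' : Set Word) : StepKind → Prop
  | .leaf => LeafStep S S'
  | .branching => BranchingStep S S'
  | .newPerp => NewPerpStep S S'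
  | .newPrec => NewPrecStep S S'

/-- Poset-types: sets closed under initial segments in which every nonempty level satisfies
precisely one of the four conditions. -/
def IsPosetType (S : Set Word) : Prop :=
  S = initialSegments S ∧
    ∀ i : ℕ, (level S i).Nonempty →
      ∃! k : StepKind, k.Holds (level S i) (level S (i + 1))

/-- `T(A)`: the finite poset-types whose set of leaves, with `≼`, is isomorphic to `A`. -/
def types (A : Type*) [PartialOrder A] : Set (Set Word) :=
  {S | IsPosetType S ∧ S.Finite ∧
    ∃ e : A ≃ leaves S, ∀ a b : A, a ≤ b ↔ PrecEq (e a) (e b)}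

/-! ### Embedding types -/

/-- Isomorphism of two sets of words as structures with the lexicographic order, `≼` and `⊥`. -/
def StructIso (U V : Set Word) : Prop :=
  ∃ e : U ≃ V, ∀ u v : U,
    ((u : Word) ≤ v ↔ (e u : Word) ≤ e v) ∧
    (PrecEq u v ↔ PrecEq (e u) (e v)) ∧
    (Perp u v ↔ Perp (e u) (e v))

/-- The indices of the interesting levels of the tree of initial segments of words of `S`. -/
def interesting (S : Set Word) : Set ℕ :=
  {i | ¬ StructIso (level (initialSegments S) i) (level (initialSegments S) (i + 1)) ∨
    ∃ u ∈ level (initialSegments S) (i + 1), ∃ v ∈ level (initialSegments S) (i + 1),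
      ¬ Compatible u v ∧ Compatible (u.take i) (v.take i)}

open Classical in
/-- Delete from a word all letters whose index is not in `I`. -/
noncomputable def keepIndices (I : Set ℕ) (w : Word) : Word :=
  (w.zipIdx.filter (fun p => decide (p.2 ∈ I))).map Prod.fst

/-- The embedding type of `S`. -/
noncomputable def embeddingType (S : Set Word) : Set Word :=
  keepIndices (interesting S) '' S

/-! ### The generic partial order -/

/-- A partial order is generic if it is countable, homogeneous, and contains a copy of every
countable partial order. -/
structure IsGenericPartialOrder (P : Type*) [PartialOrder P] : Prop where
  countable : Countable P
  homogeneous : ∀ (s t : Finset P) (e : s ≃o t), ∃ g : P ≃o P, ∀ x : s, g x = e x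
  universal : ∀ (Q : Type) [PartialOrder Q] [Countable Q], Nonempty (Q ↪o P)

/-- `ψ` is an embedding of `P` into words with `≼`, the initial segments of its values form a
poset-type, and its values are leaves of that poset-type. -/
structure IsPosetTypeEmbedding {P : Type*} [PartialOrder P] (ψ : P → Word) : Prop where
  injective : Function.Injective ψ
  le_iff : ∀ p q : P, p ≤ q ↔ PrecEq (ψ p) (ψ q)
  isPosetType : IsPosetType (initialSegments (Set.range ψ))
  mem_leaves : ∀ p : P, ψ p ∈ leaves (initialSegments (Set.range ψ))

/-- The colour of an embedding of `A` into `P`: the embedding type of the image of `A` in the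
words, as a tree, that is, together with all initial segments. -/
noncomputable def color {P : Type*} [PartialOrder P] (ψ : P → Word) {A : Type*} [PartialOrder A]
    (g : A ↪o P) : Set Word :=
  initialSegments (embeddingType (ψ '' Set.range g))

end PosetType

namespace PosetType

/-! On a level of a poset-type a separated pair (`L` against `R` at some position) is comparable
letter by letter. Hence `≺` is `Sep` there, `⊥` is incomparability for `Below`, and the
lexicographic order is a linear extension of `Below`. A step to the next level changes this
structure as little as possible: it drops a word related to all others, splits one word, removes one
pair from `Below`, or adds one pair to `Sep` (`Step.below_snoc`, `Step.sep_snoc`).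

Colours are types. In the tree of a set of leaves, each step of the large tree either survives as a
step of the same kind or leaves the structure unchanged (`trivial_or_genuine`), and counting shows
that a surviving step does change it (`Step.not_structIso`). The interesting levels are therefore
those with surviving steps, and deleting the others yields a poset-type whose leaves copy the coded
order.

Every type `R` is a colour. The levels of `R` are copied one after another into the tree `S` of `ψ`.
With each copied level goes a `Spread`: above every copied word a family of points indexed by `P`,
whose mutual order is as free as the level permits. Since `P` is universal, every countable order
consistent with the level occurs among these points. To force the next step, one more point `x` is
placed whose order relations bear witness to the change; for a new `≼` from `v` to `w`, it lies
above the points over `v` and below those over `w`. Its code is a finite word, so the change must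
have happened by the end of that word. Indivisibility of `P` makes the relevant prefixes of codes
constant on each family (`Spread.refine`). The first level at which the copies change structure then
performs exactly the required step (`exists_critical_level`). Nothing changes between such levels,
so the embedding type of the chosen leaves gives back `R` itself.

Existence of `ψ`. All points are coded simultaneously by words cut off at a finite height, and
points are made final one by one. For a point `x`, branchings decide which points lie above or below
`x`, new pairs of `⊥` remove comparisons of words that contradict this, and new pairs of `≼` confirm
the rest. The word of `x` is then related to all others and may be dropped
(`PartialCoding.exists_final`). -/

/-! ### Letterwise comparison and separation of words -/

/-- Every letter of `u` is at most the letter of `v` at the same position. -/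
def Below (u v : Word) : Prop :=
  ∀ (i : ℕ) (a b : Letter), u[i]? = some a → v[i]? = some b → a ≤ b

/-- At some position `u` has `L` and `v` has `R`. -/
def Sep (u v : Word) : Prop := ∃ i : ℕ, u[i]? = some Letter.L ∧ v[i]? = some Letter.R

theorem Below.refl (u : Word) : Below u u := by
  intro i a b h h'
  rw [h] at h'
  exact (Option.some.inj h').le

theorem Below.trans {u v w : Word} (huv : Below u v) (hvw : Below v w)
    (h : u.length ≤ v.length) : Below u w := by
  intro i a b ha hb
  have hi : i < v.length := lt_of_lt_of_le (List.getElem?_eq_some_iff.1 ha).1 h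
  exact (huv i a _ ha (List.getElem?_eq_getElem hi)).trans
    (hvw i _ b (List.getElem?_eq_getElem hi) hb)

theorem Below.antisymm {u v : Word} (huv : Below u v) (hvu : Below v u)
    (h : u.length = v.length) : u = v := by
  apply List.ext_getElem h
  intro i h₁ h₂
  exact le_antisymm (huv i _ _ (List.getElem?_eq_getElem h₁) (List.getElem?_eq_getElem h₂))
    (hvu i _ _ (List.getElem?_eq_getElem h₂) (List.getElem?_eq_getElem h₁))

theorem not_sep_self (u : Word) : ¬ Sep u u := by
  rintro ⟨i, h, h'⟩
  rw [h] at h'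
  exact absurd (Option.some.inj h') (by decide)

/-- `R` is the greatest letter, so raising the upper word keeps it; the length hypothesis keeps the
separating position inside `w`. -/
theorem Sep.trans_below {u v w : Word} (huv : Sep u v) (hvw : Below v w)
    (h : v.length ≤ w.length) : Sep u w := by
  obtain ⟨i, hu, hv⟩ := huv
  have hi : i < w.length := lt_of_lt_of_le (List.getElem?_eq_some_iff.1 hv).1 h
  refine ⟨i, hu, ?_⟩
  have := hvw i _ _ hv (List.getElem?_eq_getElem hi)
  rw [List.getElem?_eq_getElem hi]
  generalize w[i] = c at *
  revert this; cases c <;> decide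

theorem Below.trans_sep {u v w : Word} (huv : Below u v) (hvw : Sep v w)
    (h : v.length ≤ u.length) : Sep u w := by
  obtain ⟨i, hv, hw⟩ := hvw
  have hi : i < u.length := lt_of_lt_of_le (List.getElem?_eq_some_iff.1 hv).1 h
  refine ⟨i, ?_, hw⟩
  have := huv i _ _ (List.getElem?_eq_getElem hi) hv
  rw [List.getElem?_eq_getElem hi]
  generalize u[i] = c at *
  revert this; cases c <;> decide

theorem getElem?_take_eq_some {u : Word} {n i : ℕ} {a : Letter} :
    (u.take n)[i]? = some a ↔ i < n ∧ u[i]? = some a := by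
  rw [List.getElem?_take]
  split_ifs with h <;> simp [h]

theorem Below.take {u v : Word} (h : Below u v) (m n : ℕ) : Below (u.take m) (v.take n) :=
  fun i a b ha hb => h i a b (getElem?_take_eq_some.1 ha).2 (getElem?_take_eq_some.1 hb).2

theorem Sep.of_take {u v : Word} {m n : ℕ} (h : Sep (u.take m) (v.take n)) : Sep u v := by
  obtain ⟨i, hu, hv⟩ := h
  exact ⟨i, (getElem?_take_eq_some.1 hu).2, (getElem?_take_eq_some.1 hv).2⟩

theorem sep_take_right {u v : Word} {n : ℕ} (h : u.length ≤ n) : Sep u (v.take n) ↔ Sep u v := by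
  refine ⟨fun ⟨i, hu, hv⟩ => ⟨i, hu, (getElem?_take_eq_some.1 hv).2⟩, fun ⟨i, hu, hv⟩ =>
    ⟨i, hu, getElem?_take_eq_some.2 ⟨?_, hv⟩⟩⟩
  exact lt_of_lt_of_le (List.getElem?_eq_some_iff.1 hu).1 h

theorem sep_take_left {u v : Word} {n : ℕ} (h : v.length ≤ n) : Sep (u.take n) v ↔ Sep u v := by
  refine ⟨fun ⟨i, hu, hv⟩ => ⟨i, (getElem?_take_eq_some.1 hu).2, hv⟩, fun ⟨i, hu, hv⟩ =>
    ⟨i, getElem?_take_eq_some.2 ⟨?_, hu⟩, hv⟩⟩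
  exact lt_of_lt_of_le (List.getElem?_eq_some_iff.1 hv).1 h

theorem below_take_right {u v : Word} {n : ℕ} (h : u.length ≤ n) :
    Below u (v.take n) ↔ Below u v := by
  refine ⟨fun H i a b ha hb => H i a b ha (getElem?_take_eq_some.2 ⟨?_, hb⟩),
    fun H i a b ha hb => H i a b ha (getElem?_take_eq_some.1 hb).2⟩
  exact lt_of_lt_of_le (List.getElem?_eq_some_iff.1 ha).1 h

theorem below_take_left {u v : Word} {n : ℕ} (h : v.length ≤ n) :
    Below (u.take n) v ↔ Below u v := by
  refine ⟨fun H i a b ha hb => H i a b (getElem?_take_eq_some.2 ⟨?_, ha⟩) hb,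
    fun H i a b ha hb => H i a b (getElem?_take_eq_some.1 ha).2 hb⟩
  exact lt_of_lt_of_le (List.getElem?_eq_some_iff.1 hb).1 h

theorem getElem?_snoc_eq_some {u : Word} {c a : Letter} {i : ℕ} :
    (u ++ [c])[i]? = some a ↔ u[i]? = some a ∨ (i = u.length ∧ a = c) := by
  rw [List.getElem?_append]
  split_ifs with h
  · simp [h.ne]
  · rw [List.getElem?_eq_none (Nat.le_of_not_lt h), List.getElem?_singleton]
    split_ifs with h'
    · have : i = u.length := by omega
      simp [this, eq_comm]
    · have : i ≠ u.length := by omega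
      simp [this]

theorem below_snoc_iff {u v : Word} {c c' : Letter} (h : u.length = v.length) :
    Below (u ++ [c]) (v ++ [c']) ↔ Below u v ∧ c ≤ c' := by
  constructor
  · intro H
    exact ⟨fun i a b ha hb => H i a b (getElem?_snoc_eq_some.2 (.inl ha))
      (getElem?_snoc_eq_some.2 (.inl hb)), H u.length c c'
      (getElem?_snoc_eq_some.2 (.inr ⟨rfl, rfl⟩)) (getElem?_snoc_eq_some.2 (.inr ⟨h, rfl⟩))⟩
  · rintro ⟨H, hc⟩ i a b ha hb
    rcases getElem?_snoc_eq_some.1 ha with ha' | ⟨hi, rfl⟩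
    · have : i < u.length := (List.getElem?_eq_some_iff.1 ha').1
      rcases getElem?_snoc_eq_some.1 hb with hb' | ⟨hi', rfl⟩
      · exact H i a b ha' hb'
      · omega
    · rcases getElem?_snoc_eq_some.1 hb with hb' | ⟨hi', rfl⟩
      · have : i < v.length := (List.getElem?_eq_some_iff.1 hb').1
        omega
      · exact hc

theorem sep_snoc_iff {u v : Word} {c c' : Letter} (h : u.length = v.length) :
    Sep (u ++ [c]) (v ++ [c']) ↔ Sep u v ∨ (c = Letter.L ∧ c' = Letter.R) := by
  constructor
  · rintro ⟨i, hu, hv⟩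
    rcases getElem?_snoc_eq_some.1 hu with ha' | ⟨hi, hc⟩
    · have : i < u.length := (List.getElem?_eq_some_iff.1 ha').1
      rcases getElem?_snoc_eq_some.1 hv with hb' | ⟨hi', _⟩
      · exact .inl ⟨i, ha', hb'⟩
      · omega
    · rcases getElem?_snoc_eq_some.1 hv with hb' | ⟨hi', hc'⟩
      · have : i < v.length := (List.getElem?_eq_some_iff.1 hb').1
        omega
      · exact .inr ⟨hc.symm, hc'.symm⟩
  · rintro (⟨i, hu, hv⟩ | ⟨rfl, rfl⟩)
    · exact ⟨i, getElem?_snoc_eq_some.2 (.inl hu), getElem?_snoc_eq_some.2 (.inl hv)⟩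
    · exact ⟨u.length, getElem?_snoc_eq_some.2 (.inr ⟨rfl, rfl⟩),
        getElem?_snoc_eq_some.2 (.inr ⟨h, rfl⟩)⟩

theorem not_below_iff {u v : Word} :
    ¬ Below u v ↔ ∃ (j : ℕ) (h : j < u.length) (h' : j < v.length), v[j] < u[j] := by
  constructor
  · intro H
    simp only [Below, not_forall, not_le] at H
    obtain ⟨i, a, b, ha, hb, hlt⟩ := H
    obtain ⟨h1, rfl⟩ := List.getElem?_eq_some_iff.1 ha
    obtain ⟨h2, rfl⟩ := List.getElem?_eq_some_iff.1 hb
    exact ⟨i, h1, h2, hlt⟩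
  · rintro ⟨j, h, h', hlt⟩ H
    exact absurd (H j _ _ (List.getElem?_eq_getElem h) (List.getElem?_eq_getElem h')) (not_le.2 hlt)

theorem perp_iff {u v : Word} : Perp u v ↔ ¬ Below u v ∧ ¬ Below v u := by
  rw [not_below_iff, not_below_iff, Perp, and_comm]
  constructor
  · rintro ⟨h, ⟨i, h1, h2, h3⟩⟩; exact ⟨h, i, h2, h1, h3⟩
  · rintro ⟨h, ⟨i, h1, h2, h3⟩⟩; exact ⟨h, i, h2, h1, h3⟩

theorem Prec.sep {u v : Word} (h : Prec u v) : Sep u v := by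
  obtain ⟨i, h1, h2, hu, hv, -⟩ := h
  exact ⟨i, by rw [List.getElem?_eq_getElem h1, hu], by rw [List.getElem?_eq_getElem h2, hv]⟩

theorem Sep.prec {u v : Word} (h : Sep u v) (hb : Below u v) : Prec u v := by
  obtain ⟨i, hu, hv⟩ := h
  obtain ⟨h1, hu⟩ := List.getElem?_eq_some_iff.1 hu
  obtain ⟨h2, hv⟩ := List.getElem?_eq_some_iff.1 hv
  exact ⟨i, h1, h2, hu, hv, fun j hj => hb j _ _ (List.getElem?_eq_getElem _)
    (List.getElem?_eq_getElem _)⟩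

theorem lt_append_of_lt {u v : Word} (h : u.length = v.length) (hlt : u < v) (x y : Word) :
    u ++ x < v ++ y := by
  induction u generalizing v with
  | nil =>
    cases v with
    | nil => exact absurd hlt (lt_irrefl _)
    | cons b v => simp at h
  | cons a u ih =>
    cases v with
    | nil => simp at h
    | cons b v =>
      rw [List.cons_append, List.cons_append, List.cons_lt_cons_iff]
      rw [List.cons_lt_cons_iff] at hlt
      simp only [List.length_cons, Nat.add_right_cancel_iff] at h
      exact hlt.imp id fun ⟨h1, h2⟩ => ⟨h1, ih h h2⟩

theorem lt_of_take_lt {u v : Word} {n : ℕ} (h : (u.take n).length = (v.take n).length)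
    (hlt : u.take n < v.take n) : u < v := by
  have := lt_append_of_lt h hlt (u.drop n) (v.drop n)
  rwa [List.take_append_drop, List.take_append_drop] at this

theorem snoc_lt_snoc_iff {u v : Word} {c c' : Letter} (h : u.length = v.length) :
    u ++ [c] < v ++ [c'] ↔ u < v ∨ (u = v ∧ c < c') := by
  constructor
  · intro H
    rcases lt_trichotomy u v with h1 | rfl | h1
    · exact .inl h1
    · refine .inr ⟨rfl, ?_⟩
      have : [c] < [c'] := by
        by_contra hh
        rw [not_lt] at hh
        rcases hh.lt_or_eq with hh | hh
        · refine lt_asymm H ?_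
          clear H
          induction u with
          | nil => exact hh
          | cons a u ih =>
            rw [List.cons_append, List.cons_append, List.cons_lt_cons_iff]
            exact .inr ⟨rfl, ih rfl⟩
        · rw [hh] at H; exact lt_irrefl _ H
      rw [List.cons_lt_cons_iff] at this
      simpa using this
    · exact absurd H (lt_asymm (lt_append_of_lt h.symm h1 _ _))
  · rintro (h1 | ⟨rfl, h1⟩)
    · exact lt_append_of_lt h h1 _ _
    · clear h
      induction u with
      | nil => exact List.cons_lt_cons_iff.2 (.inl h1)
      | cons a u ih =>
        rw [List.cons_append, List.cons_append, List.cons_lt_cons_iff]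
        exact .inr ⟨rfl, ih⟩

theorem Below.le {u v : Word} (h : Below u v) (hl : u.length = v.length) : u ≤ v := by
  induction u generalizing v with
  | nil =>
    cases v with
    | nil => exact le_refl _
    | cons b v => simp at hl
  | cons a u ih =>
    cases v with
    | nil => simp at hl
    | cons b v =>
      rw [← not_lt, List.cons_lt_cons_iff]
      have h0 : a ≤ b := h 0 a b rfl rfl
      have h1 : u ≤ v := ih (fun i a b ha hb => h (i + 1) a b (by simpa using ha) (by simpa using hb))
        (by simpa using hl)
      rintro (h2 | ⟨-, h2⟩)
      · exact absurd h2 (not_lt.2 h0)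
      · exact absurd h2 (not_lt.2 h1)

theorem Below.lt {u v : Word} (h : Below u v) (hl : u.length = v.length) (hne : u ≠ v) : u < v :=
  lt_of_le_of_ne (h.le hl) hne

/-! ### Levels and their isomorphisms -/

/-- Words of the same length `n` in which a separated pair is comparable letter by letter. -/
structure IsLevel (n : ℕ) (U : Set Word) : Prop where
  length : ∀ u ∈ U, u.length = n
  below : ∀ u ∈ U, ∀ v ∈ U, Sep u v → Below u v

namespace IsLevel
variable {n : ℕ} {U : Set Word} {u v w : Word}

theorem mono {V : Set Word} (hU : IsLevel n U) (h : V ⊆ U) : IsLevel n V :=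
  ⟨fun u hu => hU.length u (h hu), fun u hu v hv => hU.below u (h hu) v (h hv)⟩

theorem length_eq (hU : IsLevel n U) (hu : u ∈ U) (hv : v ∈ U) : u.length = v.length :=
  (hU.length u hu).trans (hU.length v hv).symm

theorem prec_iff (hU : IsLevel n U) (hu : u ∈ U) (hv : v ∈ U) : Prec u v ↔ Sep u v :=
  ⟨Prec.sep, fun h => h.prec (hU.below u hu v hv h)⟩

theorem precEq_iff (hU : IsLevel n U) (hu : u ∈ U) (hv : v ∈ U) :
    PrecEq u v ↔ u = v ∨ Sep u v := by rw [PrecEq, hU.prec_iff hu hv]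

theorem related_iff (hU : IsLevel n U) (hu : u ∈ U) (hv : v ∈ U) :
    Related u v ↔ u = v ∨ Sep u v ∨ Sep v u ∨ (¬ Below u v ∧ ¬ Below v u) := by
  rw [Related, hU.precEq_iff hu hv, hU.precEq_iff hv hu, perp_iff]
  tauto

theorem below_trans (hU : IsLevel n U) (hu : u ∈ U) (hv : v ∈ U)
    (huv : Below u v) (hvw : Below v w) : Below u w :=
  huv.trans hvw (hU.length_eq hu hv).le

theorem below_antisymm (hU : IsLevel n U) (hu : u ∈ U) (hv : v ∈ U)
    (huv : Below u v) (hvu : Below v u) : u = v :=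
  huv.antisymm hvu (hU.length_eq hu hv)

theorem below_le (hU : IsLevel n U) (hu : u ∈ U) (hv : v ∈ U) (huv : Below u v) : u ≤ v :=
  huv.le (hU.length_eq hu hv)

theorem sep_below (hU : IsLevel n U) (hv : v ∈ U) (hw : w ∈ U)
    (huv : Sep u v) (hvw : Below v w) : Sep u w :=
  huv.trans_below hvw (hU.length_eq hv hw).le

theorem below_sep (hU : IsLevel n U) (hu : u ∈ U) (hv : v ∈ U)
    (huv : Below u v) (hvw : Sep v w) : Sep u w :=
  huv.trans_sep hvw (hU.length_eq hv hu).le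

/-- A letter `R` in the smaller word against `L` in the larger one would separate the pair in the
wrong direction and so reverse the lexicographic order. A pair separated in the right direction is
`Below`, hence not `⊥`. -/
theorem compatible (hU : IsLevel n U) (hu : u ∈ U) (hv : v ∈ U) : Compatible u v := by
  have key : ∀ u ∈ U, ∀ v ∈ U, u ≤ v → CompatibleOfLE u v := by
    intro u hu v hv huv
    constructor
    · rintro ⟨i, h, h', h1, h2⟩
      have hs : Sep v u := ⟨i, by rw [List.getElem?_eq_getElem h', h2],
        by rw [List.getElem?_eq_getElem h, h1]⟩
      have := (hU.below_le hv hu (hU.below v hv u hu hs)).antisymm huv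
      subst this
      exact not_sep_self _ hs
    · rintro ⟨i, h, h', h1, h2⟩
      have hs : Sep u v := ⟨i, by rw [List.getElem?_eq_getElem h, h1],
        by rw [List.getElem?_eq_getElem h', h2]⟩
      have hb := hU.below u hu v hv hs
      exact ⟨hs.prec hb, fun hp => (perp_iff.1 hp).1 hb⟩
  rcases le_total u v with h | h
  · exact .inl ⟨h, key u hu v hv h⟩
  · exact .inr ⟨h, key v hv u hu h⟩

end IsLevel

/-- `e` preserves and reflects the lexicographic order, `Below` and `Sep` on `U`. -/
structure IsoOn (e : Word → Word) (U : Set Word) : Prop where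
  lt_iff : ∀ u ∈ U, ∀ v ∈ U, (e u < e v ↔ u < v)
  below_iff : ∀ u ∈ U, ∀ v ∈ U, (Below (e u) (e v) ↔ Below u v)
  sep_iff : ∀ u ∈ U, ∀ v ∈ U, (Sep (e u) (e v) ↔ Sep u v)

namespace IsoOn
variable {e : Word → Word} {U : Set Word} {u v : Word}

theorem eq_iff (he : IsoOn e U) (hu : u ∈ U) (hv : v ∈ U) : e u = e v ↔ u = v := by
  refine ⟨fun h => ?_, fun h => h ▸ rfl⟩
  rcases lt_trichotomy u v with h' | h' | h'
  · exact absurd ((he.lt_iff u hu v hv).2 h') (by rw [h]; exact lt_irrefl _)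
  · exact h'
  · exact absurd ((he.lt_iff v hv u hu).2 h') (by rw [h]; exact lt_irrefl _)

theorem injOn (he : IsoOn e U) : Set.InjOn e U := fun _ hu _ hv => (he.eq_iff hu hv).1

theorem le_iff (he : IsoOn e U) (hu : u ∈ U) (hv : v ∈ U) : e u ≤ e v ↔ u ≤ v := by
  rw [← not_lt, ← not_lt, he.lt_iff v hv u hu]

theorem perp_iff (he : IsoOn e U) (hu : u ∈ U) (hv : v ∈ U) : Perp (e u) (e v) ↔ Perp u v := by
  rw [PosetType.perp_iff, PosetType.perp_iff, he.below_iff u hu v hv, he.below_iff v hv u hu]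

theorem isLevel {n m : ℕ} (he : IsoOn e U) (hU : IsLevel n U) (hl : ∀ u ∈ U, (e u).length = m) :
    IsLevel m (e '' U) := by
  constructor
  · rintro _ ⟨u, hu, rfl⟩; exact hl u hu
  · rintro _ ⟨u, hu, rfl⟩ _ ⟨v, hv, rfl⟩ h
    exact (he.below_iff u hu v hv).2 (hU.below u hu v hv ((he.sep_iff u hu v hv).1 h))

theorem prec_iff {n m : ℕ} (he : IsoOn e U) (hU : IsLevel n U) (hU' : IsLevel m (e '' U))
    (hu : u ∈ U) (hv : v ∈ U) : Prec (e u) (e v) ↔ Prec u v := by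
  rw [hU'.prec_iff ⟨u, hu, rfl⟩ ⟨v, hv, rfl⟩, hU.prec_iff hu hv, he.sep_iff u hu v hv]

theorem precEq_iff {n m : ℕ} (he : IsoOn e U) (hU : IsLevel n U) (hU' : IsLevel m (e '' U))
    (hu : u ∈ U) (hv : v ∈ U) : PrecEq (e u) (e v) ↔ PrecEq u v := by
  rw [PrecEq, PrecEq, he.prec_iff hU hU' hu hv, he.eq_iff hu hv]

theorem related_iff {n m : ℕ} (he : IsoOn e U) (hU : IsLevel n U) (hU' : IsLevel m (e '' U))
    (hu : u ∈ U) (hv : v ∈ U) : Related (e u) (e v) ↔ Related u v := by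
  rw [Related, Related, he.precEq_iff hU hU' hu hv, he.precEq_iff hU hU' hv hu,
    he.perp_iff hu hv]

theorem structIso {n m : ℕ} (he : IsoOn e U) (hU : IsLevel n U) (hU' : IsLevel m (e '' U)) :
    StructIso U (e '' U) :=
  ⟨Equiv.Set.imageOfInjOn e U he.injOn, fun u v =>
    ⟨(he.le_iff u.2 v.2).symm, (he.precEq_iff hU hU' u.2 v.2).symm,
      (he.perp_iff u.2 v.2).symm⟩⟩

end IsoOn

theorem StructIso.symm {U V : Set Word} (h : StructIso U V) : StructIso V U := by
  obtain ⟨e, he⟩ := h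
  refine ⟨e.symm, fun u v => ?_⟩
  have := he (e.symm u) (e.symm v)
  simp only [Equiv.apply_symm_apply] at this
  exact ⟨this.1.symm, this.2.1.symm, this.2.2.symm⟩

theorem StructIso.trans {U V W : Set Word} (h : StructIso U V) (h' : StructIso V W) :
    StructIso U W := by
  obtain ⟨e, he⟩ := h
  obtain ⟨e', he'⟩ := h'
  exact ⟨e.trans e', fun u v => ⟨(he u v).1.trans (he' _ _).1,
    (he u v).2.1.trans (he' _ _).2.1, (he u v).2.2.trans (he' _ _).2.2⟩⟩

/-! ### Steps between consecutive levels -/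

/-- A step from one level to the next, with its witnesses. -/
inductive Step : Type where
  | leaf (w : Word)
  | branch (w : Word)
  | perp (v w : Word)
  | prec (v w : Word)

namespace Step

def kind : Step → StepKind
  | leaf _ => .leaf
  | branch _ => .branching
  | perp _ _ => .newPerp
  | prec _ _ => .newPrec

/-- The conditions on the witnesses of a step at the level `U`. -/
def Valid (U : Set Word) : Step → Prop
  | leaf w => w ∈ U ∧ ∀ u ∈ U, u ≠ w → Related w u
  | branch w => w ∈ U
  | perp v w => v ∈ U ∧ w ∈ U ∧ v < w ∧ ¬ Related v w ∧
      ∀ u ∈ U, v < u → u < w → Perp u v ∨ Perp u w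
  | prec v w => v ∈ U ∧ w ∈ U ∧ v < w ∧ ¬ Related v w ∧
      (∀ u ∈ U, u < v → PrecEq u w ∨ Perp u v) ∧ (∀ u ∈ U, w < u → PrecEq v u ∨ Perp w u)

/-- The letters which a step allows to be added to a word. -/
def Allowed : Step → Word → Letter → Prop
  | leaf w, z, c => z ≠ w ∧ c = .X
  | branch w, z, c => (z < w ∧ c = .X) ∨ (z = w ∧ (c = .X ∨ c = .R)) ∨ (w < z ∧ c = .R)
  | perp v w, z, c => (z < v ∧ c = .X) ∨ (z = v ∧ c = .R) ∨
      (v < z ∧ z < w ∧ Perp z v ∧ c = .X) ∨ (v < z ∧ z < w ∧ ¬ Perp z v ∧ c = .R) ∨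
      (z = w ∧ c = .X) ∨ (w < z ∧ c = .R)
  | prec v w, z, c => (z < v ∧ Perp z v ∧ c = .X) ∨ (z < v ∧ ¬ Perp z v ∧ c = .L) ∨
      (z = v ∧ c = .L) ∨ (v < z ∧ z < w ∧ c = .X) ∨ (z = w ∧ c = .R) ∨
      (w < z ∧ Perp w z ∧ c = .X) ∨ (w < z ∧ ¬ Perp w z ∧ c = .R)

/-- The next level. -/
def Next (d : Step) (U : Set Word) : Set Word :=
  {y | ∃ z ∈ U, ∃ c, d.Allowed z c ∧ y = z ++ [c]}

/-- The pairs of extended words that cease to satisfy `Below` at a step. -/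
def Kills : Step → Word → Word → Letter → Letter → Prop
  -- Both extended words come from `w`, which is below itself; of the two children only the left one
  -- is below the other.
  | branch w, z, z', c, c' => z = w ∧ z' = w ∧ c = .R ∧ c' = .X
  | perp v w, z, z', _, _ => z = v ∧ z' = w
  | _, _, _, _, _ => False

/-- The pairs of words that begin to satisfy `Sep` at a step. -/
def Makes : Step → Word → Word → Prop
  | prec v w, z, z' => z = v ∧ z' = w
  | _, _, _ => False

def map (e : Word → Word) : Step → Step
  | leaf w => leaf (e w)
  | branch w => branch (e w)
  | perp v w => perp (e v) (e w)
  | prec v w => prec (e v) (e w)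

variable {d : Step} {U : Set Word} {z z' : Word} {c c' : Letter} {n : ℕ}

theorem exists_allowed (hd : d.Valid U) (hz : ∀ w, d = leaf w → z ≠ w) : ∃ c, d.Allowed z c := by
  cases d with
  | leaf w => exact ⟨.X, hz w rfl, rfl⟩
  | branch w =>
    rcases lt_trichotomy z w with h | h | h
    · exact ⟨.X, .inl ⟨h, rfl⟩⟩
    · exact ⟨.X, .inr (.inl ⟨h, .inl rfl⟩)⟩
    · exact ⟨.R, .inr (.inr ⟨h, rfl⟩)⟩
  | perp v w =>
    rcases lt_trichotomy z v with h | h | h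
    · exact ⟨.X, by simp [Allowed, h]⟩
    · exact ⟨.R, by simp [Allowed, h]⟩
    · rcases lt_trichotomy z w with h' | h' | h'
      · by_cases hp : Perp z v
        · exact ⟨.X, by simp [Allowed, h, h', hp]⟩
        · exact ⟨.R, by simp [Allowed, h, h', hp]⟩
      · exact ⟨.X, by simp [Allowed, h']⟩
      · exact ⟨.R, by simp [Allowed, h']⟩
  | prec v w =>
    rcases lt_trichotomy z v with h | h | h
    · by_cases hp : Perp z v
      · exact ⟨.X, by simp [Allowed, h, hp]⟩
      · exact ⟨.L, by simp [Allowed, h, hp]⟩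
    · exact ⟨.L, by simp [Allowed, h]⟩
    · rcases lt_trichotomy z w with h' | h' | h'
      · exact ⟨.X, by simp [Allowed, h, h']⟩
      · exact ⟨.R, by simp [Allowed, h']⟩
      · by_cases hp : Perp w z
        · exact ⟨.X, by simp [Allowed, h', hp]⟩
        · exact ⟨.R, by simp [Allowed, h', hp]⟩

theorem allowed_unique (hd : d.Valid U) (h : d.Allowed z c) (h' : d.Allowed z c')
    (hb : d ≠ branch z) : c = c' := by
  cases d with
  | leaf w => rw [h.2, h'.2]
  | branch w =>
    have hw : z ≠ w := fun hh => hb (by rw [hh])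
    simp only [Allowed] at h h'
    grind
  | perp v w =>
    obtain ⟨-, -, hvw, -, -⟩ := hd
    simp only [Allowed] at h h'
    grind
  | prec v w =>
    obtain ⟨-, -, hvw, -, -⟩ := hd
    simp only [Allowed] at h h'
    grind

/-- At a new `≼` the words receiving `L` are those `Below` `v`, a down-set, and the words receiving
`R` are those above `w`, an up-set, so letters are monotone. At a new `⊥` monotonicity can only fail
with `R` under `X`, and the absence of words between `v` and `w` leaves the pair `(v, w)` alone. -/
theorem allowed_le_iff (hU : IsLevel n U) (hd : d.Valid U) (hz : z ∈ U) (hz' : z' ∈ U)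
    (h : d.Allowed z c) (h' : d.Allowed z' c') (hb : Below z z') :
    c ≤ c' ↔ ¬ d.Kills z z' c c' := by
  have hle := hU.below_le hz hz' hb
  have hXR : Letter.X ≤ Letter.R := by decide
  have hRX : ¬ Letter.R ≤ Letter.X := by decide
  have hLX : Letter.L ≤ Letter.X := by decide
  have hLR : Letter.L ≤ Letter.R := by decide
  cases d with
  | leaf w => simp [h.2, h'.2, Kills]
  | branch w =>
    simp only [Allowed, Kills] at *
    grind
  | perp v w =>
    obtain ⟨hv, hw, hvw, hr, hc⟩ := hd
    have hbv := hU.below_trans (w := z') (u := v) (v := z) hv hz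
    have hbw := hU.below_trans (w := w) (u := z) (v := z') hz hz'
    have l1 := hU.below_le hz hv
    simp only [perp_iff] at hc h h'
    simp only [Allowed, Kills, perp_iff] at *
    constructor
    · rintro hcc ⟨rfl, rfl⟩
      have : c = .R := by grind
      have : c' = .X := by grind
      grind
    · intro hk
      by_contra hcc
      have hcR : c = .R ∧ c' = .X := by grind
      obtain ⟨rfl, rfl⟩ := hcR
      have h1 : z = v ∨ (v < z ∧ z < w ∧ ¬ (¬ Below z v ∧ ¬ Below v z)) ∨ w < z := by grind
      have h2 : z' < v ∨ (v < z' ∧ z' < w ∧ (¬ Below z' v ∧ ¬ Below v z')) ∨ z' = w := by grind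
      have h3 := hc z hz
      have l2 : v < z → ¬ Below z v := fun h h' => absurd (l1 h') (not_le.2 h)
      have l3 : z < w → ¬ Below w z := fun h h' => absurd (hU.below_le hw hz h') (not_le.2 h)
      rcases h1 with rfl | h1 | h1
      · grind
      -- Now `z'` is above `v`, so it must be `w`; then `z` lies between `v` and `w` for `Below`,
      -- which validity excludes.
      · have : Below v z := by grind
        grind
      · grind
  | prec v w =>
    obtain ⟨hv, hw, hvw, hr, hc1, hc2⟩ := hd
    simp only [Kills, not_false_eq_true, iff_true]
    have l1 : z < v → ¬ Below v z := fun h h' => absurd (hU.below_le hv hz h') (not_le.2 h)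
    have l2 : z' < v → ¬ Below v z' := fun h h' => absurd (hU.below_le hv hz' h') (not_le.2 h)
    have l3 : w < z → ¬ Below z w := fun h h' => absurd (hU.below_le hz hw h') (not_le.2 h)
    have l4 : w < z' → ¬ Below z' w := fun h h' => absurd (hU.below_le hz' hw h') (not_le.2 h)
    have hbv := hU.below_trans (w := v) (u := z) (v := z') hz hz'
    have hbw := hU.below_trans (w := z') (u := w) (v := z) hw hz
    simp only [Allowed, perp_iff] at *
    by_contra hcc
    have h3 : c ≠ .L := by rintro rfl; revert hcc; cases c' <;> decide
    have h4 : c' ≠ .R := by rintro rfl; revert hcc; cases c <;> decide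
    have h5 : c ≠ c' := by rintro rfl; exact hcc le_rfl
    rcases h with h | h | h | h | h | h | h <;> grind

theorem below_snoc (hU : IsLevel n U) (hd : d.Valid U) (hz : z ∈ U) (hz' : z' ∈ U)
    (h : d.Allowed z c) (h' : d.Allowed z' c') :
    Below (z ++ [c]) (z' ++ [c']) ↔ Below z z' ∧ ¬ d.Kills z z' c c' := by
  rw [below_snoc_iff (hU.length_eq hz hz')]
  exact and_congr_right (allowed_le_iff hU hd hz hz' h h')

theorem valid_prec_below {v w : Word} (hd : (prec v w).Valid U) (hU : IsLevel n U) :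
    Below v w ∧ ¬ Sep v w := by
  obtain ⟨hv, hw, hvw, hr, -⟩ := hd
  rw [hU.related_iff hv hw] at hr
  have : ¬ Below w v := fun h => absurd (hU.below_le hw hv h) (not_le.2 hvw)
  tauto

theorem valid_perp_below {v w : Word} (hd : (perp v w).Valid U) (hU : IsLevel n U) :
    Below v w ∧ ¬ Sep v w := by
  obtain ⟨hv, hw, hvw, hr, -⟩ := hd
  rw [hU.related_iff hv hw] at hr
  have : ¬ Below w v := fun h => absurd (hU.below_le hw hv h) (not_le.2 hvw)
  tauto

/-- With `valid_prec_right`, this says that everything which the new pair implies by transitivity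
already holds, so that the step adds that pair alone. -/
theorem valid_prec_left {v w u : Word} (hd : (prec v w).Valid U) (hU : IsLevel n U)
    (hu : u ∈ U) (hne : u ≠ v) (hb : Below u v) : Sep u w := by
  obtain ⟨hv, hw, hvw, -, h, -⟩ := hd
  have hlt := lt_of_le_of_ne (hU.below_le hu hv hb) hne
  rcases h u hu hlt with h | h
  · rcases (hU.precEq_iff hu hw).1 h with rfl | h
    · exact absurd hvw (lt_asymm hlt)
    · exact h
  · exact absurd hb (perp_iff.1 h).1

theorem valid_prec_right {v w u : Word} (hd : (prec v w).Valid U) (hU : IsLevel n U)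
    (hu : u ∈ U) (hne : u ≠ w) (hb : Below w u) : Sep v u := by
  obtain ⟨hv, hw, hvw, -, -, h⟩ := hd
  have hlt := lt_of_le_of_ne (hU.below_le hw hu hb) (Ne.symm hne)
  rcases h u hu hlt with h | h
  · rcases (hU.precEq_iff hv hu).1 h with rfl | h
    · exact absurd hvw (lt_asymm hlt)
    · exact h
  · exact absurd hb (perp_iff.1 h).1

/-- The condition on intermediate words means that `w` covers `v` in the order `Below`, so the pair
can be removed without violating transitivity. -/
theorem valid_perp_cover {v w u : Word} (hd : (perp v w).Valid U) (hU : IsLevel n U)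
    (hu : u ∈ U) (h1 : Below v u) (h2 : Below u w) : u = v ∨ u = w := by
  obtain ⟨hv, hw, hvw, -, h⟩ := hd
  by_contra hne
  push Not at hne
  rcases h u hu (lt_of_le_of_ne (hU.below_le hv hu h1) (Ne.symm hne.1))
    (lt_of_le_of_ne (hU.below_le hu hw h2) hne.2) with h | h
  · exact (perp_iff.1 h).2 h1
  · exact (perp_iff.1 h).1 h2

/-- Only a new `≼` uses `L`. It goes to the words `Below` `v`, while `R` goes to those above `w`,
and validity makes all these pairs separated beforehand except `(v, w)`. -/
theorem sep_snoc (hU : IsLevel n U) (hd : d.Valid U) (hz : z ∈ U) (hz' : z' ∈ U)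
    (h : d.Allowed z c) (h' : d.Allowed z' c') :
    Sep (z ++ [c]) (z' ++ [c']) ↔ Sep z z' ∨ d.Makes z z' := by
  rw [sep_snoc_iff (hU.length_eq hz hz')]
  cases d with
  | leaf w => simp [h.2, h'.2, Makes]
  | branch w => simp only [Allowed, Makes] at *; grind
  | perp v w => simp only [Allowed, Makes] at *; grind
  | prec v w =>
    have k1 := fun h => valid_prec_left hd hU hz (u := z) h
    have k2 := fun h => valid_prec_right hd hU hz' (u := z') h
    obtain ⟨hv, hw, hvw, hr, hc1, hc2⟩ := id hd
    have l1 : z < v → ¬ Below v z := fun h h' => absurd (hU.below_le hv hz h') (not_le.2 h)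
    have l4 : w < z' → ¬ Below z' w := fun h h' => absurd (hU.below_le hz' hw h') (not_le.2 h)
    have hvw' := (valid_prec_below hd hU).1
    simp only [Allowed, Makes, perp_iff] at *
    constructor
    · rintro (hs | ⟨rfl, rfl⟩)
      · exact .inl hs
      · have h1 : z = v ∨ (z ≠ v ∧ Below z v) := by grind
        have h2 : z' = w ∨ (z' ≠ w ∧ Below w z') := by grind
        rcases h1 with rfl | h1
        · rcases h2 with rfl | h2
          · exact .inr ⟨rfl, rfl⟩
          · exact .inl (k2 h2.1 h2.2)
        · refine .inl ?_
          have := k1 h1.1 h1.2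
          rcases h2 with rfl | h2
          · exact this
          · exact hU.sep_below hw hz' this h2.2
    · rintro (hs | ⟨rfl, rfl⟩)
      · exact .inl hs
      · right; grind

/-- A killed pair is never separated, and a pair that becomes separated was `Below` and remains so.
-/
theorem isLevel_next (hU : IsLevel n U) (hd : d.Valid U) : IsLevel (n + 1) (d.Next U) := by
  constructor
  · rintro _ ⟨z, hz, c, -, rfl⟩
    simp [hU.length z hz]
  · rintro _ ⟨z, hz, c, hc, rfl⟩ _ ⟨z', hz', c', hc', rfl⟩ h
    rw [sep_snoc hU hd hz hz' hc hc'] at h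
    rw [below_snoc hU hd hz hz' hc hc']
    rcases h with h | h
    · refine ⟨hU.below z hz z' hz' h, fun hk => ?_⟩
      cases d with
      | leaf w => exact hk
      | branch w =>
        obtain ⟨rfl, rfl, -⟩ := hk
        exact not_sep_self _ h
      | perp v w =>
        obtain ⟨rfl, rfl⟩ := hk
        exact (valid_perp_below hd hU).2 h
      | prec v w => exact hk
    · cases d with
      | prec v w =>
        obtain ⟨rfl, rfl⟩ := h
        exact ⟨(valid_prec_below hd hU).1, id⟩
      | _ => exact h.elim

theorem valid_map {e : Word → Word} {m : ℕ} (hU : IsLevel n U) (he : IsoOn e U)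
    (hU' : IsLevel m (e '' U)) (hd : d.Valid U) : (d.map e).Valid (e '' U) := by
  cases d with
  | leaf w =>
    refine ⟨⟨w, hd.1, rfl⟩, ?_⟩
    rintro _ ⟨u, hu, rfl⟩ hne
    exact (he.related_iff hU hU' hd.1 hu).2 (hd.2 u hu fun h => hne (by rw [h]))
  | branch w => exact ⟨w, hd, rfl⟩
  | perp v w =>
    obtain ⟨hv, hw, hvw, hr, hc⟩ := hd
    refine ⟨⟨v, hv, rfl⟩, ⟨w, hw, rfl⟩, (he.lt_iff v hv w hw).2 hvw,
      by rwa [he.related_iff hU hU' hv hw], ?_⟩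
    rintro _ ⟨u, hu, rfl⟩ h1 h2
    rw [he.perp_iff hu hv, he.perp_iff hu hw]
    exact hc u hu ((he.lt_iff v hv u hu).1 h1) ((he.lt_iff u hu w hw).1 h2)
  | prec v w =>
    obtain ⟨hv, hw, hvw, hr, hc1, hc2⟩ := hd
    refine ⟨⟨v, hv, rfl⟩, ⟨w, hw, rfl⟩, (he.lt_iff v hv w hw).2 hvw,
      by rwa [he.related_iff hU hU' hv hw], ?_, ?_⟩
    · rintro _ ⟨u, hu, rfl⟩ h1
      rw [he.perp_iff hu hv, he.precEq_iff hU hU' hu hw]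
      exact hc1 u hu ((he.lt_iff u hu v hv).1 h1)
    · rintro _ ⟨u, hu, rfl⟩ h1
      rw [he.perp_iff hw hu, he.precEq_iff hU hU' hv hu]
      exact hc2 u hu ((he.lt_iff w hw u hu).1 h1)

theorem allowed_map {e : Word → Word} (he : IsoOn e U) (hd : d.Valid U) (hz : z ∈ U) :
    (d.map e).Allowed (e z) c ↔ d.Allowed z c := by
  cases d with
  | leaf w => simp only [map, Allowed, ne_eq, he.eq_iff hz hd.1]
  | branch w =>
    simp only [map, Allowed, he.eq_iff hz hd, he.lt_iff z hz w hd, he.lt_iff w hd z hz]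
  | perp v w =>
    obtain ⟨hv, hw, -⟩ := hd
    simp only [map, Allowed, he.eq_iff hz hv, he.eq_iff hz hw, he.lt_iff z hz v hv,
      he.lt_iff z hz w hw, he.lt_iff w hw z hz, he.lt_iff v hv z hz, he.perp_iff hz hv]
  | prec v w =>
    obtain ⟨hv, hw, -⟩ := hd
    simp only [map, Allowed, he.eq_iff hz hv, he.eq_iff hz hw, he.lt_iff z hz v hv,
      he.lt_iff z hz w hw, he.lt_iff w hw z hz, he.lt_iff v hv z hz, he.perp_iff hz hv,
      he.perp_iff hw hz]

theorem next_map {e : Word → Word} (he : IsoOn e U) (hd : d.Valid U) :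
    (d.map e).Next (e '' U) = {y | ∃ z ∈ U, ∃ c, d.Allowed z c ∧ y = e z ++ [c]} := by
  ext y
  constructor
  · rintro ⟨_, ⟨z, hz, rfl⟩, c, hc, rfl⟩
    exact ⟨z, hz, c, (allowed_map he hd hz).1 hc, rfl⟩
  · rintro ⟨z, hz, c, hc, rfl⟩
    exact ⟨_, ⟨z, hz, rfl⟩, c, (allowed_map he hd hz).2 hc, rfl⟩

end Step

/-! ### The four conditions as steps, and uniqueness of the kind -/

theorem leafStep_iff {U U' : Set Word} :
    LeafStep U U' ↔ ∃ w, (Step.leaf w).Valid U ∧ U' = (Step.leaf w).Next U := by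
  have key : ∀ w, snocSet (U \ {w}) .X = (Step.leaf w).Next U := by
    intro w; ext y
    simp only [snocSet, Step.Next, Step.Allowed, Set.mem_image, Set.mem_sdiff,
      Set.mem_singleton_iff, Set.mem_ofPred_eq]
    grind
  simp only [LeafStep, Step.Valid, key, Set.mem_sdiff, Set.mem_singleton_iff]
  grind

theorem branchingStep_iff {U U' : Set Word} :
    BranchingStep U U' ↔ ∃ w, (Step.branch w).Valid U ∧ U' = (Step.branch w).Next U := by
  have key : ∀ w ∈ U, snocSet {z | z ∈ U ∧ z < w} .X ∪ {w ++ [.X], w ++ [.R]} ∪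
      snocSet {z | z ∈ U ∧ w < z} .R = (Step.branch w).Next U := by
    intro w hw; ext y
    simp only [snocSet, Step.Next, Step.Allowed, Set.mem_image, Set.mem_union,
      Set.mem_singleton_iff, Set.mem_ofPred_eq, Set.mem_insert_iff]
    grind
  simp only [BranchingStep, Step.Valid]
  exact exists_congr fun w => and_congr_right fun hw => by rw [key w hw]

theorem newPerpStep_iff {U U' : Set Word} :
    NewPerpStep U U' ↔ ∃ v w, (Step.perp v w).Valid U ∧ U' = (Step.perp v w).Next U := by
  have key : ∀ v ∈ U, ∀ w ∈ U, snocSet {z | z ∈ U ∧ z < v} .X ∪ {v ++ [.R]} ∪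
      snocSet {z | z ∈ U ∧ v < z ∧ z < w ∧ Perp z v} .X ∪
      snocSet {z | z ∈ U ∧ v < z ∧ z < w ∧ ¬ Perp z v} .R ∪
      {w ++ [.X]} ∪ snocSet {z | z ∈ U ∧ w < z} .R = (Step.perp v w).Next U := by
    intro v hv w hw; ext y
    simp only [snocSet, Step.Next, Step.Allowed, Set.mem_image, Set.mem_union,
      Set.mem_singleton_iff, Set.mem_ofPred_eq]
    grind
  constructor
  · rintro ⟨v, hv, w, hw, h1, h2, h3, h4⟩
    exact ⟨v, w, ⟨hv, hw, h1, h2, h4⟩, h3.trans (key v hv w hw)⟩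
  · rintro ⟨v, w, ⟨hv, hw, h1, h2, h4⟩, h3⟩
    exact ⟨v, hv, w, hw, h1, h2, h3.trans (key v hv w hw).symm, h4⟩

theorem newPrecStep_iff {U U' : Set Word} :
    NewPrecStep U U' ↔ ∃ v w, (Step.prec v w).Valid U ∧ U' = (Step.prec v w).Next U := by
  have key : ∀ v ∈ U, ∀ w ∈ U, snocSet {z | z ∈ U ∧ z < v ∧ Perp z v} .X ∪
      snocSet {z | z ∈ U ∧ z < v ∧ ¬ Perp z v} .L ∪
      {v ++ [.L]} ∪ snocSet {z | z ∈ U ∧ v < z ∧ z < w} .X ∪ {w ++ [.R]} ∪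
      snocSet {z | z ∈ U ∧ w < z ∧ Perp w z} .X ∪
      snocSet {z | z ∈ U ∧ w < z ∧ ¬ Perp w z} .R = (Step.prec v w).Next U := by
    intro v hv w hw; ext y
    simp only [snocSet, Step.Next, Step.Allowed, Set.mem_image, Set.mem_union,
      Set.mem_singleton_iff, Set.mem_ofPred_eq]
    grind
  constructor
  · rintro ⟨v, hv, w, hw, h1, h2, h3, h4⟩
    exact ⟨v, w, ⟨hv, hw, h1, h2, h4⟩, h3.trans (key v hv w hw)⟩
  · rintro ⟨v, w, ⟨hv, hw, h1, h2, h4⟩, h3⟩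
    exact ⟨v, hv, w, hw, h1, h2, h3.trans (key v hv w hw).symm, h4⟩

theorem StepKind.holds_iff {k : StepKind} {U U' : Set Word} :
    k.Holds U U' ↔ ∃ d : Step, d.kind = k ∧ d.Valid U ∧ U' = d.Next U := by
  cases k with
  | leaf =>
    refine leafStep_iff.trans ⟨fun ⟨w, h⟩ => ⟨_, rfl, h⟩, ?_⟩
    rintro ⟨d, hk, h⟩
    cases d <;> first | exact ⟨_, h⟩ | cases hk
  | branching =>
    refine branchingStep_iff.trans ⟨fun ⟨w, h⟩ => ⟨_, rfl, h⟩, ?_⟩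
    rintro ⟨d, hk, h⟩
    cases d <;> first | exact ⟨_, h⟩ | cases hk
  | newPerp =>
    refine newPerpStep_iff.trans ⟨fun ⟨v, w, h⟩ => ⟨_, rfl, h⟩, ?_⟩
    rintro ⟨d, hk, h⟩
    cases d <;> first | exact ⟨_, _, h⟩ | cases hk
  | newPrec =>
    refine newPrecStep_iff.trans ⟨fun ⟨v, w, h⟩ => ⟨_, rfl, h⟩, ?_⟩
    rintro ⟨d, hk, h⟩
    cases d <;> first | exact ⟨_, _, h⟩ | cases hk

namespace Step

theorem snoc_mem_next {d : Step} {U : Set Word} {z : Word} {c : Letter} :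
    z ++ [c] ∈ d.Next U ↔ z ∈ U ∧ d.Allowed z c := by
  constructor
  · rintro ⟨z', hz, c', hc, h⟩
    obtain ⟨rfl, h'⟩ := List.append_inj' h rfl
    rw [List.singleton_inj.1 h']
    exact ⟨hz, hc⟩
  · rintro ⟨hz, hc⟩; exact ⟨z, hz, c, hc, rfl⟩

/-- The next level shows the kind: a dropped word has no extension, a branching word has two, and
among the remaining two kinds only a new `≼` uses the letter `L`. -/
theorem kind_eq_of_next_eq {d d' : Step} {U : Set Word} (hd : d.Valid U) (hd' : d'.Valid U)
    (h : d.Next U = d'.Next U) : d.kind = d'.kind := by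
  have key : ∀ z ∈ U, ∀ c, d.Allowed z c ↔ d'.Allowed z c := by
    intro z hz c
    have := Set.ext_iff.1 h (z ++ [c])
    rw [snoc_mem_next, snoc_mem_next] at this
    tauto
  clear h
  -- The numbering of the kinds only serves to halve the number of cases.
  wlog hle : d.kind.ctorIdx ≤ d'.kind.ctorIdx generalizing d d'
  · exact (this hd' hd (fun z hz c => (key z hz c).symm) (le_of_not_ge hle)).symm
  by_contra hk
  cases d with
  | leaf w =>
    obtain ⟨c, hc⟩ := exists_allowed (z := w) hd' (by rintro w' rfl; exact absurd rfl hk)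
    exact ((key w hd.1 c).2 hc).1 rfl
  | branch w =>
    have h1 := (key w hd .X).1 (.inr (.inl ⟨rfl, .inl rfl⟩))
    have h2 := (key w hd .R).1 (.inr (.inl ⟨rfl, .inr rfl⟩))
    have : d' ≠ branch w := by rintro rfl; exact hk rfl
    exact absurd (allowed_unique hd' h1 h2 this) (by decide)
  | perp v w =>
    cases d' with
    | prec v' w' =>
      have := (key v' hd'.1 .L).2 (by simp [Allowed])
      simp [Allowed] at this
    | perp v' w' => exact hk rfl
    | leaf w => exact absurd hle (by simp [kind, StepKind.ctorIdx])
    | branch w => exact absurd hle (by simp [kind, StepKind.ctorIdx])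
  | prec v w =>
    cases d' with
    | prec v' w' => exact hk rfl
    | perp v' w' => exact absurd hle (by simp [kind, StepKind.ctorIdx])
    | leaf w => exact absurd hle (by simp [kind, StepKind.ctorIdx])
    | branch w => exact absurd hle (by simp [kind, StepKind.ctorIdx])

end Step

/-- The word "precisely" in the definition of a poset-type is automatic, so only the existence of a
step ever needs proof. -/
theorem existsUnique_holds_iff {U U' : Set Word} :
    (∃! k : StepKind, k.Holds U U') ↔ ∃ d : Step, d.Valid U ∧ U' = d.Next U := by
  constructor
  · rintro ⟨k, hk, -⟩
    obtain ⟨d, -, h⟩ := StepKind.holds_iff.1 hk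
    exact ⟨d, h⟩
  · rintro ⟨d, hd, rfl⟩
    refine ⟨d.kind, StepKind.holds_iff.2 ⟨d, rfl, hd, rfl⟩, fun k hk => ?_⟩
    obtain ⟨d', rfl, hd', h⟩ := StepKind.holds_iff.1 hk
    exact (Step.kind_eq_of_next_eq hd hd' h).symm

instance : Fintype Letter := ⟨{.L, .X, .R}, fun x => by cases x <;> simp⟩

theorem level_finite (S : Set Word) (i : ℕ) : (level S i).Finite :=
  (List.finite_length_eq Letter i).subset fun _ hw => hw.2

/-! ### Initial segments -/

theorem subset_initialSegments (S : Set Word) : S ⊆ initialSegments S :=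
  fun w hw => ⟨w, hw, List.prefix_rfl⟩

theorem mem_initialSegments_of_prefix {S : Set Word} {u v : Word} (hu : u ∈ initialSegments S)
    (h : v <+: u) : v ∈ initialSegments S := by
  obtain ⟨w, hw, hu⟩ := hu
  exact ⟨w, hw, h.trans hu⟩

theorem take_mem_initialSegments {S : Set Word} {u : Word} (hu : u ∈ initialSegments S) (n : ℕ) :
    u.take n ∈ initialSegments S :=
  mem_initialSegments_of_prefix hu (List.take_prefix n u)

theorem initialSegments_idem (S : Set Word) :
    initialSegments (initialSegments S) = initialSegments S :=
  Set.Subset.antisymm (fun _ ⟨_, hw, h⟩ => mem_initialSegments_of_prefix hw h)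
    (subset_initialSegments _)

theorem mem_level_initialSegments {S : Set Word} {u : Word} {i : ℕ} :
    u ∈ level (initialSegments S) i ↔ ∃ w ∈ S, i ≤ w.length ∧ u = w.take i := by
  constructor
  · rintro ⟨⟨w, hw, h⟩, rfl⟩
    exact ⟨w, hw, h.length_le, List.prefix_iff_eq_take.1 h⟩
  · rintro ⟨w, hw, h, rfl⟩
    exact ⟨⟨w, hw, List.take_prefix _ _⟩, by simp [h]⟩

theorem initialSegments_leaves {S : Set Word} (hS : S = initialSegments S)
    (hfin : S.Finite) : initialSegments (leaves S) = S := by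
  apply Set.Subset.antisymm
  · rintro u ⟨w, hw, h⟩
    rw [hS]
    exact ⟨w, hw.1, h⟩
  · intro u hu
    have hf : {w | w ∈ S ∧ u <+: w}.Finite := hfin.subset fun _ h => h.1
    obtain ⟨w, ⟨hw, huw⟩, hmax⟩ := hf.exists_maximalFor List.length _ ⟨u, hu, List.prefix_rfl⟩
    refine ⟨w, ⟨hw, fun w' hw' h => ?_⟩, huw⟩
    have := hmax ⟨hw', huw.trans h⟩ h.length_le
    exact (h.eq_of_length (le_antisymm h.length_le this)).symm

theorem leaves_initialSegments_of_antichain {F : Set Word}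
    (hF : ∀ w ∈ F, ∀ w' ∈ F, w <+: w' → w' = w) : leaves (initialSegments F) = F := by
  apply Set.Subset.antisymm
  · rintro u ⟨⟨w, hw, h⟩, hmax⟩
    rw [← hmax w (subset_initialSegments F hw) h]
    exact hw
  · intro w hw
    refine ⟨subset_initialSegments F hw, ?_⟩
    rintro u ⟨w', hw', h⟩ hwu
    have := hF w hw w' hw' (hwu.trans h)
    subst this
    exact h.eq_of_length (le_antisymm h.length_le hwu.length_le)

/-! ### Poset-types -/

namespace IsPosetType
variable {S : Set Word} {u v x : Word} {i : ℕ}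

theorem mem_of_prefix (hS : IsPosetType S) (hu : u ∈ S) (h : v <+: u) : v ∈ S := by
  rw [hS.1]; exact ⟨u, hu, h⟩

theorem take_mem (hS : IsPosetType S) (hu : u ∈ S) (n : ℕ) : u.take n ∈ S :=
  hS.mem_of_prefix hu (List.take_prefix n u)

theorem take_mem_level (hS : IsPosetType S) (hu : u ∈ S) (h : i ≤ u.length) :
    u.take i ∈ level S i :=
  ⟨hS.take_mem hu i, by simp [h]⟩

theorem exists_step (hS : IsPosetType S) (h : (level S i).Nonempty) :
    ∃ d : Step, d.Valid (level S i) ∧ level S (i + 1) = d.Next (level S i) :=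
  existsUnique_holds_iff.1 (hS.2 i h)

theorem isLevel (hS : IsPosetType S) (i : ℕ) : IsLevel i (level S i) := by
  induction i with
  | zero =>
    refine ⟨fun u hu => hu.2, fun u hu v hv _ => ?_⟩
    rw [List.length_eq_zero_iff.1 hu.2, List.length_eq_zero_iff.1 hv.2]
    exact Below.refl _
  | succ i ih =>
    rcases (level S i).eq_empty_or_nonempty with h | h
    · have : level S (i + 1) = ∅ := by
        rw [Set.eq_empty_iff_forall_notMem]
        rintro u ⟨hu, hl⟩
        exact Set.notMem_empty (u.take i) (h ▸ hS.take_mem_level hu (by omega))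
      rw [this]
      exact ⟨fun _ h => h.elim, fun _ h => h.elim⟩
    · obtain ⟨d, hd, hn⟩ := hS.exists_step h
      rw [hn]
      exact Step.isLevel_next ih hd

theorem below_of_sep (hS : IsPosetType S) (hu : u ∈ S) (hv : v ∈ S) (h : Sep u v) :
    Below u v := by
  rcases le_total u.length v.length with hl | hl
  · rw [← below_take_right le_rfl]
    rw [← sep_take_right le_rfl] at h
    exact (hS.isLevel u.length).below _ ⟨hu, rfl⟩ _ (hS.take_mem_level hv hl) h
  · rw [← below_take_left le_rfl]
    rw [← sep_take_left le_rfl] at h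
    exact (hS.isLevel v.length).below _ (hS.take_mem_level hu hl) _ ⟨hv, rfl⟩ h

theorem prec_iff (hS : IsPosetType S) (hu : u ∈ S) (hv : v ∈ S) : Prec u v ↔ Sep u v :=
  ⟨Prec.sep, fun h => h.prec (hS.below_of_sep hu hv h)⟩

/-- Every other step would extend `x`. -/
theorem step_eq_leaf (hx : x ∈ leaves S) {d : Step} (hd : d.Valid (level S x.length))
    (hn : level S (x.length + 1) = d.Next (level S x.length)) : d = .leaf x := by
  by_cases h : ∀ w, d = Step.leaf w → x ≠ w
  · obtain ⟨c, hc⟩ := Step.exists_allowed hd h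
    have hm : x ++ [c] ∈ level S (x.length + 1) := hn ▸ Step.snoc_mem_next.2 ⟨⟨hx.1, rfl⟩, hc⟩
    have := hx.2 _ hm.1 (List.prefix_append _ _)
    simp at this
  · push Not at h
    obtain ⟨w, rfl, rfl⟩ := h
    rfl

theorem leaf_step (hS : IsPosetType S) (hx : x ∈ leaves S) :
    (Step.leaf x).Valid (level S x.length) ∧
      level S (x.length + 1) = (Step.leaf x).Next (level S x.length) := by
  obtain ⟨d, hd, hn⟩ := hS.exists_step ⟨x, hx.1, rfl⟩
  obtain rfl := step_eq_leaf hx hd hn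
  exact ⟨hd, hn⟩

end IsPosetType

/-! ### Deleting letters -/

theorem keepIndices_nil (I : Set ℕ) : keepIndices I [] = [] := rfl

open Classical in
theorem keepIndices_snoc (I : Set ℕ) (u : Word) (c : Letter) :
    keepIndices I (u ++ [c]) = keepIndices I u ++ (if u.length ∈ I then [c] else []) := by
  rw [keepIndices, List.zipIdx_append, List.filter_append, List.map_append, ← keepIndices]
  congr 1
  by_cases h : u.length ∈ I <;> simp [h]

theorem keepIndices_snoc_of_mem {I : Set ℕ} {u : Word} (c : Letter) (h : u.length ∈ I) :
    keepIndices I (u ++ [c]) = keepIndices I u ++ [c] := by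
  rw [keepIndices_snoc, if_pos h]

theorem keepIndices_snoc_of_notMem {I : Set ℕ} {u : Word} (c : Letter) (h : u.length ∉ I) :
    keepIndices I (u ++ [c]) = keepIndices I u := by
  rw [keepIndices_snoc, if_neg h, List.append_nil]

theorem keepIndices_prefix (I : Set ℕ) {u v : Word} (h : u <+: v) :
    keepIndices I u <+: keepIndices I v := by
  obtain ⟨t, rfl⟩ := h
  induction t using List.reverseRecOn with
  | nil => rw [List.append_nil]
  | append_singleton t c ih =>
    rw [← List.append_assoc, keepIndices_snoc]
    exact ih.trans (List.prefix_append _ _)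

theorem exists_of_prefix_keepIndices {I : Set ℕ} {u v : Word} (h : u <+: keepIndices I v) :
    ∃ t, t <+: v ∧ keepIndices I t = u := by
  induction v using List.reverseRecOn with
  | nil =>
    rw [keepIndices_nil, List.prefix_nil] at h
    exact ⟨[], List.prefix_rfl, by rw [h, keepIndices_nil]⟩
  | append_singleton v c ih =>
    by_cases hv : u <+: keepIndices I v
    · obtain ⟨t, ht, rfl⟩ := ih hv
      exact ⟨t, ht.trans (List.prefix_append _ _), rfl⟩
    · by_cases hI : v.length ∈ I
      · rw [keepIndices_snoc_of_mem c hI, List.prefix_concat_iff] at h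
        refine ⟨_, List.prefix_rfl, ?_⟩
        rw [keepIndices_snoc_of_mem c hI]
        exact (h.resolve_right hv).symm
      · rw [keepIndices_snoc_of_notMem c hI] at h
        exact absurd h hv

/-- Deletion commutes with taking initial segments. -/
theorem initialSegments_keepIndices_image (I : Set ℕ) (F : Set Word) :
    initialSegments (keepIndices I '' F) = keepIndices I '' initialSegments F := by
  ext u
  constructor
  · rintro ⟨_, ⟨w, hw, rfl⟩, h⟩
    obtain ⟨t, ht, rfl⟩ := exists_of_prefix_keepIndices h
    exact ⟨t, ⟨w, hw, ht⟩, rfl⟩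
  · rintro ⟨t, ⟨w, hw, ht⟩, rfl⟩
    exact ⟨_, ⟨w, hw, rfl⟩, keepIndices_prefix I ht⟩

theorem keepIndices_take_of_forall_notMem {I : Set ℕ} {u : Word} {m : ℕ}
    (h : ∀ i, m ≤ i → i < u.length → i ∉ I) : keepIndices I (u.take m) = keepIndices I u := by
  induction u using List.reverseRecOn with
  | nil => simp
  | append_singleton u c ih =>
    by_cases hm : m ≤ u.length
    · rw [List.take_append_of_le_length hm, keepIndices_snoc_of_notMem c (h _ hm (by simp)),
        ih fun i hi hi' => h i hi (by simp; omega)]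
    · rw [List.take_of_length_le (by simp; omega)]

open Classical in
theorem length_keepIndices (I : Set ℕ) (u : Word) :
    (keepIndices I u).length = Nat.count (· ∈ I) u.length := by
  induction u using List.reverseRecOn with
  | nil => simp [keepIndices_nil]
  | append_singleton u c ih =>
    rw [keepIndices_snoc, List.length_append, ih, List.length_append, List.length_singleton,
      Nat.count_succ]
    split_ifs <;> rfl

theorem length_keepIndices_lt {I : Set ℕ} {u v : Word} {i : ℕ} (hi : i ∈ I)
    (hu : u.length ≤ i) (hv : i < v.length) :
    (keepIndices I u).length < (keepIndices I v).length := by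
  classical
  rw [length_keepIndices, length_keepIndices]
  exact (Nat.count_monotone _ hu).trans_lt (Nat.count_strict_mono hi hv)

theorem length_keepIndices_congr {I : Set ℕ} {u v : Word} (h : u.length = v.length) :
    (keepIndices I u).length = (keepIndices I v).length := by
  classical
  rw [length_keepIndices, length_keepIndices, h]

/-! ### Steps change the isomorphism type -/

/-- The bijection `e` gives `r` and `r'` equally many pairs, whereas `g` embeds the pairs of `r`
properly into those of `r'`. -/
theorem false_of_equiv_of_extends {α β : Type*} [Finite α] (e : α ≃ β) {r : α → α → Prop}
    {r' : β → β → Prop} (he : ∀ a b, r a b ↔ r' (e a) (e b)) {g : α → β}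
    (hg : Function.Injective g) (hr : ∀ a b, r a b → r' (g a) (g b)) {a b : α} (h : ¬ r a b)
    (h' : r' (g a) (g b)) : False := by
  have hfin : Finite β := Finite.of_equiv α e
  set A : Set (α × α) := {p | r p.1 p.2}
  set B : Set (β × β) := {p | r' p.1 p.2}
  have h1 : (Prod.map e e '' A) = B := by
    ext ⟨x, y⟩
    constructor
    · rintro ⟨⟨p, q⟩, hp, h⟩
      obtain ⟨rfl, rfl⟩ := Prod.mk.inj h
      exact (he p q).1 hp
    · intro hxy
      refine ⟨(e.symm x, e.symm y), (he _ _).2 ?_, by simp⟩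
      rw [Equiv.apply_symm_apply, Equiv.apply_symm_apply]
      exact hxy
  have h2 : (Prod.map g g '' A) ⊂ B := by
    refine ⟨?_, fun hsub => ?_⟩
    · rintro _ ⟨⟨p, q⟩, hp, rfl⟩
      exact hr p q hp
    · obtain ⟨⟨p, q⟩, hp, hpq⟩ := hsub (show (g a, g b) ∈ B from h')
      obtain ⟨h1, h2⟩ := Prod.mk.inj hpq
      rw [hg h1, hg h2] at hp
      exact h hp
  have h3 := Set.ncard_lt_ncard h2 (Set.toFinite B)
  rw [Set.ncard_image_of_injective _ (hg.prodMap hg), ← h1,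
    Set.ncard_image_of_injective _ (e.injective.prodMap e.injective)] at h3
  exact lt_irrefl _ h3

/-- A count changes: the number of words at a leaf or a branching, the number of pairs in `⊥` or in
`≼` at the other two kinds, where the relation in question only grows. -/
theorem Step.not_structIso {d : Step} {U : Set Word} {n : ℕ} (hU : IsLevel n U) (hfin : U.Finite)
    (hd : d.Valid U) : ¬ StructIso U (d.Next U) := by
  rintro ⟨e, he⟩
  have : Finite U := hfin
  by_cases hl : ∃ w, d = Step.leaf w
  · obtain ⟨w, rfl⟩ := hl
    have hdrop : ∀ y : (Step.leaf w).Next U, y.1.dropLast ∈ U ∧ y.1.dropLast ≠ w ∧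
        y.1 = y.1.dropLast ++ [.X] := by
      rintro ⟨_, z, hz, c, ⟨hne, rfl⟩, rfl⟩
      simp only [List.dropLast_concat]
      exact ⟨hz, hne, trivial⟩
    set g : (Step.leaf w).Next U → U := fun y => ⟨y.1.dropLast, (hdrop y).1⟩
    have hg : Function.Injective g := by
      intro y y' h
      have h := congrArg Subtype.val h
      apply Subtype.ext
      rw [(hdrop y).2.2, (hdrop y').2.2]
      exact congrArg (· ++ [Letter.X]) h
    obtain ⟨u, hu⟩ := (Finite.injective_iff_surjective (f := g ∘ e)).1 (hg.comp e.injective)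
      ⟨w, hd.1⟩
    exact (hdrop (e u)).2.1 (congrArg Subtype.val hu)
  · push Not at hl
    have hex : ∀ z : U, ∃ c, d.Allowed z c := fun z =>
      Step.exists_allowed hd fun w hw => absurd hw (hl w)
    choose c hc using hex
    set g : U → d.Next U := fun z => ⟨z ++ [c z], z, z.2, c z, hc z, rfl⟩ with hgdef
    have hg : Function.Injective g := fun z z' h =>
      Subtype.ext (List.append_inj' (congrArg Subtype.val h) rfl).1
    cases d with
    | leaf w => exact hl w rfl
    | branch w =>
      obtain ⟨c', hc', hne⟩ : ∃ c', (Step.branch w).Allowed w c' ∧ c' ≠ c ⟨w, hd⟩ := by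
        by_cases h : c ⟨w, hd⟩ = .X
        · exact ⟨.R, by simp [Step.Allowed], by rw [h]; decide⟩
        · exact ⟨.X, by simp [Step.Allowed], fun hh => h hh.symm⟩
      obtain ⟨z, hz⟩ := (Finite.injective_iff_surjective (f := e.symm ∘ g)).1
        (e.symm.injective.comp hg) (e.symm ⟨w ++ [c'], w, hd, c', hc', rfl⟩)
      have hz' := congrArg Subtype.val (e.symm.injective hz)
      obtain ⟨h1, h2⟩ := List.append_inj' hz' rfl
      obtain rfl : z = ⟨w, hd⟩ := Subtype.ext h1
      exact hne (List.singleton_inj.1 h2).symm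
    | perp v w =>
      refine false_of_equiv_of_extends e (r := fun a b => Perp a b) (r' := fun a b => Perp a b)
        (fun a b => (he a b).2.2) hg (fun a b hab => ?_) (a := ⟨v, hd.1⟩) (b := ⟨w, hd.2.1⟩) ?_ ?_
      · rw [perp_iff] at *
        simp only [hgdef]
        rw [Step.below_snoc hU hd a.2 b.2 (hc a) (hc b),
          Step.below_snoc hU hd b.2 a.2 (hc b) (hc a)]
        tauto
      · exact fun h => (perp_iff.1 h).1 (Step.valid_perp_below hd hU).1
      · rw [perp_iff]
        simp only [hgdef]
        rw [Step.below_snoc hU hd hd.1 hd.2.1 (hc ⟨v, hd.1⟩) (hc ⟨w, hd.2.1⟩),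
          Step.below_snoc hU hd hd.2.1 hd.1 (hc ⟨w, hd.2.1⟩) (hc ⟨v, hd.1⟩)]
        refine ⟨fun h => h.2 ⟨rfl, rfl⟩, fun h => ?_⟩
        exact absurd hd.2.2.1 (not_lt.2 (hU.below_le hd.2.1 hd.1 h.1))
    | prec v w =>
      have hN := Step.isLevel_next hU hd
      have key : ∀ a b : U, PrecEq (g a) (g b) ↔ a = b ∨ Sep a b ∨ (Step.prec v w).Makes a b := by
        intro a b
        rw [hN.precEq_iff (g a).2 (g b).2]
        simp only [hgdef]
        rw [Step.sep_snoc hU hd a.2 b.2 (hc a) (hc b)]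
        refine or_congr_left ⟨fun h => hg (Subtype.ext h), fun h => by rw [h]⟩
      refine false_of_equiv_of_extends e (r := fun a b => PrecEq a b)
        (r' := fun a b => PrecEq a b)
        (fun a b => (he a b).2.1) hg (fun a b hab => ?_) (a := ⟨v, hd.1⟩) (b := ⟨w, hd.2.1⟩) ?_ ?_
      · rw [key]
        rw [hU.precEq_iff a.2 b.2] at hab
        exact hab.imp Subtype.ext .inl
      · rw [hU.precEq_iff hd.1 hd.2.1]
        rintro (h | h)
        · exact hd.2.2.1.ne h
        · exact (Step.valid_prec_below hd hU).2 h
      · rw [key]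
        exact .inr (.inr ⟨rfl, rfl⟩)

/-! ### Levels of the tree of a set of leaves -/

/-- The next level has one word above each word, and the same structure. -/
def TrivialStep (U U' : Set Word) : Prop :=
  ∃ c : Word → Letter, U' = (fun z => z ++ [c z]) '' U ∧ IsoOn (fun z => z ++ [c z]) U

/-- Validity is universal over the level, so it passes to any part that contains the witnesses. If a
witness is missing, or one child of the branching word, then on the remaining part no word is
dropped or split and no pair is killed or made. -/
theorem trivial_or_genuine {S F : Set Word} (hS : IsPosetType S) (hF : F ⊆ leaves S) (i : ℕ) :
    TrivialStep (level (initialSegments F) i) (level (initialSegments F) (i + 1)) ∨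
    ∃ d : Step, d.Valid (level (initialSegments F) i) ∧
      level (initialSegments F) (i + 1) = d.Next (level (initialSegments F) i) := by
  set T := initialSegments F with hT
  have hTS : T ⊆ S := by
    rintro u ⟨w, hw, h⟩
    exact hS.mem_of_prefix (hF hw).1 h
  have hlev : ∀ j, level T j ⊆ level S j := fun j u hu => ⟨hTS hu.1, hu.2⟩
  rcases (level T i).eq_empty_or_nonempty with hemp | ⟨u₀, hu₀⟩
  · left
    refine ⟨fun _ => .X, ?_, ?_⟩
    · rw [hemp, Set.image_empty, Set.eq_empty_iff_forall_notMem]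
      rintro u ⟨hu, hl⟩
      have : u.take i ∈ level T i :=
        ⟨take_mem_initialSegments hu i, by rw [List.length_take]; omega⟩
      rw [hemp] at this
      exact this
    · rw [hemp]
      exact ⟨fun _ h => h.elim, fun _ h => h.elim, fun _ h => h.elim⟩
  obtain ⟨d, hd, hn⟩ := hS.exists_step ⟨u₀, hlev i hu₀⟩
  have hV := hS.isLevel i
  have hU : IsLevel i (level T i) := hV.mono (hlev i)
  have hsub : ∀ y ∈ level T (i + 1), ∃ z ∈ level T i, ∃ c, d.Allowed z c ∧ y = z ++ [c] := by
    intro y hy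
    obtain ⟨z, hz, c, hc, rfl⟩ := hn ▸ hlev _ hy
    exact ⟨z, ⟨mem_initialSegments_of_prefix hy.1 (List.prefix_append _ _), hz.2⟩, c, hc, rfl⟩
  have hallow : ∀ z c, z ++ [c] ∈ level T (i + 1) → d.Allowed z c := by
    intro z c h
    have := hlev _ h
    rw [hn, Step.snoc_mem_next] at this
    exact this.2
  -- A word of `F` is a leaf of `S`, so it ends only at the step that drops it.
  have hchild : ∀ z ∈ level T i, (∀ w, d = Step.leaf w → z ≠ w) →
      ∃ c, z ++ [c] ∈ level T (i + 1) := by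
    intro z hz hne
    obtain ⟨⟨w, hw, hzw⟩, hl⟩ := id hz
    obtain ⟨t, rfl⟩ := hzw
    cases t with
    | nil =>
      exfalso
      rw [List.append_nil] at hw
      obtain ⟨c, hc⟩ := Step.exists_allowed hd hne
      have hm : z ++ [c] ∈ level S (i + 1) := hn ▸ Step.snoc_mem_next.2 ⟨hlev i hz, hc⟩
      have := (hF hw).2 _ hm.1 (List.prefix_append _ _)
      simp at this
    | cons c t =>
      exact ⟨c, ⟨_, hw, by simp⟩, by simp [hl]⟩
  have hgen : d.Valid (level T i) → d.Next (level T i) ⊆ level T (i + 1) →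
      ∃ d : Step, d.Valid (level T i) ∧ level T (i + 1) = d.Next (level T i) :=
    fun h1 h2 => ⟨d, h1, Set.Subset.antisymm hsub h2⟩
  -- Away from a branching word the added letter is determined, so any child in the subtree is the
  -- one required.
  have hnext : (∀ w, d = Step.branch w → w ∈ level T i → ∀ c, d.Allowed w c →
      w ++ [c] ∈ level T (i + 1)) → d.Next (level T i) ⊆ level T (i + 1) := by
    rintro hb _ ⟨z, hz, c, hc, rfl⟩
    by_cases h : d = Step.branch z
    · exact hb z h hz c hc
    · obtain ⟨c', hc'⟩ := hchild z hz (by rintro w rfl; exact hc.1)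
      rwa [Step.allowed_unique hd hc (hallow _ _ hc') h]
  have htriv : (∀ w, d = Step.leaf w → w ∉ level T i) →
      (∀ z c c', z ++ [c] ∈ level T (i + 1) → z ++ [c'] ∈ level T (i + 1) → c = c') →
      (∀ z ∈ level T i, ∀ z' ∈ level T i, ∀ c c', d.Kills z z' c c' →
        z ++ [c] ∈ level T (i + 1) → z' ++ [c'] ∉ level T (i + 1)) →
      (∀ z ∈ level T i, ∀ z' ∈ level T i, ¬ d.Makes z z') →
      TrivialStep (level T i) (level T (i + 1)) := by
    intro h1 h2 h3 h4
    have : ∀ z, ∃ c, z ∈ level T i → z ++ [c] ∈ level T (i + 1) := by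
      intro z
      by_cases hz : z ∈ level T i
      · obtain ⟨c, hc⟩ := hchild z hz fun w hw h => h1 w hw (h ▸ hz)
        exact ⟨c, fun _ => hc⟩
      · exact ⟨.X, fun h => absurd h hz⟩
    choose c hc using this
    refine ⟨c, ?_, ?_, ?_, ?_⟩
    · ext y
      constructor
      · intro hy
        obtain ⟨z, hz, c', hc', rfl⟩ := hsub y hy
        exact ⟨z, hz, by rw [h2 z _ _ hy (hc z hz)]⟩
      · rintro ⟨z, hz, rfl⟩
        exact hc z hz
    · intro u hu v hv
      rw [snoc_lt_snoc_iff (hU.length_eq hu hv)]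
      refine or_iff_left ?_
      rintro ⟨rfl, h⟩
      exact lt_irrefl _ h
    · intro u hu v hv
      rw [Step.below_snoc hV hd (hlev i hu) (hlev i hv) (hallow _ _ (hc u hu))
        (hallow _ _ (hc v hv))]
      exact and_iff_left fun hk => h3 u hu v hv _ _ hk (hc u hu) (hc v hv)
    · intro u hu v hv
      rw [Step.sep_snoc hV hd (hlev i hu) (hlev i hv) (hallow _ _ (hc u hu))
        (hallow _ _ (hc v hv))]
      exact or_iff_left (h4 u hu v hv)
  cases d with
  | leaf w =>
    by_cases hw : w ∈ level T i
    · right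
      exact hgen ⟨hw, fun u hu => hd.2 u (hlev i hu)⟩ (hnext (by simp))
    · left
      refine htriv (by rintro _ ⟨⟩; exact hw) (fun z c c' h h' => ?_)
        (fun _ _ _ _ _ _ h => h.elim) fun _ _ _ _ h => h
      exact Step.allowed_unique hd (hallow _ _ h) (hallow _ _ h') (by simp)
  | branch w =>
    by_cases hw : w ++ [.X] ∈ level T (i + 1) ∧ w ++ [.R] ∈ level T (i + 1)
    · right
      refine hgen ?_ (hnext ?_)
      · obtain ⟨z, hz, c, -, h⟩ := hsub _ hw.1
        rw [(List.append_inj' h rfl).1]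
        exact hz
      · rintro _ ⟨⟩ hw' c (⟨h, -⟩ | ⟨-, rfl | rfl⟩ | ⟨h, -⟩)
        · exact absurd h (lt_irrefl _)
        · exact hw.1
        · exact hw.2
        · exact absurd h (lt_irrefl _)
    · left
      refine htriv (by simp) (fun z c c' h h' => ?_) ?_ (fun _ _ _ _ h => h)
      · by_cases hz : z = w
        · subst hz
          have h1 := hallow _ _ h
          have h2 := hallow _ _ h'
          simp only [Step.Allowed, lt_irrefl, false_and, or_false, false_or, true_and] at h1 h2
          rcases h1 with rfl | rfl <;> rcases h2 with rfl | rfl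
          · rfl
          · exact absurd ⟨h, h'⟩ hw
          · exact absurd ⟨h', h⟩ hw
          · rfl
        · exact Step.allowed_unique hd (hallow _ _ h) (hallow _ _ h') (by simp [Ne.symm hz])
      · rintro z hz z' hz' c c' ⟨rfl, rfl, rfl, rfl⟩ h h'
        exact hw ⟨h', h⟩
  | perp v w =>
    by_cases hvw : v ∈ level T i ∧ w ∈ level T i
    · right
      obtain ⟨h1, h2, h3, h4, h5⟩ := id hd
      exact hgen ⟨hvw.1, hvw.2, h3, h4, fun u hu => h5 u (hlev i hu)⟩ (hnext (by simp))
    · left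
      refine htriv (by simp) (fun z c c' h h' => ?_) ?_ (fun _ _ _ _ h => h)
      · exact Step.allowed_unique hd (hallow _ _ h) (hallow _ _ h') (by simp)
      · rintro z hz z' hz' c c' ⟨rfl, rfl⟩
        exact absurd ⟨hz, hz'⟩ hvw
  | prec v w =>
    by_cases hvw : v ∈ level T i ∧ w ∈ level T i
    · right
      obtain ⟨h1, h2, h3, h4, h5, h6⟩ := id hd
      exact hgen ⟨hvw.1, hvw.2, h3, h4, fun u hu => h5 u (hlev i hu),
        fun u hu => h6 u (hlev i hu)⟩ (hnext (by simp))
    · left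
      refine htriv (by simp) (fun z c c' h h' => ?_) (fun _ _ _ _ _ _ h => h.elim) ?_
      · exact Step.allowed_unique hd (hallow _ _ h) (hallow _ _ h') (by simp)
      · rintro z hz z' hz' ⟨rfl, rfl⟩
        exact absurd ⟨hz, hz'⟩ hvw

theorem isLevel_initialSegments {S F : Set Word} (hS : IsPosetType S) (hF : F ⊆ S) (i : ℕ) :
    IsLevel i (level (initialSegments F) i) :=
  (hS.isLevel i).mono fun _ ⟨⟨_, hw, h⟩, hl⟩ => ⟨hS.mem_of_prefix (hF hw) h, hl⟩

/-- In a poset-type no pair becomes incompatible, so that only the structure of levels matters. -/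
theorem mem_interesting_iff {S F : Set Word} (hS : IsPosetType S) (hF : F ⊆ S) {i : ℕ} :
    i ∈ interesting F ↔
      ¬ StructIso (level (initialSegments F) i) (level (initialSegments F) (i + 1)) := by
  refine or_iff_left ?_
  rintro ⟨u, hu, v, hv, h, -⟩
  exact h ((isLevel_initialSegments hS hF (i + 1)).compatible hu hv)

theorem TrivialStep.structIso {U U' : Set Word} {n m : ℕ} (hU : IsLevel n U) (hU' : IsLevel m U')
    (h : TrivialStep U U') : StructIso U U' := by
  obtain ⟨c, rfl, hc⟩ := h
  exact hc.structIso hU hU'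

theorem genuine_of_mem_interesting {S F : Set Word} (hS : IsPosetType S) (hF : F ⊆ leaves S)
    {i : ℕ} (hi : i ∈ interesting F) : ∃ d : Step, d.Valid (level (initialSegments F) i) ∧
      level (initialSegments F) (i + 1) = d.Next (level (initialSegments F) i) := by
  have hFS : F ⊆ S := fun w hw => (hF hw).1
  refine (trivial_or_genuine hS hF i).resolve_left fun h => ?_
  exact (mem_interesting_iff hS hFS).1 hi (h.structIso (isLevel_initialSegments hS hFS i)
    (isLevel_initialSegments hS hFS (i + 1)))

theorem trivial_of_notMem_interesting {S F : Set Word} (hS : IsPosetType S) (hF : F ⊆ leaves S)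
    {i : ℕ} (hi : i ∉ interesting F) :
    TrivialStep (level (initialSegments F) i) (level (initialSegments F) (i + 1)) := by
  have hFS : F ⊆ S := fun w hw => (hF hw).1
  refine (trivial_or_genuine hS hF i).resolve_right ?_
  rintro ⟨d, hd, h⟩
  refine hi ((mem_interesting_iff hS hFS).2 ?_)
  rw [h]
  exact d.not_structIso (isLevel_initialSegments hS hFS i) (level_finite _ _) hd

/-- By induction on the level: a deleted letter comes from a trivial step and carries no structure,
and a kept letter is appended alike to the word and to its image. -/
theorem isoOn_keepIndices {S F : Set Word} (hS : IsPosetType S) (hF : F ⊆ leaves S) (i : ℕ) :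
    IsoOn (keepIndices (interesting F)) (level (initialSegments F) i) := by
  set K := keepIndices (interesting F)
  induction i with
  | zero =>
    have h0 : ∀ u ∈ level (initialSegments F) 0, u = [] :=
      fun u hu => List.length_eq_zero_iff.1 hu.2
    constructor <;>
    · intro u hu v hv
      rw [h0 u hu, h0 v hv]
      rfl
  | succ i ih =>
    have hU := isLevel_initialSegments hS (fun w hw => (hF hw).1) i
    by_cases hi : i ∈ interesting F
    · obtain ⟨d, hd, hn⟩ := genuine_of_mem_interesting hS hF hi
      rw [hn]
      have hlen : ∀ u ∈ level (initialSegments F) i, ∀ v ∈ level (initialSegments F) i,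
          (K u).length = (K v).length := fun u hu v hv =>
        length_keepIndices_congr (hU.length_eq hu hv)
      have hK : ∀ u ∈ level (initialSegments F) i, ∀ c, K (u ++ [c]) = K u ++ [c] :=
        fun u hu c => keepIndices_snoc_of_mem c (by rw [hu.2]; exact hi)
      constructor
      · rintro _ ⟨u, hu, c, -, rfl⟩ _ ⟨v, hv, c', -, rfl⟩
        rw [hK u hu, hK v hv, snoc_lt_snoc_iff (hlen u hu v hv),
          snoc_lt_snoc_iff (hU.length_eq hu hv), ih.lt_iff u hu v hv, ih.eq_iff hu hv]
      · rintro _ ⟨u, hu, c, -, rfl⟩ _ ⟨v, hv, c', -, rfl⟩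
        rw [hK u hu, hK v hv, below_snoc_iff (hlen u hu v hv),
          below_snoc_iff (hU.length_eq hu hv), ih.below_iff u hu v hv]
      · rintro _ ⟨u, hu, c, -, rfl⟩ _ ⟨v, hv, c', -, rfl⟩
        rw [hK u hu, hK v hv, sep_snoc_iff (hlen u hu v hv),
          sep_snoc_iff (hU.length_eq hu hv), ih.sep_iff u hu v hv]
    · obtain ⟨c, hn, hc⟩ := trivial_of_notMem_interesting hS hF hi
      rw [hn]
      have hK : ∀ u ∈ level (initialSegments F) i, ∀ c, K (u ++ [c]) = K u :=
        fun u hu c => keepIndices_snoc_of_notMem c (by rw [hu.2]; exact hi)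
      constructor
      · rintro _ ⟨u, hu, rfl⟩ _ ⟨v, hv, rfl⟩
        rw [hc.lt_iff u hu v hv]
        simp only [hK u hu, hK v hv, ih.lt_iff u hu v hv]
      · rintro _ ⟨u, hu, rfl⟩ _ ⟨v, hv, rfl⟩
        rw [hc.below_iff u hu v hv]
        simp only [hK u hu, hK v hv, ih.below_iff u hu v hv]
      · rintro _ ⟨u, hu, rfl⟩ _ ⟨v, hv, rfl⟩
        rw [hc.sep_iff u hu v hv]
        simp only [hK u hu, hK v hv, ih.sep_iff u hu v hv]

/-! ### The embedding type of a set of leaves -/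

section EmbeddingType
variable {S F : Set Word} (hS : IsPosetType S) (hF : F ⊆ leaves S)
include hS hF

/-- A trivial step extends every word, but a leaf has no extension. -/
theorem length_mem_interesting {w : Word} (hw : w ∈ F) : w.length ∈ interesting F := by
  by_contra h
  obtain ⟨c, hn, -⟩ := trivial_of_notMem_interesting hS hF h
  have hm : w ++ [c w] ∈ level (initialSegments F) (w.length + 1) :=
    hn ▸ ⟨w, ⟨subset_initialSegments F hw, rfl⟩, rfl⟩
  obtain ⟨⟨w', hw', hp⟩, -⟩ := hm
  have := (hF hw).2 _ (hS.mem_of_prefix (hF hw').1 hp) (List.prefix_append _ _)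
  simp at this

theorem exists_extension_of_notMem_interesting {u : Word} {i : ℕ}
    (hu : u ∈ level (initialSegments F) i) (n : ℕ)
    (h : ∀ j, i ≤ j → j < i + n → j ∉ interesting F) :
    ∃ v ∈ level (initialSegments F) (i + n),
      keepIndices (interesting F) v = keepIndices (interesting F) u := by
  induction n with
  | zero => exact ⟨u, hu, rfl⟩
  | succ n ih =>
    obtain ⟨v, hv, hK⟩ := ih fun j h1 h2 => h j h1 (by omega)
    have hi := h (i + n) (by omega) (by omega)
    obtain ⟨c, hn, -⟩ := trivial_of_notMem_interesting hS hF hi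
    refine ⟨v ++ [c v], ?_, ?_⟩
    · rw [← Nat.add_assoc, hn]
      exact ⟨v, hv, rfl⟩
    · rw [keepIndices_snoc_of_notMem _ (by rw [hv.2]; exact hi), hK]

-- Distinct levels may have the same image. A word whose image has the right length can be cut, or
-- prolonged through trivial steps, to length `j` without changing the image.
open Classical in
theorem level_embeddingType (j : ℕ) :
    level (initialSegments (embeddingType F)) (Nat.count (· ∈ interesting F) j) =
      keepIndices (interesting F) '' level (initialSegments F) j := by
  rw [embeddingType, initialSegments_keepIndices_image]
  ext v
  constructor
  · rintro ⟨⟨u, hu, rfl⟩, hl⟩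
    rw [length_keepIndices] at hl
    rcases le_total j u.length with hj | hj
    · refine ⟨u.take j, ⟨take_mem_initialSegments hu j, by simp [hj]⟩, ?_⟩
      refine keepIndices_take_of_forall_notMem fun i h1 h2 hi => ?_
      have h3 := Nat.count_strict_mono (p := (· ∈ interesting F)) hi h2
      have h4 := Nat.count_monotone (· ∈ interesting F) h1
      omega
    · obtain ⟨n, rfl⟩ := Nat.exists_eq_add_of_le hj
      obtain ⟨v, hv, hK⟩ := exists_extension_of_notMem_interesting hS hF (u := u) ⟨hu, rfl⟩ n
        fun i h1 h2 hi => by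
          have h3 := Nat.count_strict_mono (p := (· ∈ interesting F)) hi h2
          have h4 := Nat.count_monotone (· ∈ interesting F) h1
          omega
      exact ⟨v, hv, hK⟩
  · rintro ⟨u, hu, rfl⟩
    exact ⟨⟨u, hu.1, rfl⟩, by rw [length_keepIndices, hu.2]⟩

theorem isPosetType_embeddingType (hfin : F.Finite) :
    IsPosetType (initialSegments (embeddingType F)) := by
  classical
  refine ⟨(initialSegments_idem _).symm, fun k hk => ?_⟩
  rw [existsUnique_holds_iff]
  obtain ⟨u, hu, rfl⟩ : ∃ u ∈ initialSegments F, (keepIndices (interesting F) u).length = k := by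
    obtain ⟨v, hv, hl⟩ := hk
    rw [embeddingType, initialSegments_keepIndices_image] at hv
    obtain ⟨u, hu, rfl⟩ := hv
    exact ⟨u, hu, hl⟩
  -- Without another interesting level `u` would have extensions longer than all words of `F`.
  have hex : ∃ i, u.length ≤ i ∧ i ∈ interesting F := by
    by_contra hne
    push Not at hne
    obtain ⟨N, hN⟩ := (hfin.image List.length).bddAbove
    obtain ⟨v, ⟨⟨w, hw, hvw⟩, hvl⟩, -⟩ := exists_extension_of_notMem_interesting hS hF (u := u)
      ⟨hu, rfl⟩ (N + 1) fun j h _ => hne j h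
    have h1 := hvw.length_le
    have h2 := hN ⟨w, hw, rfl⟩
    omega
  -- Up to `j` only deleted letters are added to `u`, so the step at level `j` is the one that
  -- continues the reduced level.
  set j := Nat.find hex
  obtain ⟨huj, hj⟩ := Nat.find_spec hex
  have hcount : (keepIndices (interesting F) u).length = Nat.count (· ∈ interesting F) j := by
    obtain ⟨n, hn⟩ := Nat.exists_eq_add_of_le huj
    obtain ⟨v, hv, hK⟩ := exists_extension_of_notMem_interesting hS hF (u := u) ⟨hu, rfl⟩ n
      fun i h1 h2 hi => Nat.find_min hex (m := i) (by omega) ⟨h1, hi⟩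
    rw [← hK, length_keepIndices, hv.2, ← hn]
  obtain ⟨d, hd, hn⟩ := genuine_of_mem_interesting hS hF hj
  have hU := isLevel_initialSegments hS (fun w hw => (hF hw).1) j
  have hK := isoOn_keepIndices hS hF j
  refine ⟨d.map (keepIndices (interesting F)), ?_, ?_⟩
  · rw [hcount, level_embeddingType hS hF]
    exact Step.valid_map hU hK (hK.isLevel hU (m := Nat.count (· ∈ interesting F) j)
      fun v hv => by rw [length_keepIndices, hv.2]) hd
  · have hsucc : Nat.count (· ∈ interesting F) j + 1 = Nat.count (· ∈ interesting F) (j + 1) := by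
      rw [Nat.count_succ, if_pos hj]
    rw [hcount, hsucc, level_embeddingType hS hF, level_embeddingType hS hF, hn,
      Step.next_map hK hd]
    ext y
    constructor
    · rintro ⟨_, ⟨z, hz, c, hc, rfl⟩, rfl⟩
      exact ⟨z, hz, c, hc, keepIndices_snoc_of_mem c (by rw [hz.2]; exact hj)⟩
    · rintro ⟨z, hz, c, hc, rfl⟩
      exact ⟨_, ⟨z, hz, c, hc, rfl⟩, keepIndices_snoc_of_mem c (by rw [hz.2]; exact hj)⟩

/-- The length of a word of `F` is interesting, so a strictly longer word has a strictly longer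
image. This gives `w` at most the length of `w'`, and deletion is injective on the level of `w`. -/
theorem eq_of_keepIndices_prefix {w w' : Word} (hw : w ∈ F) (hw' : w' ∈ F)
    (h : keepIndices (interesting F) w <+: keepIndices (interesting F) w') : w' = w := by
  rcases lt_or_ge w'.length w.length with hl | hl
  · exact absurd h.length_le
      (not_le.2 (length_keepIndices_lt (length_mem_interesting hS hF hw') le_rfl hl))
  · have h1 : (w'.take w.length).length = w.length := by simp [hl]
    have h2 : keepIndices (interesting F) w = keepIndices (interesting F) (w'.take w.length) :=
      List.IsPrefix.eq_of_length (List.prefix_of_prefix_length_le h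
        (keepIndices_prefix _ (List.take_prefix _ _)) (length_keepIndices_congr h1.symm).le)
        (length_keepIndices_congr h1.symm)
    have h3 := ((isoOn_keepIndices hS hF w.length).eq_iff
      ⟨subset_initialSegments F hw, rfl⟩
      ⟨take_mem_initialSegments (subset_initialSegments F hw') _, h1⟩).1 h2
    exact (hF hw).2 w' (hF hw').1 (by rw [h3]; exact List.take_prefix _ _)

theorem leaves_initialSegments_embeddingType :
    leaves (initialSegments (embeddingType F)) = embeddingType F := by
  apply leaves_initialSegments_of_antichain
  rintro _ ⟨w, hw, rfl⟩ _ ⟨w', hw', rfl⟩ h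
  rw [eq_of_keepIndices_prefix hS hF hw hw' h]

theorem injOn_keepIndices : Set.InjOn (keepIndices (interesting F)) F :=
  fun w hw w' hw' h => (eq_of_keepIndices_prefix hS hF hw hw' (by rw [h])).symm

theorem sep_keepIndices_iff {w w' : Word} (hw : w ∈ F) (hw' : w' ∈ F) :
    Sep (keepIndices (interesting F) w) (keepIndices (interesting F) w') ↔ Sep w w' := by
  have hT : ∀ w ∈ F, ∀ i ≤ w.length, w.take i ∈ level (initialSegments F) i := fun w hw i h =>
    ⟨take_mem_initialSegments (subset_initialSegments F hw) _, by simp [h]⟩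
  have key : ∀ w ∈ F, ∀ w' ∈ F, w.length ≤ w'.length →
      keepIndices (interesting F) (w'.take w.length) =
        (keepIndices (interesting F) w').take (keepIndices (interesting F) w).length := by
    intro w hw w' hw' hl
    rw [List.prefix_iff_eq_take.1 (keepIndices_prefix (interesting F)
      (List.take_prefix w.length w')), length_keepIndices_congr (u := w'.take w.length) (v := w)
      (by simp [hl])]
  rcases le_total w.length w'.length with hl | hl
  · have := (isoOn_keepIndices hS hF w.length).sep_iff _
      ⟨subset_initialSegments F hw, rfl⟩ _ (hT w' hw' _ hl)
    rwa [key w hw w' hw' hl, sep_take_right le_rfl, sep_take_right le_rfl] at this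
  · have := (isoOn_keepIndices hS hF w'.length).sep_iff _ (hT w hw _ hl) _
      ⟨subset_initialSegments F hw', rfl⟩
    rwa [key w' hw' w hw hl, sep_take_left le_rfl, sep_take_left le_rfl] at this

theorem precEq_keepIndices_iff (hfin : F.Finite) {w w' : Word} (hw : w ∈ F) (hw' : w' ∈ F) :
    PrecEq (keepIndices (interesting F) w) (keepIndices (interesting F) w') ↔ PrecEq w w' := by
  have hR := isPosetType_embeddingType hS hF hfin
  have hm : ∀ w ∈ F, keepIndices (interesting F) w ∈ initialSegments (embeddingType F) :=
    fun w hw => subset_initialSegments _ ⟨w, hw, rfl⟩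
  rw [PrecEq, PrecEq, (injOn_keepIndices hS hF).eq_iff hw hw', hR.prec_iff (hm w hw) (hm w' hw'),
    hS.prec_iff (hF hw).1 (hF hw').1, sep_keepIndices_iff hS hF hw hw']

end EmbeddingType

theorem initialSegments_finite {F : Set Word} (h : F.Finite) : (initialSegments F).Finite := by
  have : initialSegments F = ⋃ w ∈ F, {u | u ∈ w.inits} := by
    ext u
    simp [initialSegments, List.mem_inits]
  rw [this]
  exact h.biUnion fun w _ => List.finite_toSet _

/-- The colour of an embedding is a poset-type of the embedded order. -/
theorem color_mem_types {P : Type*} [PartialOrder P] {ψ : P → Word}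
    (hψ : IsPosetTypeEmbedding ψ) {A : Type*} [PartialOrder A] [Finite A] (g : A ↪o P) :
    color ψ g ∈ types A := by
  set F := ψ '' Set.range g with hFdef
  have hF : F ⊆ leaves (initialSegments (Set.range ψ)) := by
    rintro _ ⟨p, -, rfl⟩
    exact hψ.mem_leaves p
  have hfin : F.Finite := (Set.finite_range g).image ψ
  have hS := hψ.isPosetType
  have hFm : ∀ a, ψ (g a) ∈ F := fun a => ⟨g a, ⟨a, rfl⟩, rfl⟩
  refine ⟨isPosetType_embeddingType hS hF hfin, initialSegments_finite (hfin.image _), ?_⟩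
  have hl := leaves_initialSegments_embeddingType hS hF
  have hmem : ∀ a, keepIndices (interesting F) (ψ (g a)) ∈ leaves (color ψ g) := fun a => by
    rw [color, hl]
    exact ⟨_, hFm a, rfl⟩
  refine ⟨Equiv.ofBijective (fun a => ⟨_, hmem a⟩) ⟨fun a b h => ?_, ?_⟩, fun a b => ?_⟩
  · exact EmbeddingLike.injective g (hψ.injective (injOn_keepIndices hS hF (hFm a) (hFm b)
      (congrArg Subtype.val h)))
  · rintro ⟨u, hu⟩
    rw [color, hl] at hu
    obtain ⟨_, ⟨_, ⟨a, rfl⟩, rfl⟩, rfl⟩ := hu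
    exact ⟨a, rfl⟩
  · change a ≤ b ↔ PrecEq (keepIndices (interesting F) (ψ (g a)))
      (keepIndices (interesting F) (ψ (g b)))
    rw [precEq_keepIndices_iff hS hF hfin (hFm a) (hFm b), ← hψ.le_iff, g.le_iff_le]

/-! ### Universality and indivisibility -/

namespace IsGenericPartialOrder
variable {P : Type*} [PartialOrder P]

/-- Universality is stated for orders in `Type`; a countable order in any universe has a copy there.
-/
theorem exists_orderEmbedding (hP : IsGenericPartialOrder P) (Q : Type*) [PartialOrder Q]
    [Countable Q] : Nonempty (Q ↪o P) := by
  let e : Shrink.{0} Q ≃ Q := (equivShrink.{0} Q).symm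
  have : Countable (Shrink.{0} Q) := e.injective.countable
  let i : PartialOrder (Shrink.{0} Q) := PartialOrder.lift e e.injective
  obtain ⟨f⟩ := @hP.universal (Shrink.{0} Q) i this
  refine ⟨OrderEmbedding.ofMapLEIff (fun a => f (e.symm a)) fun a b => ?_⟩
  rw [f.le_iff_le]
  change e (e.symm a) ≤ e (e.symm b) ↔ a ≤ b
  rw [e.apply_symm_apply, e.apply_symm_apply]

theorem exists_map_lt_iff (hP : IsGenericPartialOrder P) {Q : Type*} [Countable Q]
    (r : Q → Q → Prop) (hirr : ∀ a, ¬ r a a) (htrans : ∀ a b c, r a b → r b c → r a c) :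
    ∃ j : Q → P, ∀ a b, j a < j b ↔ r a b := by
  have : IsStrictOrder Q r := { irrefl := hirr, trans := htrans }
  let _ : PartialOrder Q := partialOrderOfSO r
  obtain ⟨f⟩ := hP.exists_orderEmbedding Q
  exact ⟨f, fun a b => f.lt_iff_lt⟩

theorem nonempty (hP : IsGenericPartialOrder P) : Nonempty P := by
  obtain ⟨f⟩ := hP.exists_orderEmbedding Unit
  exact ⟨f ()⟩

theorem exists_lt (hP : IsGenericPartialOrder P) : ∃ p q : P, p < q := by
  obtain ⟨f⟩ := hP.exists_orderEmbedding Bool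
  exact ⟨f false, f true, f.lt_iff_lt.2 (by decide)⟩

/-- Embed the lexicographic product of `P` with itself. Either a whole fibre lies in `X`, or a point
outside `X` can be chosen in each fibre, and such a choice is again a copy of `P`. -/
theorem exists_orderEmbedding_mem_or_notMem (hP : IsGenericPartialOrder P) (X : Set P) :
    (∃ e : P ↪o P, ∀ p, e p ∈ X) ∨ ∃ e : P ↪o P, ∀ p, e p ∉ X := by
  have := hP.countable
  have : Countable (P ×ₗ P) := inferInstanceAs (Countable (P × P))
  obtain ⟨j⟩ := hP.exists_orderEmbedding (P ×ₗ P)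
  by_cases h : ∃ p, ∀ q, j (toLex (p, q)) ∈ X
  · obtain ⟨p, hp⟩ := h
    refine .inl ⟨OrderEmbedding.ofMapLEIff (fun q => j (toLex (p, q))) fun a b => ?_, hp⟩
    rw [j.le_iff_le, Prod.Lex.toLex_le_toLex]
    simp
  · push Not at h
    choose q hq using h
    refine .inr ⟨OrderEmbedding.ofMapLEIff (fun p => j (toLex (p, q p))) fun a b => ?_, hq⟩
    rw [j.le_iff_le, Prod.Lex.toLex_le_toLex]
    constructor
    · rintro (h | h)
      · exact h.le
      · exact h.1.le
    · intro h
      rcases h.lt_or_eq with h | rfl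
      · exact .inl h
      · exact .inr ⟨rfl, le_rfl⟩

theorem exists_monochromatic (hP : IsGenericPartialOrder P) {C : Type*} [Finite C] (c : P → C) :
    ∃ (e : P ↪o P) (k : C), ∀ p, c (e p) = k := by
  classical
  have key : ∀ (t : Finset C) (c : P → C), (∀ p, c p ∈ t) →
      ∃ (e : P ↪o P) (k : C), ∀ p, c (e p) = k := by
    intro t
    induction t using Finset.induction_on with
    | empty =>
      intro c hc
      exact absurd (hc hP.nonempty.some) (Finset.notMem_empty _)
    | insert a t ha ih =>
      intro c hc
      rcases hP.exists_orderEmbedding_mem_or_notMem {p | c p = a} with ⟨e, he⟩ | ⟨e, he⟩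
      · exact ⟨e, a, he⟩
      · obtain ⟨e', k, hk⟩ := ih (c ∘ e) fun p =>
          (Finset.mem_insert.1 (hc (e p))).resolve_left (he p)
        exact ⟨e'.trans e, k, hk⟩
  have := Fintype.ofFinite C
  exact key Finset.univ c fun p => Finset.mem_univ _

end IsGenericPartialOrder

/-! ### Spread families -/

/-- `φ` codes a partial order by leaves of the poset-type `S`. -/
structure IsCoding {P : Type*} [PartialOrder P] (S : Set Word) (φ : P → Word) : Prop where
  isPosetType : IsPosetType S
  mem_leaves : ∀ p, φ p ∈ leaves S
  injective : Function.Injective φ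
  lt_iff : ∀ p q, p < q ↔ Sep (φ p) (φ q)

/-- The level `U` is copied by `h` to level `m` of `S`, and `θ` chooses codes above the copies so
that every order between labelled points which `U` permits is realised. -/
structure Spread {P : Type*} [PartialOrder P] (S : Set Word) (φ : P → Word) (U : Set Word) (m : ℕ)
    (h : Word → Word) (θ : P → Word → P) : Prop where
  iso : IsoOn h U
  mem : ∀ s ∈ U, h s ∈ level S m
  -- `Sep` of the words forces the order and failure of `Below` forbids it; in all other cases the
  -- indices `p` and `q` decide.
  lt_iff : ∀ p q, ∀ s ∈ U, ∀ t ∈ U, (θ p s < θ q t ↔ Sep s t ∨ (Below s t ∧ p < q))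
  take : ∀ p, ∀ s ∈ U, (φ (θ p s)).take m = h s

theorem Below.dropLast {u v : Word} (h : Below u v) : Below u.dropLast v.dropLast := by
  rw [List.dropLast_eq_take, List.dropLast_eq_take]
  exact h.take _ _

theorem Sep.of_dropLast {u v : Word} (h : Sep u.dropLast v.dropLast) : Sep u v := by
  rw [List.dropLast_eq_take, List.dropLast_eq_take] at h
  exact h.of_take

section
variable {P : Type*} [PartialOrder P] {S : Set Word} {φ : P → Word}

/-- One point `x` is coded above the copy of `s₀`, and the family is refined to one over the level
`U'` whose members lie above or below `x` as prescribed by `D` and `E`. -/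
theorem Spread.refine (hP : IsGenericPartialOrder P) (hφ : IsCoding S φ) {U U' : Set Word}
    {n m : ℕ} {h : Word → Word} {θ : P → Word → P} (hU : IsLevel n U) (hθ : Spread S φ U m h θ)
    (hU' : IsLevel (n + 1) U') (hdrop : ∀ s ∈ U', s.dropLast ∈ U) {s₀ : Word} (hs₀ : s₀ ∈ U)
    (D E : Word → Prop)
    (hED : ∀ s ∈ U', ∀ t ∈ U', E s → D t → Sep s t)
    (hD : ∀ s ∈ U', ∀ t ∈ U', D s → Below s t → D t)
    (hE : ∀ s ∈ U', ∀ t ∈ U', E t → Below s t → E s)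
    (hD₁ : ∀ t ∈ U', D t → Below s₀ t.dropLast) (hD₂ : ∀ t ∈ U', Sep s₀ t.dropLast → D t)
    (hE₁ : ∀ s ∈ U', E s → Below s.dropLast s₀) (hE₂ : ∀ s ∈ U', Sep s.dropLast s₀ → E s)
    (hkill : ∀ s ∈ U', ∀ t ∈ U', Below s.dropLast t.dropLast → ¬ Below s t → D s ∧ ¬ D t)
    (hmake : ∀ s ∈ U', ∀ t ∈ U', Sep s t → ¬ Sep s.dropLast t.dropLast → E s ∧ D t) :
    ∃ (x : P) (h' : Word → Word) (θ' : P → Word → P), m ≤ (φ x).length ∧ (φ x).take m = h s₀ ∧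
      Spread S φ U' ((φ x).length + 1) h' θ' ∧ (∀ s ∈ U', (h' s).take m = h s.dropLast) ∧
      (∀ s ∈ U', Sep (φ x) (h' s) ↔ D s) ∧ ∀ s ∈ U', Sep (h' s) (φ x) ↔ E s := by
  classical
  have := hP.countable
  -- The order wanted on the new families together with the new point, which is `none`. The
  -- conditions `hED`, `hD` and `hE` are what its transitivity requires.
  let r : Option (P × U') → Option (P × U') → Prop
    | none, none => False
    | none, some a => D a.2
    | some a, none => E a.2
    | some a, some b => Sep a.2.1 b.2.1 ∨ (Below a.2.1 b.2.1 ∧ a.1 < b.1)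
  have hSB : ∀ a ∈ U', ∀ b ∈ U', Sep a b → Below a b := hU'.below
  obtain ⟨j, hj⟩ := hP.exists_map_lt_iff r
    (by
      rintro (_ | ⟨p, s⟩) hr
      · exact hr
      · rcases hr with hr | hr
        · exact not_sep_self _ hr
        · exact lt_irrefl _ hr.2)
    (by
      rintro (_ | ⟨p, s⟩) (_ | ⟨q, t⟩) (_ | ⟨o, u⟩) h1 h2
      · exact h1
      · exact h1.elim
      · exact not_sep_self _ (hED t t.2 t t.2 h2 h1)
      · exact hD t t.2 u u.2 h1 (h2.elim (hSB _ t.2 _ u.2) And.left)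
      · exact h2.elim
      · exact .inl (hED s s.2 u u.2 h1 h2)
      · exact hE s s.2 t t.2 h2 (h1.elim (hSB _ s.2 _ t.2) And.left)
      · rcases h1 with h1 | h1 <;> rcases h2 with h2 | h2
        · exact .inl (hU'.sep_below t.2 u.2 h1 (hSB _ t.2 _ u.2 h2))
        · exact .inl (hU'.sep_below t.2 u.2 h1 h2.1)
        · exact .inl (hU'.below_sep s.2 t.2 h1.1 h2)
        · exact .inr ⟨hU'.below_trans s.2 t.2 h1.1 h2.1, h1.2.trans h2.2⟩)
  -- The order `r` is first realised by indices in `P` and then carried over by `θ`. This is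
  -- faithful because `r` contains `Sep` of the old words and is contained in `Below`.
  set x := θ (j none) s₀ with hx
  set M := (φ x).length with hM
  have hxm : (φ x).take m = h s₀ := hθ.take _ _ hs₀
  have hmM : m ≤ M := by
    have := congrArg List.length hxm
    rw [(hθ.mem _ hs₀).2, List.length_take] at this
    omega
  set θ₀ : P → U' → P := fun p s => θ (j (some (p, s))) s.1.dropLast with hθ₀
  have hθ₀lt : ∀ p q s t, θ₀ p s < θ₀ q t ↔ Sep s.1 t.1 ∨ (Below s.1 t.1 ∧ p < q) := by
    intro p q s t
    rw [hθ₀]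
    simp only
    rw [hθ.lt_iff _ _ _ (hdrop s s.2) _ (hdrop t t.2), hj]
    constructor
    · rintro (h1 | h1)
      · exact .inl h1.of_dropLast
      · exact h1.2
    · intro h1
      exact .inr ⟨(h1.elim (hSB _ s.2 _ t.2) And.left).dropLast, h1⟩
  have hxlt : ∀ q t, x < θ₀ q t ↔ D t := by
    intro q t
    rw [hx, hθ.lt_iff _ _ _ hs₀ _ (hdrop t t.2), hj]
    constructor
    · rintro (h1 | h1)
      · exact hD₂ t t.2 h1
      · exact h1.2
    · intro h1
      exact .inr ⟨hD₁ t t.2 h1, h1⟩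
  have hltx : ∀ q t, θ₀ q t < x ↔ E t := by
    intro q t
    rw [hx, hθ.lt_iff _ _ _ (hdrop t t.2) _ hs₀, hj]
    constructor
    · rintro (h1 | h1)
      · exact hE₂ t t.2 h1
      · exact h1.2
    · intro h1
      exact .inr ⟨hE₁ t t.2 h1, h1⟩
  have hfinU' : Finite U' :=
    (List.finite_length_eq Letter (n + 1)).subset fun u hu => hU'.length u hu
  have hfinC : Finite {w : Word | w.length ≤ M + 1} := List.finite_length_le Letter (M + 1)
  -- The colour of an index lists the prefixes of length `M + 1` of its codes over all words of
  -- `U'`. There are finitely many colours, so on a copy of `P` these prefixes are constant.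
  obtain ⟨e, k, hk⟩ := hP.exists_monochromatic
    (C := U' → {w : Word | w.length ≤ M + 1})
    fun p s => ⟨(φ (θ₀ p s)).take (M + 1), by simp⟩
  have hk' : ∀ p s, (φ (θ₀ (e p) s)).take (M + 1) = (k s).1 := fun p s =>
    congrArg Subtype.val (congrFun (hk p) s)
  -- A shorter constant prefix would be the entire code of every point of the family, against
  -- injectivity.
  have hklen : ∀ s, (k s).1.length = M + 1 := by
    intro s
    refine le_antisymm (k s).2 (not_lt.1 fun hlt => ?_)
    have hall : ∀ p, φ (θ₀ (e p) s) = (k s).1 := by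
      intro p
      rw [← hk' p s, List.length_take] at hlt
      rw [← hk' p s, List.take_of_length_le (by omega)]
    obtain ⟨p, q, hpq⟩ := hP.exists_lt
    have h1 : θ₀ (e p) s < θ₀ (e q) s :=
      (hθ₀lt _ _ _ _).2 (.inr ⟨Below.refl _, e.lt_iff_lt.2 hpq⟩)
    rw [hφ.injective ((hall p).trans (hall q).symm)] at h1
    exact lt_irrefl _ h1
  let h' : Word → Word := fun s => if hs : s ∈ U' then (k ⟨s, hs⟩).1 else []
  let θ' : P → Word → P := fun p s => if hs : s ∈ U' then θ₀ (e p) ⟨s, hs⟩ else x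
  have hh' : ∀ s : U', h' s = (k s).1 := fun s => dif_pos s.2
  have hθ' : ∀ p, ∀ s : U', θ' p s = θ₀ (e p) s := fun p s => dif_pos s.2
  have htake : ∀ p, ∀ s ∈ U', (φ (θ' p s)).take (M + 1) = h' s := by
    intro p s hs
    rw [hh' ⟨s, hs⟩, hθ' p ⟨s, hs⟩, hk']
  have hlen : ∀ s ∈ U', (h' s).length = M + 1 := fun s hs => by rw [hh' ⟨s, hs⟩, hklen]
  have hmem : ∀ s ∈ U', h' s ∈ level S (M + 1) := by
    intro s hs
    refine ⟨?_, hlen s hs⟩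
    rw [← htake (hP.nonempty.some) s hs]
    exact hφ.isPosetType.take_mem (hφ.mem_leaves _).1 _
  have hlt' : ∀ p q, ∀ s ∈ U', ∀ t ∈ U',
      (θ' p s < θ' q t ↔ Sep s t ∨ (Below s t ∧ p < q)) := by
    intro p q s hs t ht
    rw [hθ' p ⟨s, hs⟩, hθ' q ⟨t, ht⟩, hθ₀lt, e.lt_iff_lt]
  have htm : ∀ s ∈ U', (h' s).take m = h s.dropLast := by
    intro s hs
    obtain ⟨p⟩ := hP.nonempty
    rw [← htake p s hs, List.take_take, min_eq_left (by omega), hθ' p ⟨s, hs⟩]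
    exact hθ.take _ _ (hdrop s hs)
  have hDs : ∀ s ∈ U', Sep (φ x) (h' s) ↔ D s := by
    intro s hs
    obtain ⟨p⟩ := hP.nonempty
    rw [← htake p s hs, sep_take_right (by omega), ← hφ.lt_iff, hθ' p ⟨s, hs⟩, hxlt]
  have hEs : ∀ s ∈ U', Sep (h' s) (φ x) ↔ E s := by
    intro s hs
    obtain ⟨p⟩ := hP.nonempty
    rw [← htake p s hs, sep_take_left (by omega), ← hφ.lt_iff, hθ' p ⟨s, hs⟩, hltx]
  have hL := hφ.isPosetType.isLevel (M + 1)
  have hbelow : ∀ s ∈ U', ∀ t ∈ U', (Below (h' s) (h' t) ↔ Below s t) := by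
    intro s hs t ht
    constructor
    · intro hb
      by_contra hn
      by_cases hπ : Below s.dropLast t.dropLast
      -- The point `x` is below the family over `s` but not below the one over `t`; were the copies
      -- still `Below`, separation from `x` would pass on to `t`.
      · obtain ⟨h1, h2⟩ := hkill s hs t ht hπ hn
        exact h2 ((hDs t ht).1 (hL.sep_below (hmem s hs) (hmem t ht) ((hDs s hs).2 h1) hb))
      · apply hπ
        rw [← hθ.iso.below_iff _ (hdrop s hs) _ (hdrop t ht), ← htm s hs, ← htm t ht]
        exact hb.take _ _
    · intro hb
      -- With `p < q` the two points are comparable, and their codes are then separated and hence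
      -- `Below`.
      obtain ⟨p, q, hpq⟩ := hP.exists_lt
      have h1 := (hφ.lt_iff _ _).1 ((hlt' p q s hs t ht).2 (.inr ⟨hb, hpq⟩))
      have h2 := hφ.isPosetType.below_of_sep (hφ.mem_leaves _).1 (hφ.mem_leaves _).1 h1
      rw [← htake p s hs, ← htake q t ht]
      exact h2.take _ _
  have hsep : ∀ s ∈ U', ∀ t ∈ U', (Sep (h' s) (h' t) ↔ Sep s t) := by
    intro s hs t ht
    constructor
    · intro h1
      obtain ⟨p⟩ := hP.nonempty
      rw [← htake p s hs, ← htake p t ht] at h1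
      -- For equal indices only `Sep s t` can order the two points.
      have := (hlt' p p s hs t ht).1 ((hφ.lt_iff _ _).2 h1.of_take)
      exact this.resolve_right fun h => lt_irrefl _ h.2
    · intro h1
      by_cases hπ : Sep s.dropLast t.dropLast
      · rw [← hθ.iso.sep_iff _ (hdrop s hs) _ (hdrop t ht), ← htm s hs, ← htm t ht] at hπ
        exact hπ.of_take
      · obtain ⟨h2, h3⟩ := hmake s hs t ht h1 hπ
        have h4 := (hDs t ht).2 h3
        exact ((hEs s hs).2 h2).trans_below
          (hφ.isPosetType.below_of_sep (hφ.mem_leaves _).1 (hmem t ht).1 h4)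
          (by rw [hlen t ht]; omega)
  have hlt : ∀ s ∈ U', ∀ t ∈ U', s < t → h' s < h' t := by
    intro s hs t ht hst
    by_cases hb : Below s t
    · have hb' := (hbelow s hs t ht).2 hb
      refine hb'.lt (by rw [hlen s hs, hlen t ht]) fun heq => ?_
      have : Below t s := by rw [← hbelow t ht s hs, heq]; exact Below.refl _
      exact hst.ne (hU'.below_antisymm hs ht hb this)
    · have hs0 : s ≠ [] := by
        rintro rfl; simpa using hU'.length _ hs
      have ht0 : t ≠ [] := by
        rintro rfl; simpa using hU'.length _ ht
      have hl := hU.length_eq (hdrop s hs) (hdrop t ht)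
      have h1 := hst
      rw [← List.dropLast_append_getLast hs0, ← List.dropLast_append_getLast ht0] at h1 hb
      rw [snoc_lt_snoc_iff hl] at h1
      rw [below_snoc_iff hl] at hb
      rcases h1 with h1 | ⟨h1, h2⟩
      · refine lt_of_take_lt (n := m) ?_ ?_
        · rw [htm s hs, htm t ht, (hθ.mem _ (hdrop s hs)).2, (hθ.mem _ (hdrop t ht)).2]
        · rw [htm s hs, htm t ht]
          exact (hθ.iso.lt_iff _ (hdrop s hs) _ (hdrop t ht)).2 h1
      · exact absurd ⟨by rw [h1]; exact Below.refl _, h2.le⟩ hb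
  refine ⟨x, h', θ', hmM, hxm, ⟨⟨fun s hs t ht => ⟨fun h1 => ?_, hlt s hs t ht⟩, hbelow, hsep⟩,
    hmem, hlt', htake⟩, htm, hDs, hEs⟩
  rcases lt_trichotomy s t with h2 | rfl | h2
  · exact h2
  · exact absurd h1 (lt_irrefl _)
  · exact absurd h1 (lt_asymm (hlt t ht s hs h2))

end

/-! ### Copying a single step -/

/-- Prolonging words can only destroy `Below` and create `Sep`, and it keeps the lexicographic order
of distinct words of equal length. Once these two changes are excluded, nothing else can go wrong.
-/
theorem IsoOn.of_take {U : Set Word} {h e : Word → Word} {m : ℕ} (hh : IsoOn h U)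
    (hm : ∀ z ∈ U, (h z).length = m)
    (htake : ∀ z ∈ U, (e z).take m = h z)
    (hbelow : ∀ s ∈ U, ∀ t ∈ U, Below s t → Below (e s) (e t))
    (hsep : ∀ s ∈ U, ∀ t ∈ U, Sep (e s) (e t) → Sep s t) : IsoOn e U := by
  have hlt : ∀ s ∈ U, ∀ t ∈ U, s < t → e s < e t := by
    intro s hs t ht hst
    refine lt_of_take_lt (n := m) ?_ ?_
    · rw [htake s hs, htake t ht, hm s hs, hm t ht]
    · rw [htake s hs, htake t ht]
      exact (hh.lt_iff s hs t ht).2 hst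
  refine ⟨fun s hs t ht => ⟨fun h1 => ?_, hlt s hs t ht⟩,
    fun s hs t ht => ⟨fun h1 => ?_, hbelow s hs t ht⟩,
    fun s hs t ht => ⟨hsep s hs t ht, fun h1 => ?_⟩⟩
  · rcases lt_trichotomy s t with h2 | rfl | h2
    · exact h2
    · exact absurd h1 (lt_irrefl _)
    · exact absurd h1 (lt_asymm (hlt t ht s hs h2))
  · rw [← hh.below_iff s hs t ht, ← htake s hs, ← htake t ht]
    exact h1.take _ _
  · rw [← hh.sep_iff s hs t ht, ← htake s hs, ← htake t ht] at h1
    exact h1.of_take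

theorem IsoOn.snoc {U U' : Set Word} {n j : ℕ} {e h : Word → Word} {d : Step} (hU : IsLevel n U)
    (he : IsoOn e U) (hj : ∀ z ∈ U, (e z).length = j) (hU' : U' = d.Next U)
    (hh : ∀ z ∈ U, ∀ c, d.Allowed z c → h (z ++ [c]) = e z ++ [c]) : IsoOn h U' := by
  subst hU'
  have hl : ∀ s ∈ U, ∀ t ∈ U, (e s).length = (e t).length := fun s hs t ht => by
    rw [hj s hs, hj t ht]
  constructor
  · rintro _ ⟨s, hs, c, hc, rfl⟩ _ ⟨t, ht, c', hc', rfl⟩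
    rw [hh s hs c hc, hh t ht c' hc', snoc_lt_snoc_iff (hl s hs t ht),
      snoc_lt_snoc_iff (hU.length_eq hs ht), he.lt_iff s hs t ht, he.eq_iff hs ht]
  · rintro _ ⟨s, hs, c, hc, rfl⟩ _ ⟨t, ht, c', hc', rfl⟩
    rw [hh s hs c hc, hh t ht c' hc', below_snoc_iff (hl s hs t ht),
      below_snoc_iff (hU.length_eq hs ht), he.below_iff s hs t ht]
  · rintro _ ⟨s, hs, c, hc, rfl⟩ _ ⟨t, ht, c', hc', rfl⟩
    rw [hh s hs c hc, hh t ht c' hc', sep_snoc_iff (hl s hs t ht),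
      sep_snoc_iff (hU.length_eq hs ht), he.sep_iff s hs t ht]

section
variable {P : Type*} [PartialOrder P] {S : Set Word} {φ : P → Word}

/-- The new point `x` takes the place of `w`. Since `w` is related to every other word, the relation
of `x` to the other families is forced, so `φ x` completes a faithful copy of the level at height
`M`. -/
theorem Spread.leaf (hP : IsGenericPartialOrder P) (hφ : IsCoding S φ) {U : Set Word} {n m : ℕ}
    {h : Word → Word} {θ : P → Word → P} (hU : IsLevel n U) (hθ : Spread S φ U m h θ) {w : Word}
    (hd : (Step.leaf w).Valid U) :
    ∃ (j : ℕ) (e h' : Word → Word) (θ' : P → Word → P), m ≤ j ∧ IsoOn e U ∧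
      (∀ z ∈ U, e z ∈ level S j ∧ (e z).take m = h z) ∧
      Spread S φ ((Step.leaf w).Next U) (j + 1) h' θ' ∧
      (∀ z ∈ U, ∀ c, (Step.leaf w).Allowed z c → h' (z ++ [c]) = e z ++ [c]) ∧
      ∃ x, e w = φ x := by
  have hU' := Step.isLevel_next hU hd
  obtain ⟨x, h', θ', hm, hx, hθ', htake, hD, hE⟩ := hθ.refine hP hφ hU hU'
    (by rintro _ ⟨z, hz, c, -, rfl⟩; rwa [List.dropLast_concat]) hd.1
    (fun s => Sep w s.dropLast) (fun s => Sep s.dropLast w)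
    (by
      rintro _ ⟨s, hs, c, hc, rfl⟩ _ ⟨t, ht, c', hc', rfl⟩ h1 h2
      rw [List.dropLast_concat] at h1 h2
      rw [Step.sep_snoc hU hd hs ht hc hc']
      exact .inl (hU.sep_below hd.1 ht h1 (hU.below _ hd.1 _ ht h2)))
    (by
      rintro _ ⟨s, hs, c, hc, rfl⟩ _ ⟨t, ht, c', hc', rfl⟩ h1 h2
      rw [List.dropLast_concat] at h1 ⊢
      have h2 := h2.dropLast
      rw [List.dropLast_concat, List.dropLast_concat] at h2
      exact hU.sep_below hs ht h1 h2)
    (by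
      rintro _ ⟨s, hs, c, hc, rfl⟩ _ ⟨t, ht, c', hc', rfl⟩ h1 h2
      rw [List.dropLast_concat] at h1 ⊢
      have h2 := h2.dropLast
      rw [List.dropLast_concat, List.dropLast_concat] at h2
      exact hU.below_sep hs ht h2 h1)
    (by
      rintro _ ⟨t, ht, c', hc', rfl⟩ h1
      rw [List.dropLast_concat] at h1 ⊢
      exact hU.below _ hd.1 _ ht h1)
    (fun _ _ h => h)
    (by
      rintro _ ⟨t, ht, c', hc', rfl⟩ h1
      rw [List.dropLast_concat] at h1 ⊢
      exact hU.below _ ht _ hd.1 h1)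
    (fun _ _ h => h)
    (by
      rintro _ ⟨s, hs, c, hc, rfl⟩ _ ⟨t, ht, c', hc', rfl⟩ h1 h2
      rw [List.dropLast_concat, List.dropLast_concat] at h1
      exact absurd ((Step.below_snoc hU hd hs ht hc hc').2 ⟨h1, id⟩) h2)
    (by
      rintro _ ⟨s, hs, c, hc, rfl⟩ _ ⟨t, ht, c', hc', rfl⟩ h1 h2
      rw [List.dropLast_concat, List.dropLast_concat] at h2
      exact absurd ((Step.sep_snoc hU hd hs ht hc hc').1 h1) (by simp [h2, Step.Makes]))
  set M := (φ x).length with hM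
  classical
  set e : Word → Word := fun z => if z = w then φ x else (h' (z ++ [.X])).take M with he
  have hew : e w = φ x := if_pos rfl
  have hne : ∀ z, z ≠ w → e z = (h' (z ++ [.X])).take M := fun z hz => if_neg hz
  have hX : ∀ z ∈ U, z ≠ w → z ++ [.X] ∈ (Step.leaf w).Next U := fun z hz h =>
    ⟨z, hz, .X, ⟨h, rfl⟩, rfl⟩
  have hemem : ∀ z ∈ U, e z ∈ level S M := by
    intro z hz
    by_cases h1 : z = w
    · rw [h1, hew]
      exact ⟨(hφ.mem_leaves x).1, rfl⟩
    · rw [hne z h1]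
      have := hθ'.mem _ (hX z hz h1)
      exact hφ.isPosetType.take_mem_level this.1 (by rw [this.2]; omega)
  have hetake : ∀ z ∈ U, (e z).take m = h z := by
    intro z hz
    by_cases h1 : z = w
    · rw [h1, hew, hx]
    · rw [hne z h1, List.take_take, min_eq_left hm, htake _ (hX z hz h1), List.dropLast_concat]
  have hL := hφ.isPosetType.isLevel M
  have hsepD : ∀ z ∈ U, z ≠ w → (Sep (φ x) (e z) ↔ Sep w z) := by
    intro z hz h1
    rw [hne z h1, sep_take_right le_rfl, hD _ (hX z hz h1), List.dropLast_concat]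
  have hsepE : ∀ z ∈ U, z ≠ w → (Sep (e z) (φ x) ↔ Sep z w) := by
    intro z hz h1
    rw [hne z h1, sep_take_left le_rfl, hE _ (hX z hz h1), List.dropLast_concat]
  have hrel : ∀ z ∈ U, z ≠ w → Sep w z ∨ Sep z w ∨ (¬ Below w z ∧ ¬ Below z w) := by
    intro z hz h1
    have := (hU.related_iff hd.1 hz).1 (hd.2 z hz h1)
    exact this.resolve_left (Ne.symm h1)
  have hiso : IsoOn e U := by
    refine hθ.iso.of_take (fun z hz => (hθ.mem z hz).2) hetake ?_ ?_
    · intro s hs t ht hst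
      by_cases h1 : s = w
      · subst h1
        by_cases h2 : t = s
        · rw [h2]; exact Below.refl _
        · rcases hrel t ht h2 with h3 | h3 | h3
          · exact hL.below _ (hemem s hs) _ (hemem t ht) (by rw [hew]; exact (hsepD t ht h2).2 h3)
          · exact absurd (hU.sep_below hs ht h3 hst) (not_sep_self _)
          · exact absurd hst h3.1
      · by_cases h2 : t = w
        · subst h2
          rcases hrel s hs h1 with h3 | h3 | h3
          · exact absurd (hU.sep_below hs ht h3 hst) (not_sep_self _)
          · exact hL.below _ (hemem s hs) _ (hemem t ht) (by rw [hew]; exact (hsepE s hs h1).2 h3)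
          · exact absurd hst h3.2
        · rw [hne s h1, hne t h2]
          refine Below.take ?_ _ _
          rw [hθ'.iso.below_iff _ (hX s hs h1) _ (hX t ht h2),
            Step.below_snoc hU hd hs ht ⟨h1, rfl⟩ ⟨h2, rfl⟩]
          exact ⟨hst, id⟩
    · intro s hs t ht hst
      by_cases h1 : s = w
      · subst h1
        by_cases h2 : t = s
        · rw [h2] at hst; exact absurd hst (not_sep_self _)
        · rwa [hew, hsepD t ht h2] at hst
      · by_cases h2 : t = w
        · subst h2
          rwa [hew, hsepE s hs h1] at hst
        · rw [hne s h1, hne t h2] at hst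
          have := (hθ'.iso.sep_iff _ (hX s hs h1) _ (hX t ht h2)).1 hst.of_take
          exact ((Step.sep_snoc hU hd hs ht ⟨h1, rfl⟩ ⟨h2, rfl⟩).1 this).resolve_right id
  refine ⟨M, e, h', θ', hm, hiso, fun z hz => ⟨hemem z hz, hetake z hz⟩, hθ', ?_, x, hew⟩
  rintro z hz c ⟨h1, rfl⟩
  -- At height `M` the tree `S` drops the leaf `φ x`, so every other word receives `X`, as in the
  -- step to be copied.
  have h2 := hθ'.mem _ (hX z hz h1)
  rw [(hφ.isPosetType.leaf_step (hφ.mem_leaves x)).2] at h2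
  obtain ⟨y, hy, c, ⟨-, rfl⟩, h3⟩ := h2
  rw [hne z h1, h3, List.take_left' hy.2]

/-- The tree `S` performs the step `d` on copies of the words of `U` at the first level at which
the structure of the copies changes. -/
theorem exists_critical_level (hS : IsPosetType S) {U : Set Word} {n m m' : ℕ} {d : Step}
    {h h' : Word → Word} (hU : IsLevel n U) (hd : d.Valid U) (hleaf : ∀ w, d ≠ Step.leaf w)
    (hh : IsoOn h U) (hm : ∀ z ∈ U, h z ∈ level S m) (hh' : IsoOn h' (d.Next U))
    (hm' : ∀ s ∈ d.Next U, h' s ∈ level S m')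
    (htake : ∀ z ∈ U, ∀ c, d.Allowed z c → (h' (z ++ [c])).take m = h z) :
    ∃ (j : ℕ) (e : Word → Word), m ≤ j ∧ j + 1 ≤ m' ∧ IsoOn e U ∧
      (∀ z ∈ U, e z ∈ level S j ∧ (e z).take m = h z) ∧
      ∀ z ∈ U, ∀ c, d.Allowed z c → (h' (z ++ [c])).take (j + 1) = e z ++ [c] := by
  classical
  have hmemN : ∀ z ∈ U, ∀ c, d.Allowed z c → z ++ [c] ∈ d.Next U := fun z hz c hc =>
    ⟨z, hz, c, hc, rfl⟩
  -- A height is bad when the prefixes of that length have lost a pair of `Below` or gained a pair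
  -- of `Sep` in comparison with `U`. The step `d` makes `m'` bad, and heights up to `m` are good.
  let Bad : ℕ → Prop := fun k => ∃ z ∈ U, ∃ c, d.Allowed z c ∧ ∃ z' ∈ U, ∃ c', d.Allowed z' c' ∧
    ((Below z z' ∧ ¬ Below ((h' (z ++ [c])).take k) ((h' (z' ++ [c'])).take k)) ∨
      (¬ Sep z z' ∧ Sep ((h' (z ++ [c])).take k) ((h' (z' ++ [c'])).take k)))
  have hall : ∀ s ∈ d.Next U, (h' s).take m' = h' s := fun s hs =>
    List.take_of_length_le (hm' s hs).2.le
  have hexall : ∀ z, ∃ c, d.Allowed z c := fun z =>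
    Step.exists_allowed hd fun w hw => absurd hw (hleaf w)
  have hbad : Bad m' := by
    have key : ∀ z ∈ U, ∀ z' ∈ U, ∀ c c', d.Allowed z c → d.Allowed z' c' →
        ((Below z z' ∧ d.Kills z z' c c') ∨ (¬ Sep z z' ∧ d.Makes z z')) → Bad m' := by
      intro z hz z' hz' c c' hc hc' hk
      refine ⟨z, hz, c, hc, z', hz', c', hc', ?_⟩
      rw [hall _ (hmemN z hz c hc), hall _ (hmemN z' hz' c' hc'),
        hh'.below_iff _ (hmemN z hz c hc) _ (hmemN z' hz' c' hc'),
        hh'.sep_iff _ (hmemN z hz c hc) _ (hmemN z' hz' c' hc'),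
        Step.below_snoc hU hd hz hz' hc hc', Step.sep_snoc hU hd hz hz' hc hc']
      tauto
    cases d with
    | leaf w => exact absurd rfl (hleaf w)
    | branch w =>
      exact key w hd w hd .R .X (.inr (.inl ⟨rfl, .inr rfl⟩)) (.inr (.inl ⟨rfl, .inl rfl⟩))
        (.inl ⟨Below.refl _, rfl, rfl, rfl, rfl⟩)
    | perp v w =>
      obtain ⟨c, hc⟩ := hexall v
      obtain ⟨c', hc'⟩ := hexall w
      exact key v hd.1 w hd.2.1 c c' hc hc' (.inl ⟨(Step.valid_perp_below hd hU).1, rfl, rfl⟩)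
    | prec v w =>
      obtain ⟨c, hc⟩ := hexall v
      obtain ⟨c', hc'⟩ := hexall w
      exact key v hd.1 w hd.2.1 c c' hc hc' (.inr ⟨(Step.valid_prec_below hd hU).2, rfl, rfl⟩)
  have hgood : ∀ k ≤ m, ¬ Bad k := by
    rintro k hk ⟨z, hz, c, hc, z', hz', c', hc', hor⟩
    have h1 : ∀ z ∈ U, ∀ c, d.Allowed z c → (h' (z ++ [c])).take k = (h z).take k := by
      intro z hz c hc
      rw [← htake z hz c hc, List.take_take, min_eq_left hk]
    rw [h1 z hz c hc, h1 z' hz' c' hc'] at hor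
    rcases hor with ⟨h2, h3⟩ | ⟨h2, h3⟩
    · exact h3 (((hh.below_iff z hz z' hz').2 h2).take _ _)
    · exact h2 ((hh.sep_iff z hz z' hz').1 h3.of_take)
  have hex : ∃ k, Bad k := ⟨m', hbad⟩
  obtain ⟨j, hj⟩ : ∃ j, Nat.find hex = j + 1 := by
    refine Nat.exists_eq_succ_of_ne_zero fun h0 => ?_
    exact hgood 0 (Nat.zero_le _) (h0 ▸ Nat.find_spec hex)
  have hbadj : Bad (j + 1) := hj ▸ Nat.find_spec hex
  have hmin : ¬ Bad j := Nat.find_min hex (by omega)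
  have hmj : m ≤ j := by
    by_contra hlt
    exact hgood (j + 1) (by omega) hbadj
  have hjm' : j + 1 ≤ m' := hj ▸ Nat.find_min' hex hbad
  choose c₀ hc₀ using hexall
  set e : Word → Word := fun z => (h' (z ++ [c₀ z])).take j with he
  have hB : ∀ z ∈ U, ∀ c, d.Allowed z c → ∀ z' ∈ U, ∀ c', d.Allowed z' c' → Below z z' →
      Below ((h' (z ++ [c])).take j) ((h' (z' ++ [c'])).take j) := by
    intro z hz c hc z' hz' c' hc' hb
    by_contra hn
    exact hmin ⟨z, hz, c, hc, z', hz', c', hc', .inl ⟨hb, hn⟩⟩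
  have hlenj : ∀ z ∈ U, ∀ c, d.Allowed z c → ((h' (z ++ [c])).take j).length = j := by
    intro z hz c hc
    rw [List.length_take, (hm' _ (hmemN z hz c hc)).2]
    omega
  -- At the last good height the copies of the children of one word still coincide, because `Below z
  -- z` is preserved in both directions.
  have hej : ∀ z ∈ U, ∀ c, d.Allowed z c → (h' (z ++ [c])).take j = e z := by
    intro z hz c hc
    exact (hB z hz c hc z hz _ (hc₀ z) (Below.refl _)).antisymm
      (hB z hz _ (hc₀ z) z hz c hc (Below.refl _))
      (by rw [hlenj z hz c hc, hlenj z hz _ (hc₀ z)])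
  have hemem : ∀ z ∈ U, e z ∈ level S j := by
    intro z hz
    have := hm' _ (hmemN z hz _ (hc₀ z))
    exact hS.take_mem_level this.1 (by rw [this.2]; omega)
  have hetake : ∀ z ∈ U, (e z).take m = h z := by
    intro z hz
    rw [he]
    simp only
    rw [List.take_take, min_eq_left hmj, htake z hz _ (hc₀ z)]
  have hiso : IsoOn e U := by
    refine hh.of_take (fun z hz => (hm z hz).2) hetake
      (fun s hs t ht hst => hB s hs _ (hc₀ s) t ht _ (hc₀ t) hst) ?_
    intro s hs t ht hst
    by_contra hn
    exact hmin ⟨s, hs, _, hc₀ s, t, ht, _, hc₀ t, .inr ⟨hn, hst⟩⟩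
  refine ⟨j, e, hmj, hjm', hiso, fun z hz => ⟨hemem z hz, hetake z hz⟩, ?_⟩
  obtain ⟨z₁, hz₁, c₁, hc₁, z₂, hz₂, c₂, hc₂, hor⟩ := hbadj
  have hL := hS.isLevel j
  obtain ⟨d', hd', hn'⟩ := hS.exists_step ⟨_, hemem z₁ hz₁⟩
  have hletter : ∀ z ∈ U, ∀ c, d.Allowed z c →
      ∃ c', (h' (z ++ [c])).take (j + 1) = e z ++ [c'] ∧ d'.Allowed (e z) c' := by
    intro z hz c hc
    have h1 := hm' _ (hmemN z hz c hc)
    have h2 : (h' (z ++ [c])).take (j + 1) ∈ level S (j + 1) :=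
      hS.take_mem_level h1.1 (by rw [h1.2]; omega)
    rw [hn'] at h2
    obtain ⟨y, hy, c', hc', h3⟩ := h2
    have h4 : y = e z := by
      rw [← hej z hz c hc, ← List.take_left' (l₂ := [c']) hy.2, ← h3, List.take_take,
        min_eq_left (by omega)]
    exact ⟨c', by rw [h3, h4], h4 ▸ hc'⟩
  obtain ⟨a₁, ha₁, hal₁⟩ := hletter z₁ hz₁ c₁ hc₁
  obtain ⟨a₂, ha₂, hal₂⟩ := hletter z₂ hz₂ c₂ hc₂
  rw [ha₁, ha₂, Step.below_snoc hL hd' (hemem z₁ hz₁) (hemem z₂ hz₂) hal₁ hal₂,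
    Step.sep_snoc hL hd' (hemem z₁ hz₁) (hemem z₂ hz₂) hal₁ hal₂,
    hiso.below_iff z₁ hz₁ z₂ hz₂, hiso.sep_iff z₁ hz₁ z₂ hz₂] at hor
  -- A pair lost or gained at this height remains so up to `m'`, so it is also a pair that `d` kills
  -- or makes. Such a pair determines the kind and the witnesses of both steps.
  have hsame : d' = d.map e ∧ ∀ w, d = Step.branch w →
      z₁ = w ∧ z₂ = w ∧ c₁ = .R ∧ c₂ = .X ∧ a₁ = .R ∧ a₂ = .X := by
    rcases hor with ⟨h1, h2⟩ | ⟨h1, h2⟩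
    · have hk' : d'.Kills (e z₁) (e z₂) a₁ a₂ := by tauto
      have hnb : ¬ Below (z₁ ++ [c₁]) (z₂ ++ [c₂]) := by
        intro hb
        rw [← hh'.below_iff _ (hmemN z₁ hz₁ c₁ hc₁) _ (hmemN z₂ hz₂ c₂ hc₂)] at hb
        have := hb.take (j + 1) (j + 1)
        rw [ha₁, ha₂, Step.below_snoc hL hd' (hemem z₁ hz₁) (hemem z₂ hz₂) hal₁ hal₂] at this
        exact this.2 hk'
      rw [Step.below_snoc hU hd hz₁ hz₂ hc₁ hc₂] at hnb
      have hk : d.Kills z₁ z₂ c₁ c₂ := by tauto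
      cases d' with
      | leaf _ => exact hk'.elim
      | prec _ _ => exact hk'.elim
      | branch w' =>
        cases d with
        | leaf _ => exact hk.elim
        | prec _ _ => exact hk.elim
        | branch w =>
          refine ⟨by rw [Step.map, ← hk.1, hk'.1], ?_⟩
          rintro _ ⟨⟩
          exact ⟨hk.1, hk.2.1, hk.2.2.1, hk.2.2.2, hk'.2.2.1, hk'.2.2.2⟩
        | perp v w =>
          have := (hiso.eq_iff hz₁ hz₂).1 (hk'.1.trans hk'.2.1.symm)
          exact absurd hd.2.2.1 (by rw [← hk.1, ← hk.2, this]; exact lt_irrefl _)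
      | perp v' w' =>
        cases d with
        | leaf _ => exact hk.elim
        | prec _ _ => exact hk.elim
        | branch w =>
          exact absurd hd'.2.2.1 (by rw [← hk'.1, ← hk'.2, hk.1, hk.2.1]; exact lt_irrefl _)
        | perp v w =>
          exact ⟨by rw [Step.map, ← hk.1, ← hk.2, hk'.1, hk'.2], by simp⟩
    · have hk' : d'.Makes (e z₁) (e z₂) := by tauto
      have hnb : Sep (z₁ ++ [c₁]) (z₂ ++ [c₂]) := by
        rw [← hh'.sep_iff _ (hmemN z₁ hz₁ c₁ hc₁) _ (hmemN z₂ hz₂ c₂ hc₂)]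
        refine Sep.of_take (m := j + 1) (n := j + 1) ?_
        rw [ha₁, ha₂, Step.sep_snoc hL hd' (hemem z₁ hz₁) (hemem z₂ hz₂) hal₁ hal₂]
        exact .inr hk'
      rw [Step.sep_snoc hU hd hz₁ hz₂ hc₁ hc₂] at hnb
      have hk : d.Makes z₁ z₂ := by tauto
      cases d' with
      | prec v' w' =>
        cases d with
        | prec v w => exact ⟨by rw [Step.map, ← hk.1, ← hk.2, hk'.1, hk'.2], by simp⟩
        | _ => exact hk.elim
      | _ => exact hk'.elim
  obtain ⟨rfl, hbr⟩ := hsame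
  intro z hz c hc
  obtain ⟨a, ha, hal⟩ := hletter z hz c hc
  rw [Step.allowed_map hiso hd hz] at hal
  -- Letters are determined by the step except over a branching word, where the killed pair shows
  -- that `R` is copied to `R` and `X` to `X`.
  by_cases hdz : d = Step.branch z
  · obtain ⟨rfl, rfl, rfl, rfl, rfl, rfl⟩ := hbr z hdz
    subst hdz
    have : c = .X ∨ c = .R := by
      simpa only [Step.Allowed, lt_irrefl, false_and, or_false, false_or, true_and] using hc
    rcases this with rfl | rfl
    · exact ha₂
    · exact ha₁
  · rw [ha, Step.allowed_unique hd hc hal hdz]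

end

section
variable {P : Type*} [PartialOrder P] {S : Set Word} {φ : P → Word}

/-- At a step that drops no leaf there are a witness and prescriptions as in `Spread.refine`. -/
theorem Step.exists_prescription {U : Set Word} {n : ℕ} {d : Step} (hU : IsLevel n U)
    (hd : d.Valid U) (hleaf : ∀ w, d ≠ Step.leaf w) :
    ∃ s₀ ∈ U, ∃ D E : Word → Letter → Prop,
      (∀ s ∈ U, ∀ c, d.Allowed s c → ∀ t ∈ U, ∀ c', d.Allowed t c' → E s c → D t c' →
        Sep s t ∨ d.Makes s t) ∧
      (∀ s ∈ U, ∀ c, d.Allowed s c → ∀ t ∈ U, ∀ c', d.Allowed t c' → D s c → Below s t →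
        ¬ d.Kills s t c c' → D t c') ∧
      (∀ s ∈ U, ∀ c, d.Allowed s c → ∀ t ∈ U, ∀ c', d.Allowed t c' → E t c' → Below s t →
        E s c) ∧
      (∀ t ∈ U, ∀ c, d.Allowed t c → D t c → Below s₀ t) ∧
      (∀ t ∈ U, ∀ c, d.Allowed t c → Sep s₀ t → D t c) ∧
      (∀ s ∈ U, ∀ c, d.Allowed s c → E s c → Below s s₀) ∧
      (∀ s ∈ U, ∀ c, d.Allowed s c → Sep s s₀ → E s c) ∧
      (∀ s ∈ U, ∀ c, d.Allowed s c → ∀ t ∈ U, ∀ c', d.Allowed t c' → Below s t →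
        d.Kills s t c c' → D s c ∧ ¬ D t c') ∧
      (∀ s ∈ U, ∀ c, d.Allowed s c → ∀ t ∈ U, ∀ c', d.Allowed t c' → ¬ Sep s t →
        d.Makes s t → E s c ∧ D t c') := by
  cases d with
  | leaf w => exact absurd rfl (hleaf w)
  | branch w =>
    have hw : w ∈ U := hd
    -- The point is placed over `w`, below the points over the right child of `w` but not below
    -- those over the left child.
    refine ⟨w, hw, fun z c => (z = w ∧ c = .R) ∨ (z ≠ w ∧ Below w z), fun z _ => Sep z w,
      ?_, ?_, ?_, ?_, ?_, ?_, ?_, ?_, ?_⟩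
    · intro s hs c hc t ht c' hc' h1 h2
      refine .inl (hU.sep_below hw ht h1 ?_)
      rcases h2 with ⟨rfl, -⟩ | h2
      · exact Below.refl _
      · exact h2.2
    · intro s hs c hc t ht c' hc' h1 h2 h3
      by_cases htw : t = w
      · subst htw
        rcases h1 with ⟨rfl, rfl⟩ | h1
        · refine .inl ⟨rfl, ?_⟩
          simp only [Allowed, lt_irrefl, false_and, or_false, false_or, true_and] at hc'
          exact hc'.resolve_left fun h => h3 ⟨rfl, rfl, rfl, h⟩
        · exact absurd (hU.below_antisymm hs ht h2 h1.2) h1.1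
      · refine .inr ⟨htw, ?_⟩
        rcases h1 with ⟨rfl, -⟩ | h1
        · exact h2
        · exact hU.below_trans hw hs h1.2 h2
    · intro s hs c hc t ht c' hc' h1 h2
      exact hU.below_sep hs ht h2 h1
    · rintro t ht c hc (⟨rfl, -⟩ | h)
      · exact Below.refl _
      · exact h.2
    · intro t ht c hc h
      exact .inr ⟨by rintro rfl; exact not_sep_self _ h, hU.below _ hw _ ht h⟩
    · intro s hs c hc h
      exact hU.below _ hs _ hw h
    · intro s hs c hc h
      exact h
    · rintro s hs c hc t ht c' hc' h ⟨rfl, rfl, rfl, rfl⟩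
      exact ⟨.inl ⟨rfl, rfl⟩, by simp⟩
    · intro s hs c hc t ht c' hc' h h'
      exact h'.elim
  | perp v w =>
    have hv := hd.1
    have hw := hd.2.1
    have hvw := valid_perp_below hd hU
    -- The point is placed over `v` and below all families that `v` permits, except the one over
    -- `w`.
    refine ⟨v, hv, fun z _ => z ≠ w ∧ Below v z, fun z _ => Sep z v,
      ?_, ?_, ?_, ?_, ?_, ?_, ?_, ?_, ?_⟩
    · intro s hs c hc t ht c' hc' h1 h2
      exact .inl (hU.sep_below hv ht h1 h2.2)
    · intro s hs c hc t ht c' hc' h1 h2 h3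
      refine ⟨?_, hU.below_trans hv hs h1.2 h2⟩
      rintro rfl
      rcases valid_perp_cover hd hU hs h1.2 h2 with h | h
      · exact h3 ⟨h, rfl⟩
      · exact h1.1 h
    · intro s hs c hc t ht c' hc' h1 h2
      exact hU.below_sep hs ht h2 h1
    · intro t ht c hc h
      exact h.2
    · intro t ht c hc h
      exact ⟨by rintro rfl; exact hvw.2 h, hU.below _ hv _ ht h⟩
    · intro s hs c hc h
      exact hU.below _ hs _ hv h
    · intro s hs c hc h
      exact h
    · rintro s hs c hc t ht c' hc' h ⟨rfl, rfl⟩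
      exact ⟨⟨hd.2.2.1.ne, Below.refl _⟩, by simp⟩
    · intro s hs c hc t ht c' hc' h h'
      exact h'.elim
  | prec v w =>
    have hv := hd.1
    have hw := hd.2.1
    have hvw := valid_prec_below hd hU
    -- The point is placed over `v`, above the families of all words `Below` `v` and below the
    -- family of `w`.
    refine ⟨v, hv, fun z _ => z = w ∨ Sep v z, fun z _ => Below z v,
      ?_, ?_, ?_, ?_, ?_, ?_, ?_, ?_, ?_⟩
    · rintro s hs c hc t ht c' hc' h1 (rfl | h2)
      · by_cases h : s = v
        · exact .inr ⟨h, rfl⟩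
        · exact .inl (valid_prec_left hd hU hs h h1)
      · exact .inl (hU.below_sep hs hv h1 h2)
    · rintro s hs c hc t ht c' hc' (rfl | h1) h2 -
      · by_cases h : t = s
        · exact .inl h
        · exact .inr (valid_prec_right hd hU ht h h2)
      · exact .inr (hU.sep_below hs ht h1 h2)
    · intro s hs c hc t ht c' hc' h1 h2
      exact hU.below_trans hs ht h2 h1
    · rintro t ht c hc (rfl | h)
      · exact hvw.1
      · exact hU.below _ hv _ ht h
    · intro t ht c hc h
      exact .inr h
    · intro s hs c hc h
      exact h
    · intro s hs c hc h
      exact hU.below _ hs _ hv h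
    · intro s hs c hc t ht c' hc' h h'
      exact h'.elim
    · rintro s hs c hc t ht c' hc' h ⟨rfl, rfl⟩
      exact ⟨Below.refl _, .inl rfl⟩

theorem Spread.next (hP : IsGenericPartialOrder P) (hφ : IsCoding S φ) {U : Set Word} {n m : ℕ}
    {h : Word → Word} {θ : P → Word → P} (hU : IsLevel n U) (hθ : Spread S φ U m h θ) {d : Step}
    (hd : d.Valid U) :
    ∃ (j : ℕ) (e h' : Word → Word) (θ' : P → Word → P), m ≤ j ∧ IsoOn e U ∧
      (∀ z ∈ U, e z ∈ level S j ∧ (e z).take m = h z) ∧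
      Spread S φ (d.Next U) (j + 1) h' θ' ∧
      (∀ z ∈ U, ∀ c, d.Allowed z c → h' (z ++ [c]) = e z ++ [c]) ∧
      ∀ w, d = Step.leaf w → ∃ x, e w = φ x := by
  by_cases hleaf : ∃ w, d = Step.leaf w
  · obtain ⟨w, rfl⟩ := hleaf
    obtain ⟨j, e, h', θ', h1, h2, h3, h4, h5, h6⟩ := hθ.leaf hP hφ hU hd
    exact ⟨j, e, h', θ', h1, h2, h3, h4, h5, by rintro _ ⟨⟩; exact h6⟩
  push Not at hleaf
  obtain ⟨s₀, hs₀, D, E, c1, c2, c3, c4, c5, c6, c7, c8, c9⟩ :=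
    Step.exists_prescription hU hd hleaf
  have hU' := Step.isLevel_next hU hd
  have hex : ∀ Q : Word → Letter → Prop, ∃ Q' : Word → Prop, ∀ z c, Q' (z ++ [c]) ↔ Q z c := by
    intro Q
    refine ⟨fun s => ∃ z c, s = z ++ [c] ∧ Q z c, fun z c => ⟨?_, fun h => ⟨z, c, rfl, h⟩⟩⟩
    rintro ⟨z', c', h, hQ⟩
    obtain ⟨rfl, h'⟩ := List.append_inj' h rfl
    rwa [List.singleton_inj.1 h']
  obtain ⟨D', hD'⟩ := hex D
  obtain ⟨E', hE'⟩ := hex E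
  obtain ⟨x, h', θ', -, -, hθ', htake, -, -⟩ := hθ.refine hP hφ hU hU'
    (by rintro _ ⟨z, hz, c, -, rfl⟩; rwa [List.dropLast_concat]) hs₀ D' E'
    (by
      rintro _ ⟨s, hs, c, hc, rfl⟩ _ ⟨t, ht, c', hc', rfl⟩ h1 h2
      rw [Step.sep_snoc hU hd hs ht hc hc']
      exact c1 s hs c hc t ht c' hc' ((hE' _ _).1 h1) ((hD' _ _).1 h2))
    (by
      rintro _ ⟨s, hs, c, hc, rfl⟩ _ ⟨t, ht, c', hc', rfl⟩ h1 h2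
      rw [Step.below_snoc hU hd hs ht hc hc'] at h2
      exact (hD' _ _).2 (c2 s hs c hc t ht c' hc' ((hD' _ _).1 h1) h2.1 h2.2))
    (by
      rintro _ ⟨s, hs, c, hc, rfl⟩ _ ⟨t, ht, c', hc', rfl⟩ h1 h2
      rw [Step.below_snoc hU hd hs ht hc hc'] at h2
      exact (hE' _ _).2 (c3 s hs c hc t ht c' hc' ((hE' _ _).1 h1) h2.1))
    (by
      rintro _ ⟨t, ht, c', hc', rfl⟩ h1
      rw [List.dropLast_concat]
      exact c4 t ht c' hc' ((hD' _ _).1 h1))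
    (by
      rintro _ ⟨t, ht, c', hc', rfl⟩ h1
      rw [List.dropLast_concat] at h1
      exact (hD' _ _).2 (c5 t ht c' hc' h1))
    (by
      rintro _ ⟨t, ht, c', hc', rfl⟩ h1
      rw [List.dropLast_concat]
      exact c6 t ht c' hc' ((hE' _ _).1 h1))
    (by
      rintro _ ⟨t, ht, c', hc', rfl⟩ h1
      rw [List.dropLast_concat] at h1
      exact (hE' _ _).2 (c7 t ht c' hc' h1))
    (by
      rintro _ ⟨s, hs, c, hc, rfl⟩ _ ⟨t, ht, c', hc', rfl⟩ h1 h2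
      rw [List.dropLast_concat, List.dropLast_concat] at h1
      rw [Step.below_snoc hU hd hs ht hc hc'] at h2
      rw [hD', hD']
      exact c8 s hs c hc t ht c' hc' h1 (by tauto))
    (by
      rintro _ ⟨s, hs, c, hc, rfl⟩ _ ⟨t, ht, c', hc', rfl⟩ h1 h2
      rw [List.dropLast_concat, List.dropLast_concat] at h2
      rw [Step.sep_snoc hU hd hs ht hc hc'] at h1
      rw [hE', hD']
      exact c9 s hs c hc t ht c' hc' h2 (by tauto))
  have htake' : ∀ z ∈ U, ∀ c, d.Allowed z c → (h' (z ++ [c])).take m = h z := by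
    intro z hz c hc
    rw [htake _ ⟨z, hz, c, hc, rfl⟩, List.dropLast_concat]
  obtain ⟨j, e, hmj, hjm, he, hemem, hsnoc⟩ := exists_critical_level hφ.isPosetType hU hd hleaf
    hθ.iso hθ.mem hθ'.iso hθ'.mem htake'
  -- The copies are cut back to just after the critical height, while the points coded above them
  -- are kept.
  refine ⟨j, e, fun s => (h' s).take (j + 1), θ', hmj, he, hemem, ⟨?_, ?_, hθ'.lt_iff, ?_⟩, hsnoc,
    fun w hw => absurd hw (hleaf w)⟩
  · exact he.snoc hU (fun z hz => (hemem z hz).1.2) rfl hsnoc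
  · intro s hs
    have := hθ'.mem s hs
    exact hφ.isPosetType.take_mem_level this.1 (by rw [this.2]; exact hjm)
  · intro p s hs
    rw [← hθ'.take p s hs, List.take_take, min_eq_left hjm]

end

/-! ### Copying a whole poset-type -/

theorem exists_dependent_seq {σ : ℕ → Type*} (s₀ : σ 0) {r : ∀ i, σ i → σ (i + 1) → Prop}
    (h : ∀ i s, ∃ t, r i s t) : ∃ f : ∀ i, σ i, f 0 = s₀ ∧ ∀ i, r i (f i) (f (i + 1)) := by
  choose g hg using h
  exact ⟨fun i => Nat.rec s₀ g i, rfl, fun i => hg i _⟩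

/-- Copies in `S` of the levels of `R`: `h i` and `e i` copy the words of length `i` to the first
and the last level of a block of levels, the last level of which performs the step of `R`. -/
structure CopySeq {P : Type*} (S R : Set Word) (φ : P → Word) (m j : ℕ → ℕ)
    (h e : ℕ → Word → Word) : Prop where
  zero : m 0 = 0
  le : ∀ i, m i ≤ j i
  succ : ∀ i, m (i + 1) = j i + 1
  iso_start : ∀ i, IsoOn (h i) (level R i)
  iso_end : ∀ i, IsoOn (e i) (level R i)
  mem_start : ∀ i, ∀ z ∈ level R i, h i z ∈ level S (m i)
  mem_end : ∀ i, ∀ z ∈ level R i, e i z ∈ level S (j i)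
  take : ∀ i, ∀ z ∈ level R i, (e i z).take (m i) = h i z
  snoc : ∀ i, ∀ z ∈ level R i, ∀ c, z ++ [c] ∈ R → h (i + 1) (z ++ [c]) = e i z ++ [c]
  leaf : ∀ l ∈ leaves R, ∃ x, φ x = e l.length l

theorem exists_copySeq {P : Type*} [PartialOrder P] {S R : Set Word} {φ : P → Word}
    (hP : IsGenericPartialOrder P) (hφ : IsCoding S φ) (hR : IsPosetType R) :
    ∃ m j h e, CopySeq S R φ m j h e := by
  let σ : ℕ → Type _ := fun i =>
    {s : ℕ × (Word → Word) × (P → Word → P) // Spread S φ (level R i) s.1 s.2.1 s.2.2}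
  have h0 : ∀ s ∈ level R 0, s = [] := fun s hs => List.length_eq_zero_iff.1 hs.2
  obtain ⟨p₀⟩ := hP.nonempty
  -- Over the empty word the family is `P` itself.
  let s₀ : σ 0 := ⟨(0, id, fun p _ => p), by
    refine ⟨⟨fun _ _ _ _ => Iff.rfl, fun _ _ _ _ => Iff.rfl, fun _ _ _ _ => Iff.rfl⟩, ?_, ?_, ?_⟩
    · intro s hs
      rw [h0 s hs]
      exact ⟨hφ.isPosetType.mem_of_prefix (hφ.mem_leaves p₀).1 List.nil_prefix, rfl⟩
    · intro p q s hs t ht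
      rw [h0 s hs, h0 t ht]
      refine ⟨fun h => .inr ⟨Below.refl _, h⟩, fun h => (h.resolve_left (not_sep_self _)).2⟩
    · intro p s hs
      rw [h0 s hs]
      rfl⟩
  let r : ∀ i, σ i → σ (i + 1) → Prop := fun i s t => ∃ (j : ℕ) (e : Word → Word),
    s.1.1 ≤ j ∧ t.1.1 = j + 1 ∧ IsoOn e (level R i) ∧
    (∀ z ∈ level R i, e z ∈ level S j ∧ (e z).take s.1.1 = s.1.2.1 z) ∧
    (∀ z ∈ level R i, ∀ c, z ++ [c] ∈ R → t.1.2.1 (z ++ [c]) = e z ++ [c]) ∧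
    ∀ l ∈ leaves R, l.length = i → ∃ x, φ x = e l
  obtain ⟨f, hf0, hf⟩ := exists_dependent_seq (r := r) s₀ (by
    rintro i ⟨⟨m, h, θ⟩, hs⟩
    -- Above the last level of `R` nothing is copied; the height merely has to keep growing.
    rcases (level R i).eq_empty_or_nonempty with hemp | hne
    · have hemp' : level R (i + 1) = ∅ := by
        rw [Set.eq_empty_iff_forall_notMem]
        rintro u ⟨hu, hl⟩
        exact Set.notMem_empty (u.take i) (hemp ▸ hR.take_mem_level hu (by omega))
      have hno : ∀ z, z ∉ level R i := fun z hz => Set.notMem_empty z (hemp ▸ hz)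
      have hno' : ∀ z, z ∉ level R (i + 1) := fun z hz => Set.notMem_empty z (hemp' ▸ hz)
      refine ⟨⟨(m + 1, h, θ), ⟨⟨fun s hs => absurd hs (hno' s), fun s hs => absurd hs (hno' s),
        fun s hs => absurd hs (hno' s)⟩, fun s hs => absurd hs (hno' s),
        fun _ _ s hs => absurd hs (hno' s), fun _ s hs => absurd hs (hno' s)⟩⟩,
        m, h, le_rfl, rfl, hs.iso, fun z hz => absurd hz (hno z), fun z hz => absurd hz (hno z),
        fun l hl hli => absurd ⟨hl.1, hli⟩ (hno l)⟩
    · obtain ⟨d, hd, hn⟩ := hR.exists_step hne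
      obtain ⟨j, e, h', θ', hmj, he, hemem, hs', hsnoc, hleaf⟩ :=
        hs.next hP hφ (hR.isLevel i) hd
      refine ⟨⟨(j + 1, h', θ'), hn ▸ hs'⟩, j, e, hmj, rfl, he, hemem, fun z hz c hc => ?_,
        fun l hl hli => ?_⟩
      · refine hsnoc z hz c ?_
        have : z ++ [c] ∈ level R (i + 1) := ⟨hc, by simp [hz.2]⟩
        rw [hn, Step.snoc_mem_next] at this
        exact this.2
      · subst hli
        obtain ⟨x, hx⟩ := hleaf l (IsPosetType.step_eq_leaf hl hd hn)
        exact ⟨x, hx.symm⟩)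
  choose j e h1 h2 h3 h4 h5 h6 using hf
  exact ⟨fun i => (f i).1.1, j, fun i => (f i).1.2.1, e, by rw [hf0], h1, h2,
    fun i => (f i).2.iso, h3, fun i => (f i).2.mem, fun i z hz => (h4 i z hz).1,
    fun i z hz => (h4 i z hz).2, h5, fun l hl => h6 _ l hl rfl⟩

namespace CopySeq
variable {P : Type*} {S R : Set Word} {φ : P → Word} {m j : ℕ → ℕ} {h e : ℕ → Word → Word}
  {i k : ℕ} {l : Word}

theorem strictMono (H : CopySeq S R φ m j h e) : StrictMono m :=
  strictMono_nat_of_lt_succ fun i => by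
    have := H.le i
    have := H.succ i
    omega

theorem take_start (H : CopySeq S R φ m j h e) (hR : IsPosetType R) (hl : l ∈ leaves R)
    (hi : i ≤ l.length) : (e l.length l).take (m i) = h i (l.take i) := by
  induction hi using Nat.decreasingInduction with
  | self =>
    rw [List.take_length]
    exact H.take _ _ ⟨hl.1, rfl⟩
  | of_succ i hi ih =>
    have hlt : i < l.length := hi
    have hz := hR.take_mem_level hl.1 hlt.le
    have h1 := H.succ i
    have h2 := H.le i
    have h3 := hR.take_mem hl.1 (i + 1)
    rw [List.take_succ_eq_append_getElem hlt] at ih h3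
    have h4 := congrArg (List.take (m i)) ih
    rw [List.take_take, min_eq_left (by omega), H.snoc i _ hz _ h3,
      List.take_append_of_le_length (by rw [(H.mem_end i _ hz).2]; exact h2),
      H.take i _ hz] at h4
    exact h4

theorem take_end (H : CopySeq S R φ m j h e) (hR : IsPosetType R) (hl : l ∈ leaves R)
    (hi : i ≤ l.length) : (e l.length l).take (j i) = e i (l.take i) := by
  rcases hi.lt_or_eq with hlt | rfl
  · have hz := hR.take_mem_level hl.1 hlt.le
    have h3 := hR.take_mem hl.1 (i + 1)
    have ih := H.take_start hR hl (i := i + 1) hlt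
    rw [List.take_succ_eq_append_getElem hlt] at ih h3
    have h4 := congrArg (List.take (j i)) ih
    rwa [List.take_take, min_eq_left (by rw [H.succ]; omega), H.snoc i _ hz _ h3,
      List.take_left' (H.mem_end i _ hz).2] at h4
  · rw [List.take_length]
    exact List.take_of_length_le (H.mem_end _ _ ⟨hl.1, rfl⟩).2.le

/-- The code of a leaf passes through the copies of all its initial segments, and every word of the
finite tree `R` lies under some leaf. -/
theorem level_eq (H : CopySeq S R φ m j h e) (hR : IsPosetType R) (hfin : R.Finite)
    (h1 : m i ≤ k) (h2 : k ≤ j i) :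
    level (initialSegments ((fun l => e l.length l) '' leaves R)) k =
      (fun z => (e i z).take k) '' level R i := by
  have hlen : ∀ l ∈ leaves R, (e l.length l).length = j l.length :=
    fun l hl => (H.mem_end _ _ ⟨hl.1, rfl⟩).2
  ext u
  rw [mem_level_initialSegments]
  constructor
  · rintro ⟨_, ⟨l, hl, rfl⟩, hk, rfl⟩
    simp only at hk ⊢
    rw [hlen l hl] at hk
    have hi : i ≤ l.length := by
      by_contra hlt
      have h3 := H.strictMono.monotone (show l.length + 1 ≤ i by omega)
      rw [H.succ] at h3
      omega
    refine ⟨l.take i, hR.take_mem_level hl.1 hi, ?_⟩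
    simp only
    rw [← H.take_end hR hl hi, List.take_take, min_eq_left h2]
  · rintro ⟨z, hz, rfl⟩
    have hz' := hz.1
    rw [← initialSegments_leaves hR.1 hfin] at hz'
    obtain ⟨l, hl, hzl⟩ := hz'
    have hi : i ≤ l.length := hz.2 ▸ hzl.length_le
    have hzt : z = l.take i := by rw [← hz.2]; exact List.prefix_iff_eq_take.1 hzl
    refine ⟨_, ⟨l, hl, rfl⟩, ?_, ?_⟩
    · simp only
      rw [hlen l hl]
      have h3 := H.strictMono.monotone (show i + 1 ≤ l.length + 1 by omega)
      rw [H.succ, H.succ] at h3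
      omega
    · simp only
      rw [hzt, ← H.take_end hR hl hi, List.take_take, min_eq_left h2]

theorem structIso_level (H : CopySeq S R φ m j h e) (hS : IsPosetType S) (hR : IsPosetType R)
    (hfin : R.Finite) (h1 : m i ≤ k) (h2 : k ≤ j i) :
    StructIso (level R i) (level (initialSegments ((fun l => e l.length l) '' leaves R)) k) := by
  rw [H.level_eq hR hfin h1 h2]
  have hiso : IsoOn (fun z => (e i z).take k) (level R i) := by
    refine (H.iso_start i).of_take (fun z hz => (H.mem_start i z hz).2) ?_ ?_ ?_
    · intro z hz
      rw [List.take_take, min_eq_left h1, H.take i z hz]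
    · intro s hs t ht hst
      exact (((H.iso_end i).below_iff s hs t ht).2 hst).take _ _
    · intro s hs t ht hst
      exact ((H.iso_end i).sep_iff s hs t ht).1 hst.of_take
  refine hiso.structIso (hR.isLevel i) ((hS.isLevel k).mono ?_)
  rintro _ ⟨z, hz, rfl⟩
  have := H.mem_end i z hz
  exact hS.take_mem_level this.1 (by rw [this.2]; exact h2)

end CopySeq

/-- Every poset-type of `A` is a colour of a copy of `A`. -/
theorem exists_color_eq {P : Type*} [PartialOrder P] (hP : IsGenericPartialOrder P)
    {ψ : P → Word} (hψ : IsPosetTypeEmbedding ψ) {A : Type*} [PartialOrder A]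
    (f : P ↪o P) {R : Set Word} (hRA : R ∈ types A) :
    ∃ g : A ↪o P, color ψ (g.trans f) = R := by
  obtain ⟨hR, hfin, eA, heA⟩ := hRA
  set S := initialSegments (Set.range ψ) with hSdef
  have hS : IsPosetType S := hψ.isPosetType
  have hlt : ∀ p q, p < q ↔ Sep (ψ p) (ψ q) := by
    intro p q
    rw [← hS.prec_iff (hψ.mem_leaves p).1 (hψ.mem_leaves q).1, lt_iff_le_and_ne, hψ.le_iff, PrecEq]
    constructor
    · rintro ⟨h1 | h1, h2⟩
      · exact absurd (hψ.injective h1) h2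
      · exact h1
    · intro h1
      refine ⟨.inr h1, ?_⟩
      rintro rfl
      exact not_sep_self _ h1.sep
  have hφ : IsCoding S (fun p => ψ (f p)) :=
    ⟨hS, fun p => hψ.mem_leaves _, fun p q h => f.injective (hψ.injective h),
      fun p q => by rw [← hlt, f.lt_iff_lt]⟩
  obtain ⟨m, j, h, e, H⟩ := exists_copySeq hP hφ hR
  set F := (fun l => e l.length l) '' leaves R with hFdef
  have hF : F ⊆ leaves S := by
    rintro _ ⟨l, hl, rfl⟩
    obtain ⟨x, hx⟩ := H.leaf l hl
    simp only
    rw [← hx]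
    exact hψ.mem_leaves _
  have hFS : F ⊆ S := fun w hw => (hF hw).1
  have hFfin : F.Finite := (hfin.subset fun l hl => hl.1).image _
  -- Within a block all levels are isomorphic to the same level of `R`.
  have hout : ∀ i k, m i ≤ k → k < j i → k ∉ interesting F := by
    intro i k h1 h2
    rw [mem_interesting_iff hS hFS, not_not]
    exact (H.structIso_level hS hR hfin h1 h2.le).symm.trans
      (H.structIso_level hS hR hfin (i := i) (by omega) h2)
  -- Across the end of a block an isomorphism would identify the structures of two consecutive
  -- levels of `R`, which no step allows.
  have hin : ∀ i, (level R i).Nonempty → j i ∈ interesting F := by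
    intro i hne
    rw [mem_interesting_iff hS hFS]
    intro hiso
    obtain ⟨d, hd, hn⟩ := hR.exists_step hne
    refine d.not_structIso (hR.isLevel i) (level_finite _ _) hd ?_
    rw [← hn]
    refine (H.structIso_level hS hR hfin (H.le i) le_rfl).trans (hiso.trans ?_)
    have := H.structIso_level hS hR hfin (i := i + 1) le_rfl (H.le (i + 1))
    rw [H.succ] at this
    exact this.symm
  have hKe : ∀ i, ∀ z ∈ level R i,
      keepIndices (interesting F) (e i z) = keepIndices (interesting F) (h i z) := by
    intro i z hz
    rw [← H.take i z hz]
    refine (keepIndices_take_of_forall_notMem fun k h1 h2 => hout i k h1 ?_).symm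
    rwa [(H.mem_end i z hz).2] at h2
  -- Each block contributes only the letter at its last height, and this is the letter of the word
  -- of `R`.
  have hKh : ∀ i, ∀ z ∈ level R i, keepIndices (interesting F) (h i z) = z := by
    intro i
    induction i with
    | zero =>
      intro z hz
      have := (H.mem_start 0 z hz).2
      rw [H.zero] at this
      rw [List.length_eq_zero_iff.1 this, List.length_eq_zero_iff.1 hz.2, keepIndices_nil]
    | succ i ih =>
      intro z hz
      rcases List.eq_nil_or_concat z with rfl | ⟨y, c, rfl⟩
      · exact absurd hz.2 (by simp)
      rw [List.concat_eq_append] at hz ⊢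
      have hy : y ∈ level R i :=
        ⟨hR.mem_of_prefix hz.1 (List.prefix_append _ _), by simpa using hz.2⟩
      rw [H.snoc i y hy c hz.1, keepIndices_snoc_of_mem, hKe i y hy, ih y hy]
      rw [(H.mem_end i y hy).2]
      exact hin i ⟨y, hy⟩
  have hK : ∀ l ∈ leaves R, keepIndices (interesting F) (e l.length l) = l := fun l hl => by
    rw [hKe _ l ⟨hl.1, rfl⟩, hKh _ l ⟨hl.1, rfl⟩]
  choose x hx using fun a => H.leaf (eA a) (eA a).2
  have hxF : ∀ a, ψ (f (x a)) ∈ F := fun a => by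
    rw [hx]
    exact ⟨_, (eA a).2, rfl⟩
  let g : A ↪o P := OrderEmbedding.ofMapLEIff x fun a b => by
    rw [heA a b, ← f.le_iff_le, hψ.le_iff, ← precEq_keepIndices_iff hS hF hFfin (hxF a) (hxF b),
      hx, hx, hK _ (eA a).2, hK _ (eA b).2]
  refine ⟨g, ?_⟩
  have himage : ψ '' Set.range (g.trans f) = F := by
    ext w
    constructor
    · rintro ⟨_, ⟨a, rfl⟩, rfl⟩
      exact hxF a
    · rintro ⟨l, hl, rfl⟩
      refine ⟨_, ⟨eA.symm ⟨l, hl⟩, rfl⟩, (hx _).trans ?_⟩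
      rw [eA.apply_symm_apply]
  have hemb : embeddingType F = leaves R := by
    ext w
    constructor
    · rintro ⟨_, ⟨l, hl, rfl⟩, rfl⟩
      simp only
      rw [hK l hl]
      exact hl
    · intro hw
      exact ⟨_, ⟨w, hw, rfl⟩, hK w hw⟩
  rw [color, himage, hemb, initialSegments_leaves hR.1 hfin]

/-! ### Existence of a coding by finite approximations -/

/-- This drives the inductions below: after a step every remaining defect comes from an earlier
defect other than the one just repaired. -/
theorem ncard_lt_of_subset_image {α β : Type*} {A : Set α} {B : Set β} {a : α} (f : α → β)
    (hA : A.Finite) (ha : a ∈ A) (h : B ⊆ f '' (A \ {a})) : B.ncard < A.ncard := by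
  have hfin : (A \ {a}).Finite := hA.subset Set.sdiff_subset
  calc B.ncard ≤ (f '' (A \ {a})).ncard := Set.ncard_le_ncard h (hfin.image f)
    _ ≤ (A \ {a}).ncard := Set.ncard_image_le hfin
    _ < A.ncard := Set.ncard_sdiff_singleton_lt_of_mem ha hA

theorem level_initialSegments_range_congr {P : Type*} {ℓ ℓ' : P → Word} {m i : ℕ}
    (h : ∀ p, (ℓ' p).take m = ℓ p) (hi : i ≤ m) :
    level (initialSegments (Set.range ℓ')) i = level (initialSegments (Set.range ℓ)) i := by
  have hlen : ∀ p, i ≤ (ℓ' p).length ↔ i ≤ (ℓ p).length := by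
    intro p
    rw [← h p, List.length_take]
    omega
  have htake : ∀ p, (ℓ' p).take i = (ℓ p).take i := by
    intro p
    rw [← h p, List.take_take, min_eq_left hi]
  ext u
  simp only [mem_level_initialSegments, Set.exists_range_iff, hlen, htake]

/-- A coding of `P` by words cut off at height `m`: words of length less than `m` are final. -/
structure PartialCoding {P : Type*} [PartialOrder P] (m : ℕ) (ℓ : P → Word) : Prop where
  length_le : ∀ p, (ℓ p).length ≤ m
  lt_of_sep : ∀ p q, Sep (ℓ p) (ℓ q) → p < q
  below : ∀ p q, p ≤ q → Below (ℓ p) (ℓ q)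
  final : ∀ p, (ℓ p).length < m → ∀ q, q ≠ p →
    (p < q → Sep (ℓ p) (ℓ q)) ∧ (q < p → Sep (ℓ q) (ℓ p)) ∧ ¬ ℓ p <+: ℓ q
  step : ∀ i < m, (level (initialSegments (Set.range ℓ)) i).Nonempty →
    ∃ d : Step, d.Valid (level (initialSegments (Set.range ℓ)) i) ∧
      level (initialSegments (Set.range ℓ)) (i + 1) =
        d.Next (level (initialSegments (Set.range ℓ)) i)

/-- The partial coding `ℓ'` of height `m'` extends the partial coding `ℓ` of height `m`. -/
def Extends {P : Type*} (m : ℕ) (ℓ : P → Word) (m' : ℕ) (ℓ' : P → Word) : Prop :=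
  m ≤ m' ∧ ∀ p, (ℓ' p).take m = ℓ p

/-- `Q` holds for all or for none of the points with a given word of length `m`. -/
def Homogeneous {P : Type*} (m : ℕ) (ℓ : P → Word) (Q : P → Prop) : Prop :=
  ∀ p q, (ℓ p).length = m → ℓ p = ℓ q → Q p → Q q

/-- The relation `τ` does not distinguish points with the same word of length `m`. -/
def Invariant {P : Type*} (m : ℕ) (ℓ : P → Word) (τ : P → P → Prop) : Prop :=
  ∀ p q p' q', (ℓ p).length = m → (ℓ q).length = m → ℓ p = ℓ p' → ℓ q = ℓ q' →
    τ p q → τ p' q'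

section
variable {P : Type*} {m m' m'' : ℕ} {ℓ ℓ' ℓ'' : P → Word}

theorem Extends.trans (h : Extends m ℓ m' ℓ') (h' : Extends m' ℓ' m'' ℓ'') :
    Extends m ℓ m'' ℓ'' := by
  refine ⟨h.1.trans h'.1, fun p => ?_⟩
  rw [← h.2 p, ← h'.2 p, List.take_take, min_eq_left h.1]

theorem Extends.length_eq (h : Extends m ℓ m' ℓ') {p : P} (hp : (ℓ' p).length = m') :
    (ℓ p).length = m := by
  have := h.1
  rw [← h.2 p, List.length_take]
  omega

theorem Extends.eq_of_length_lt (h : Extends m ℓ m' ℓ') {p : P} (hp : (ℓ p).length < m) :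
    ℓ' p = ℓ p := by
  have h1 := h.2 p
  rw [← h1, List.take_of_length_le]
  rw [← h1, List.length_take] at hp
  omega

theorem Homogeneous.extends {Q : P → Prop} (hQ : Homogeneous m ℓ Q) (h : Extends m ℓ m' ℓ') :
    Homogeneous m' ℓ' Q := by
  intro p q hp hpq
  exact hQ p q (h.length_eq hp) (by rw [← h.2 p, ← h.2 q, hpq])

theorem Invariant.extends {τ : P → P → Prop}
    (hτ : Invariant m ℓ τ) (h : Extends m ℓ m' ℓ') : Invariant m' ℓ' τ := by
  intro p q p' q' hp hq hpp hqq
  exact hτ p q p' q' (h.length_eq hp) (h.length_eq hq) (by rw [← h.2 p, ← h.2 p', hpp])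
    (by rw [← h.2 q, ← h.2 q', hqq])

end

namespace PartialCoding
variable {P : Type*} [PartialOrder P] {m : ℕ} {ℓ : P → Word}

theorem mem_level (h : PartialCoding m ℓ) {u : Word} :
    u ∈ level (initialSegments (Set.range ℓ)) m ↔ ∃ p, (ℓ p).length = m ∧ ℓ p = u := by
  rw [mem_level_initialSegments, Set.exists_range_iff]
  refine exists_congr fun p => ?_
  constructor
  · rintro ⟨h1, rfl⟩
    have h2 := h.length_le p
    exact ⟨by omega, (List.take_of_length_le h2).symm⟩
  · rintro ⟨h1, rfl⟩
    exact ⟨h1.ge, (List.take_of_length_le h1.le).symm⟩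

theorem isLevel (h : PartialCoding m ℓ) :
    IsLevel m (level (initialSegments (Set.range ℓ)) m) := by
  refine ⟨fun u hu => hu.2, fun u hu v hv huv => ?_⟩
  obtain ⟨p, -, rfl⟩ := h.mem_level.1 hu
  obtain ⟨q, -, rfl⟩ := h.mem_level.1 hv
  exact h.below p q (h.lt_of_sep p q huv).le

/-- The hypotheses say that the step respects the order of `P`: a pair made separated is increasing,
a killed pair is not, and a dropped word codes a single point. By `hsurj` every allowed letter is
used, so the next level is complete. -/
theorem extend (h : PartialCoding m ℓ) {d : Step}
    (hd : d.Valid (level (initialSegments (Set.range ℓ)) m)) (c : P → Letter)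
    (hc : ∀ p, (ℓ p).length = m → d ≠ .leaf (ℓ p) → d.Allowed (ℓ p) (c p))
    (hsurj : ∀ p, (ℓ p).length = m → ∀ a, d.Allowed (ℓ p) a → ∃ q, ℓ q = ℓ p ∧ c q = a)
    (hmake : ∀ p q, d.Makes (ℓ p) (ℓ q) → p < q)
    (hkill : ∀ p q, p ≤ q → ¬ d.Kills (ℓ p) (ℓ q) (c p) (c q))
    (hleaf : ∀ p q, d = .leaf (ℓ p) → ℓ p = ℓ q → p = q) :
    ∃ ℓ' : P → Word, PartialCoding (m + 1) ℓ' ∧ Extends m ℓ (m + 1) ℓ' ∧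
      (∀ p, (ℓ p).length = m → d ≠ .leaf (ℓ p) → ℓ' p = ℓ p ++ [c p]) ∧
      (∀ p, d = .leaf (ℓ p) → ℓ' p = ℓ p) := by
  classical
  set U := level (initialSegments (Set.range ℓ)) m with hUdef
  have hU : IsLevel m U := h.isLevel
  set ℓ' : P → Word := fun p =>
    if (ℓ p).length = m ∧ d ≠ .leaf (ℓ p) then ℓ p ++ [c p] else ℓ p with hℓ'
  have hyes : ∀ p, (ℓ p).length = m → d ≠ .leaf (ℓ p) → ℓ' p = ℓ p ++ [c p] :=
    fun p h1 h2 => if_pos ⟨h1, h2⟩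
  have hno : ∀ p, ¬ ((ℓ p).length = m ∧ d ≠ .leaf (ℓ p)) → ℓ' p = ℓ p := fun p h1 => if_neg h1
  have hUm : ∀ p, (ℓ p).length = m → ℓ p ∈ U := fun p hp => h.mem_level.2 ⟨p, hp, rfl⟩
  have hext : ∀ p, (ℓ' p).take m = ℓ p := by
    intro p
    by_cases hp : (ℓ p).length = m ∧ d ≠ .leaf (ℓ p)
    · rw [hyes p hp.1 hp.2, List.take_left' hp.1]
    · rw [hno p hp, List.take_of_length_le (h.length_le p)]
  have hsep : ∀ p q, Sep (ℓ p) (ℓ q) → Sep (ℓ' p) (ℓ' q) := by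
    intro p q hpq
    rw [← hext p, ← hext q] at hpq
    exact hpq.of_take
  have hlevm := fun {i : ℕ} (hi : i ≤ m) => level_initialSegments_range_congr hext hi
  have hmem' : ∀ u, u ∈ level (initialSegments (Set.range ℓ')) (m + 1) ↔
      ∃ p, ((ℓ p).length = m ∧ d ≠ .leaf (ℓ p)) ∧ u = ℓ p ++ [c p] := by
    intro u
    rw [mem_level_initialSegments, Set.exists_range_iff]
    refine exists_congr fun p => ?_
    by_cases hp : (ℓ p).length = m ∧ d ≠ .leaf (ℓ p)
    · rw [hyes p hp.1 hp.2, List.take_of_length_le (by simp [hp.1])]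
      simp [hp.1, hp.2]
    · rw [hno p hp]
      have := h.length_le p
      simp only [hp, false_and, iff_false, not_and]
      intro h1
      omega
  refine ⟨ℓ', ⟨?_, ?_, ?_, ?_, ?_⟩, ⟨Nat.le_succ m, hext⟩, hyes, fun p hp => hno p fun h => h.2 hp⟩
  · intro p
    by_cases hp : (ℓ p).length = m ∧ d ≠ .leaf (ℓ p)
    · rw [hyes p hp.1 hp.2]
      simp [hp.1]
    · rw [hno p hp]
      exact (h.length_le p).trans (Nat.le_succ m)
  · intro p q hpq
    by_cases hp : (ℓ p).length = m ∧ d ≠ .leaf (ℓ p)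
    · by_cases hq : (ℓ q).length = m ∧ d ≠ .leaf (ℓ q)
      · rw [hyes p hp.1 hp.2, hyes q hq.1 hq.2, Step.sep_snoc hU hd (hUm p hp.1) (hUm q hq.1)
          (hc p hp.1 hp.2) (hc q hq.1 hq.2)] at hpq
        exact hpq.elim (h.lt_of_sep p q) (hmake p q)
      · rw [hno q hq, ← sep_take_left (h.length_le q), hext] at hpq
        exact h.lt_of_sep p q hpq
    · rw [hno p hp, ← sep_take_right (h.length_le p), hext] at hpq
      exact h.lt_of_sep p q hpq
  · intro p q hpq
    have hb := h.below p q hpq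
    by_cases hp : (ℓ p).length = m ∧ d ≠ .leaf (ℓ p)
    · by_cases hq : (ℓ q).length = m ∧ d ≠ .leaf (ℓ q)
      · rw [hyes p hp.1 hp.2, hyes q hq.1 hq.2, Step.below_snoc hU hd (hUm p hp.1) (hUm q hq.1)
          (hc p hp.1 hp.2) (hc q hq.1 hq.2)]
        exact ⟨hb, hkill p q hpq⟩
      · rwa [hno q hq, ← below_take_left (h.length_le q), hext]
    · rwa [hno p hp, ← below_take_right (h.length_le p), hext]
  · intro p hp q hqp
    have hp' : ¬ ((ℓ p).length = m ∧ d ≠ .leaf (ℓ p)) := by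
      intro h1
      rw [hyes p h1.1 h1.2] at hp
      simp [h1.1] at hp
    by_cases hpm : (ℓ p).length < m
    · obtain ⟨h1, h2, h3⟩ := h.final p hpm q hqp
      refine ⟨fun h => hsep _ _ (h1 h), fun h => hsep _ _ (h2 h), fun h4 => h3 ?_⟩
      rw [hno p hp'] at h4
      rw [← hext q]
      exact List.prefix_take_iff.2 ⟨h4, hpm.le⟩
    · have hpm : (ℓ p).length = m := le_antisymm (h.length_le p) (not_lt.1 hpm)
      have hdp : d = .leaf (ℓ p) := by tauto
      by_cases hqm : (ℓ q).length < m
      · obtain ⟨h1, h2, h3⟩ := h.final q hqm p (Ne.symm hqp)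
        refine ⟨fun h => hsep _ _ (h2 h), fun h => hsep _ _ (h1 h), fun h4 => ?_⟩
        rw [hno p hp', hno q (fun h => hqm.ne h.1)] at h4
        have := h4.length_le
        omega
      · have hqm : (ℓ q).length = m := le_antisymm (h.length_le q) (not_lt.1 hqm)
        have hne : ℓ q ≠ ℓ p := fun h => hqp (hleaf p q hdp h.symm).symm
        have hval := hd
        rw [hdp] at hval
        -- The dropped word is related to the other one, so the order of the two points is already
        -- decided by `Sep` or refuted by the failure of `Below`.
        have hr := (hU.related_iff (hUm p hpm) (hUm q hqm)).1 (hval.2 _ (hUm q hqm) hne)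
        refine ⟨fun h1 => hsep _ _ ?_, fun h1 => hsep _ _ ?_, fun h4 => hne ?_⟩
        · rcases hr with h2 | h2 | h2 | h2
          · exact absurd h2.symm hne
          · exact h2
          · exact absurd (h.lt_of_sep _ _ h2) (lt_asymm h1)
          · exact absurd (h.below _ _ h1.le) h2.1
        · rcases hr with h2 | h2 | h2 | h2
          · exact absurd h2.symm hne
          · exact absurd (h.lt_of_sep _ _ h2) (lt_asymm h1)
          · exact h2
          · exact absurd (h.below _ _ h1.le) h2.2
        · rw [hno p hp'] at h4
          have h5 := List.prefix_iff_eq_take.1 h4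
          rw [hpm, hext q] at h5
          exact h5.symm
  · intro i hi hne
    rcases Nat.lt_succ_iff_lt_or_eq.1 hi with hi | rfl
    · rw [hlevm hi.le] at hne ⊢
      rw [hlevm (show i + 1 ≤ m from hi)]
      exact h.step i hi hne
    · refine ⟨d, ?_, ?_⟩
      · rw [hlevm le_rfl]
        exact hd
      · rw [hlevm le_rfl]
        ext u
        rw [hmem']
        constructor
        · rintro ⟨p, ⟨h1, h2⟩, rfl⟩
          exact ⟨_, hUm p h1, _, hc p h1 h2, rfl⟩
        · rintro ⟨z, hz, a, ha, rfl⟩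
          obtain ⟨p, hp, rfl⟩ := h.mem_level.1 hz
          obtain ⟨q, hq, rfl⟩ := hsurj p hp a ha
          refine ⟨q, ⟨by rw [hq, hp], ?_⟩, by rw [hq]⟩
          rintro rfl
          exact ha.1 hq.symm

/-- A step at which no word branches or is dropped. -/
theorem extend_unary (h : PartialCoding m ℓ) {d : Step}
    (hd : d.Valid (level (initialSegments (Set.range ℓ)) m)) (hleaf : ∀ w, d ≠ .leaf w)
    (hbranch : ∀ w, d ≠ .branch w) (hmake : ∀ p q, d.Makes (ℓ p) (ℓ q) → p < q)
    (hkill : ∀ p q, p ≤ q → ∀ a b, ¬ d.Kills (ℓ p) (ℓ q) a b) :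
    ∃ (ℓ' : P → Word) (c : Word → Letter), PartialCoding (m + 1) ℓ' ∧ Extends m ℓ (m + 1) ℓ' ∧
      (∀ z, d.Allowed z (c z)) ∧ ∀ p, (ℓ p).length = m → ℓ' p = ℓ p ++ [c (ℓ p)] := by
  have hex : ∀ z, ∃ c, d.Allowed z c := fun z =>
    Step.exists_allowed hd fun w hw => absurd hw (hleaf w)
  choose c hc using hex
  obtain ⟨ℓ', h1, h2, h3, -⟩ := h.extend hd (fun p => c (ℓ p)) (fun p _ _ => hc _)
    (fun p _ a ha => ⟨p, rfl, Step.allowed_unique hd (hc _) ha (hbranch _)⟩) hmake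
    (fun p q hpq => hkill p q hpq _ _) (fun p q hp => absurd hp (hleaf _))
  exact ⟨ℓ', c, h1, h2, hc, fun p hp => h3 p hp (hleaf _)⟩

/-- Each word shared by points inside and outside `Q` is split by a branching, which leaves fewer
mixed words. -/
theorem exists_homogeneous (h : PartialCoding m ℓ) {Q : P → Prop}
    (hQ : ∀ p q, p ≤ q → Q p → Q q) :
    ∃ m' ℓ', PartialCoding m' ℓ' ∧ Extends m ℓ m' ℓ' ∧ Homogeneous m' ℓ' Q ∧
      Homogeneous m' ℓ' fun p => ¬ Q p := by
  classical
  generalize hN : {u | ∃ p q, (ℓ p).length = m ∧ ℓ p = u ∧ ℓ q = u ∧ Q p ∧ ¬ Q q}.ncard = N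
  induction N using Nat.strong_induction_on generalizing m ℓ with
  | _ N ih =>
    set B := {u | ∃ p q, (ℓ p).length = m ∧ ℓ p = u ∧ ℓ q = u ∧ Q p ∧ ¬ Q q} with hB
    have hBU : B ⊆ level (initialSegments (Set.range ℓ)) m := by
      rintro _ ⟨p, q, hp, rfl, -⟩
      exact h.mem_level.2 ⟨p, hp, rfl⟩
    rcases B.eq_empty_or_nonempty with hemp | ⟨u, hu⟩
    · have hno : ∀ u, u ∉ B := fun u hu => Set.notMem_empty u (hemp ▸ hu)
      refine ⟨m, ℓ, h, ⟨le_rfl, fun p => List.take_of_length_le (h.length_le p)⟩, ?_, ?_⟩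
      · intro p q hp hpq hQp
        by_contra hQq
        exact hno _ ⟨p, q, hp, rfl, hpq.symm, hQp, hQq⟩
      · intro p q hp hpq hQp hQq
        exact hno _ ⟨q, p, by rw [← hpq, hp], rfl, hpq, hQq, hQp⟩
    · have hd : (Step.branch u).Valid (level (initialSegments (Set.range ℓ)) m) := hBU hu
      set c₀ : Word → Letter := fun z => if z < u then .X else .R with hc₀
      -- Points of `Q` go to the right. As `Q` is an up-set, no `p ≤ q` has `p` going right and `q`
      -- going left.
      set c : P → Letter := fun p => if ℓ p = u then (if Q p then .R else .X) else c₀ (ℓ p) with hc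
      have hall : ∀ p, (Step.branch u).Allowed (ℓ p) (c p) := by
        intro p
        simp only [hc, hc₀, Step.Allowed]
        rcases lt_trichotomy (ℓ p) u with h1 | h1 | h1
        · simp [h1, h1.ne]
        · by_cases hq : Q p <;> simp [h1, hq]
        · simp [h1, h1.ne', lt_asymm h1]
      obtain ⟨ℓ', h1, h2, h3, -⟩ := h.extend hd c (fun p _ _ => hall p) (by
        intro p hp a ha
        by_cases hpu : ℓ p = u
        · obtain ⟨q, q', -, h1, h2, h3, h4⟩ := hu
          simp only [Step.Allowed, hpu, lt_irrefl, false_and, or_false, false_or, true_and] at ha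
          rcases ha with rfl | rfl
          · exact ⟨q', by rw [h2, hpu], by simp [hc, h2, h4]⟩
          · exact ⟨q, by rw [h1, hpu], by simp [hc, h1, h3]⟩
        · exact ⟨p, rfl, Step.allowed_unique hd (hall p) ha (by simp [Ne.symm hpu])⟩)
        (fun p q h => h.elim) (by
          rintro p q hpq ⟨h1, h2, h3, h4⟩
          have h5 : Q p := by
            by_contra hn
            simp [hc, h1, hn] at h3
          simp [hc, h2, hQ p q hpq h5] at h4) (by simp)
      have hlt : {u | ∃ p q, (ℓ' p).length = m + 1 ∧ ℓ' p = u ∧ ℓ' q = u ∧ Q p ∧ ¬ Q q}.ncard <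
          B.ncard := by
        refine ncard_lt_of_subset_image (fun z => z ++ [c₀ z])
          ((level_finite _ _).subset hBU) hu ?_
        rintro _ ⟨p, q, hp, rfl, hqp, hQp, hQq⟩
        have hpm := h2.length_eq hp
        have hqm := h2.length_eq (p := q) (by rw [hqp, hp])
        rw [h3 p hpm (by simp), h3 q hqm (by simp)] at hqp
        obtain ⟨h4, h5⟩ := List.append_inj' hqp rfl
        have h5 := List.singleton_inj.1 h5
        have hne : ℓ p ≠ u := by
          intro hpu
          simp [hc, h4, hpu, hQp, hQq] at h5
        refine ⟨ℓ p, ⟨⟨p, q, hpm, rfl, h4, hQp, hQq⟩, hne⟩, ?_⟩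
        rw [h3 p hpm (by simp)]
        simp [hc, hne]
      obtain ⟨m', ℓ'', h4, h5, h6⟩ := ih _ (hN ▸ hlt) h1 rfl
      exact ⟨m', ℓ'', h4, h2.trans h5, h6⟩

/-- Pairs of `Below` that violate `τ` are removed one at a time by new pairs of `⊥`. Since `τ`
contains `≤`, no comparable pair of points is affected. -/
theorem exists_below_imp (h : PartialCoding m ℓ) {τ : P → P → Prop}
    (hle : ∀ p q, p ≤ q → τ p q) (htrans : ∀ p q r, τ p q → τ q r → τ p r)
    (hinv : Invariant m ℓ τ) :
    ∃ m' ℓ', PartialCoding m' ℓ' ∧ Extends m ℓ m' ℓ' ∧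
      ∀ p q, (ℓ' p).length = m' → (ℓ' q).length = m' → Below (ℓ' p) (ℓ' q) → τ p q := by
  generalize hN : {x : Word × Word | ∃ p q, (ℓ p).length = m ∧ (ℓ q).length = m ∧
    (ℓ p, ℓ q) = x ∧ Below (ℓ p) (ℓ q) ∧ ¬ τ p q}.ncard = N
  induction N using Nat.strong_induction_on generalizing m ℓ with
  | _ N ih =>
    set B := {x : Word × Word | ∃ p q, (ℓ p).length = m ∧ (ℓ q).length = m ∧
      (ℓ p, ℓ q) = x ∧ Below (ℓ p) (ℓ q) ∧ ¬ τ p q} with hB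
    set U := level (initialSegments (Set.range ℓ)) m with hUdef
    have hU : IsLevel m U := h.isLevel
    have hUm : ∀ p, (ℓ p).length = m → ℓ p ∈ U := fun p hp => h.mem_level.2 ⟨p, hp, rfl⟩
    have hBfin : B.Finite := by
      refine ((level_finite _ _).prod (level_finite _ _)).subset (s := U ×ˢ U) ?_
      rintro _ ⟨p, q, hp, hq, rfl, -⟩
      exact ⟨hUm p hp, hUm q hq⟩
    rcases B.eq_empty_or_nonempty with hemp | hne
    · refine ⟨m, ℓ, h, ⟨le_rfl, fun p => List.take_of_length_le (h.length_le p)⟩, ?_⟩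
      intro p q hp hq hb
      by_contra hn
      exact Set.notMem_empty _ (hemp ▸ (show (ℓ p, ℓ q) ∈ B from ⟨p, q, hp, hq, rfl, hb, hn⟩))
    -- Take `v` lexicographically last among the defects, then `w` first. By transitivity of `τ` a
    -- word between them would yield a defect with a later `v` or an earlier `w`, so `w` covers `v`.
    · obtain ⟨⟨v, w'⟩, hvB, hvmax⟩ := Set.exists_max_image B Prod.fst hBfin hne
      obtain ⟨⟨v', w⟩, ⟨hvwB, hv'⟩, hwmin⟩ := Set.exists_min_image {x ∈ B | x.1 = v} Prod.snd
        (hBfin.subset fun _ hx => hx.1) ⟨_, hvB, rfl⟩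
      obtain rfl : v' = v := hv'
      obtain ⟨p, q, hp, hq, hpq, hb, hτ⟩ := id hvwB
      obtain ⟨rfl, rfl⟩ := Prod.mk.inj hpq
      have hvne : ℓ p ≠ ℓ q := fun heq =>
        hτ (hinv p p p q hp hp rfl heq (hle p p le_rfl))
      have hlt : ℓ p < ℓ q := hb.lt (by rw [hp, hq]) hvne
      have hnb : ¬ Below (ℓ q) (ℓ p) := fun h1 => hvne (hU.below_antisymm (hUm p hp) (hUm q hq) hb h1)
      have hd : (Step.perp (ℓ p) (ℓ q)).Valid U := by
        refine ⟨hUm p hp, hUm q hq, hlt, ?_, ?_⟩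
        · rw [hU.related_iff (hUm p hp) (hUm q hq)]
          rintro (h1 | h1 | h1 | h1)
          · exact hvne h1
          · exact hτ (hle _ _ (h.lt_of_sep _ _ h1).le)
          · exact hnb (hU.below _ (hUm q hq) _ (hUm p hp) h1)
          · exact h1.1 hb
        · intro u hu h1 h2
          obtain ⟨r, hr, rfl⟩ := h.mem_level.1 hu
          by_contra hcon
          rw [perp_iff, perp_iff] at hcon
          have h3 : ¬ Below (ℓ r) (ℓ p) := fun h =>
            absurd (hU.below_le (hUm r hr) (hUm p hp) h) (not_le.2 h1)
          have h4 : ¬ Below (ℓ q) (ℓ r) := fun h =>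
            absurd (hU.below_le (hUm q hq) (hUm r hr) h) (not_le.2 h2)
          have h5 : Below (ℓ p) (ℓ r) := by tauto
          have h6 : Below (ℓ r) (ℓ q) := by tauto
          by_cases h7 : τ p r
          · have h8 : ¬ τ r q := fun h => hτ (htrans _ _ _ h7 h)
            exact absurd (hvmax (ℓ r, ℓ q) ⟨r, q, hr, hq, rfl, h6, h8⟩) (not_le.2 h1)
          · exact absurd (hwmin (ℓ p, ℓ r) ⟨⟨p, r, hp, hr, rfl, h5, h7⟩, rfl⟩) (not_le.2 h2)
      obtain ⟨ℓ', c, h1, h2, h3, h4⟩ := h.extend_unary hd (by simp) (by simp)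
        (fun _ _ h => h.elim) (by
          rintro p' q' hpq' - - ⟨h1, h2⟩
          exact hτ (hinv p' q' p q (by rw [h1, hp]) (by rw [h2, hq]) h1 h2 (hle _ _ hpq')))
      have hltN : {x : Word × Word | ∃ p q, (ℓ' p).length = m + 1 ∧ (ℓ' q).length = m + 1 ∧
          (ℓ' p, ℓ' q) = x ∧ Below (ℓ' p) (ℓ' q) ∧ ¬ τ p q}.ncard < B.ncard := by
        refine ncard_lt_of_subset_image (fun x => (x.1 ++ [c x.1], x.2 ++ [c x.2])) hBfin hvwB ?_
        rintro _ ⟨p', q', hp', hq', rfl, hb', hτ'⟩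
        have hpm := h2.length_eq hp'
        have hqm := h2.length_eq hq'
        rw [h4 p' hpm, h4 q' hqm] at hb' ⊢
        rw [Step.below_snoc hU hd (hUm _ hpm) (hUm _ hqm) (h3 _) (h3 _)] at hb'
        exact ⟨(ℓ p', ℓ q'), ⟨⟨p', q', hpm, hqm, rfl, hb'.1, hτ'⟩,
          fun heq => hb'.2 (Prod.mk.inj heq)⟩, rfl⟩
      obtain ⟨m', ℓ'', h5, h6, h7⟩ := ih _ (hN ▸ hltN) h1 (hinv.extends h2) rfl
      exact ⟨m', ℓ'', h5, h2.trans h6, h7⟩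

/-- Missing separations are added one at a time by new pairs of `≼`. That `σ` absorbs `τ` on both
sides is what makes the step valid at an extremal missing pair. -/
theorem exists_sep_of (h : PartialCoding m ℓ) {τ σ : P → P → Prop}
    (hτ : ∀ p q, (ℓ p).length = m → (ℓ q).length = m → Below (ℓ p) (ℓ q) → τ p q)
    (hle : ∀ p q, σ p q → p ≤ q) (hτσ : ∀ p q r, τ p q → σ q r → σ p r)
    (hστ : ∀ p q r, σ p q → τ q r → σ p r) (hinv : Invariant m ℓ σ) :
    ∃ m' ℓ', PartialCoding m' ℓ' ∧ Extends m ℓ m' ℓ' ∧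
      ∀ p q, (ℓ' p).length = m' → (ℓ' q).length = m' → ℓ' p ≠ ℓ' q → σ p q →
        Sep (ℓ' p) (ℓ' q) := by
  generalize hN : {x : Word × Word | ∃ p q, (ℓ p).length = m ∧ (ℓ q).length = m ∧
    (ℓ p, ℓ q) = x ∧ ℓ p ≠ ℓ q ∧ ¬ Sep (ℓ p) (ℓ q) ∧ σ p q}.ncard = N
  induction N using Nat.strong_induction_on generalizing m ℓ with
  | _ N ih =>
    set B := {x : Word × Word | ∃ p q, (ℓ p).length = m ∧ (ℓ q).length = m ∧
      (ℓ p, ℓ q) = x ∧ ℓ p ≠ ℓ q ∧ ¬ Sep (ℓ p) (ℓ q) ∧ σ p q} with hB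
    set U := level (initialSegments (Set.range ℓ)) m with hUdef
    have hU : IsLevel m U := h.isLevel
    have hUm : ∀ p, (ℓ p).length = m → ℓ p ∈ U := fun p hp => h.mem_level.2 ⟨p, hp, rfl⟩
    have hBfin : B.Finite := by
      refine ((level_finite _ _).prod (level_finite _ _)).subset (s := U ×ˢ U) ?_
      rintro _ ⟨p, q, hp, hq, rfl, -⟩
      exact ⟨hUm p hp, hUm q hq⟩
    rcases B.eq_empty_or_nonempty with hemp | hne
    · refine ⟨m, ℓ, h, ⟨le_rfl, fun p => List.take_of_length_le (h.length_le p)⟩, ?_⟩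
      intro p q hp hq hpq hσ
      by_contra hn
      exact Set.notMem_empty _
        (hemp ▸ (show (ℓ p, ℓ q) ∈ B from ⟨p, q, hp, hq, rfl, hpq, hn, hσ⟩))
    -- Here `v` is lexicographically first and then `w` last, so the pairs that the new one implies,
    -- with a smaller `v` or a larger `w`, are separated already.
    · obtain ⟨⟨v, w'⟩, hvB, hvmin⟩ := Set.exists_min_image B Prod.fst hBfin hne
      obtain ⟨⟨v', w⟩, ⟨hvwB, hv'⟩, hwmax⟩ := Set.exists_max_image {x ∈ B | x.1 = v} Prod.snd
        (hBfin.subset fun _ hx => hx.1) ⟨_, hvB, rfl⟩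
      obtain rfl : v' = v := hv'
      obtain ⟨p, q, hp, hq, hpq, hvne, hs, hσ⟩ := id hvwB
      obtain ⟨rfl, rfl⟩ := Prod.mk.inj hpq
      have hb : Below (ℓ p) (ℓ q) := h.below _ _ (hle _ _ hσ)
      have hlt : ℓ p < ℓ q := hb.lt (by rw [hp, hq]) hvne
      have hnb : ¬ Below (ℓ q) (ℓ p) := fun h1 => hvne (hU.below_antisymm (hUm p hp) (hUm q hq) hb h1)
      have hd : (Step.prec (ℓ p) (ℓ q)).Valid U := by
        refine ⟨hUm p hp, hUm q hq, hlt, ?_, ?_, ?_⟩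
        · rw [hU.related_iff (hUm p hp) (hUm q hq)]
          rintro (h1 | h1 | h1 | h1)
          · exact hvne h1
          · exact hs h1
          · exact hnb (hU.below _ (hUm q hq) _ (hUm p hp) h1)
          · exact h1.1 hb
        · intro u hu h1
          obtain ⟨r, hr, rfl⟩ := h.mem_level.1 hu
          rw [hU.precEq_iff (hUm r hr) (hUm q hq), perp_iff]
          have h3 : ¬ Below (ℓ p) (ℓ r) := fun h =>
            absurd (hU.below_le (hUm p hp) (hUm r hr) h) (not_le.2 h1)
          by_contra hcon
          have h4 : Below (ℓ r) (ℓ p) := by tauto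
          have h5 : σ r q := hτσ _ _ _ (hτ r p hr hp h4) hσ
          exact absurd (hvmin (ℓ r, ℓ q) ⟨r, q, hr, hq, rfl, fun h => hcon (.inl (.inl h)),
            fun h => hcon (.inl (.inr h)), h5⟩) (not_le.2 h1)
        · intro u hu h1
          obtain ⟨r, hr, rfl⟩ := h.mem_level.1 hu
          rw [hU.precEq_iff (hUm p hp) (hUm r hr), perp_iff]
          have h3 : ¬ Below (ℓ r) (ℓ q) := fun h =>
            absurd (hU.below_le (hUm r hr) (hUm q hq) h) (not_le.2 h1)
          by_contra hcon
          have h4 : Below (ℓ q) (ℓ r) := by tauto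
          have h5 : σ p r := hστ _ _ _ hσ (hτ q r hq hr h4)
          exact absurd (hwmax (ℓ p, ℓ r) ⟨⟨p, r, hp, hr, rfl, fun h => hcon (.inl (.inl h)),
            fun h => hcon (.inl (.inr h)), h5⟩, rfl⟩) (not_le.2 h1)
      obtain ⟨ℓ', c, h1, h2, h3, h4⟩ := h.extend_unary hd (by simp) (by simp)
        (by
          rintro p' q' ⟨h1, h2⟩
          refine lt_of_le_of_ne (hle _ _ (hinv p q p' q' hp hq h1.symm h2.symm hσ)) ?_
          rintro rfl
          exact hvne (h1.symm.trans h2))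
        (fun _ _ _ _ _ h => h.elim)
      have hltN : {x : Word × Word | ∃ p q, (ℓ' p).length = m + 1 ∧ (ℓ' q).length = m + 1 ∧
          (ℓ' p, ℓ' q) = x ∧ ℓ' p ≠ ℓ' q ∧ ¬ Sep (ℓ' p) (ℓ' q) ∧ σ p q}.ncard < B.ncard := by
        refine ncard_lt_of_subset_image (fun x => (x.1 ++ [c x.1], x.2 ++ [c x.2])) hBfin hvwB ?_
        rintro _ ⟨p', q', hp', hq', rfl, hne', hs', hσ'⟩
        have hpm := h2.length_eq hp'
        have hqm := h2.length_eq hq'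
        rw [h4 p' hpm, h4 q' hqm] at hs' hne' ⊢
        rw [Step.sep_snoc hU hd (hUm _ hpm) (hUm _ hqm) (h3 _) (h3 _)] at hs'
        refine ⟨(ℓ p', ℓ q'), ⟨⟨p', q', hpm, hqm, rfl, fun h => hne' (by rw [h]),
          fun h => hs' (.inl h), hσ'⟩, fun heq => hs' (.inr (Prod.mk.inj heq))⟩, rfl⟩
      obtain ⟨m', ℓ'', h5, h6, h7⟩ := ih _ (hN ▸ hltN) h1
        (fun p q hp hq hpq => hτ p q (h2.length_eq hp) (h2.length_eq hq) (by
          rw [← h2.2 p, ← h2.2 q]; exact hpq.take _ _)) (hinv.extends h2) rfl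
      exact ⟨m', ℓ'', h5, h2.trans h6, h7⟩

/-- The word of any given point can be made final. -/
theorem exists_final (h : PartialCoding m ℓ) (x : P) :
    ∃ m' ℓ', PartialCoding m' ℓ' ∧ Extends m ℓ m' ℓ' ∧ (ℓ' x).length < m' := by
  obtain ⟨m₁, ℓ₁, h₁, e₁, a₁, a₁'⟩ := h.exists_homogeneous (Q := fun q => x ≤ q)
    fun p q hpq h => h.trans hpq
  -- The points below `x` form a down-set, so the splitting is applied to the complement.
  obtain ⟨m₂, ℓ₂, h₂, e₂, b₂', b₂⟩ := h₁.exists_homogeneous (Q := fun q => ¬ q ≤ x)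
    fun p q hpq h h' => h (hpq.trans h')
  simp only [not_not] at b₂
  have a₂ := a₁.extends e₂
  have a₂' := a₁'.extends e₂
  -- The relation `τ` is the coarsest comparison consistent with the position of points relative to
  -- `x`.
  obtain ⟨m₃, ℓ₃, h₃, e₃, c₃⟩ := h₂.exists_below_imp
    (τ := fun p q => (x ≤ p → x ≤ q) ∧ (q ≤ x → p ≤ x))
    (fun p q hpq => ⟨fun h => h.trans hpq, fun h => hpq.trans h⟩)
    (fun p q r h1 h2 => ⟨fun h => h2.1 (h1.1 h), fun h => h1.2 (h2.2 h)⟩)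
    (by
      intro p q p' q' hp hq hpp hqq h
      refine ⟨fun h1 => a₂ q q' hq hqq (h.1 (a₂ p' p (by rw [← hpp, hp]) hpp.symm h1)),
        fun h1 => b₂ p p' hp hpp (h.2 (b₂ q' q (by rw [← hqq, hq]) hqq.symm h1))⟩)
  have a₃ := a₂.extends e₃
  have b₃ := b₂.extends e₃
  -- The pairs of `σ` are those whose order follows through `x`; they are to be separated before the
  -- word of `x` ends.
  obtain ⟨m₄, ℓ₄, h₄, e₄, c₄⟩ := h₃.exists_sep_of (σ := fun p q => p ≤ x ∧ x ≤ q) c₃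
    (fun p q h => h.1.trans h.2) (fun p q r h1 h2 => ⟨h1.2 h2.1, h2.2⟩)
    (fun p q r h1 h2 => ⟨h1.1, h2.1 h1.2⟩)
    (fun p q p' q' hp hq hpp hqq h => ⟨b₃ p p' hp hpp h.1, a₃ q q' hq hqq h.2⟩)
  have a₄ := a₃.extends e₄
  have b₄ := b₃.extends e₄
  have e := e₁.trans (e₂.trans (e₃.trans e₄))
  rcases (h₄.length_le x).lt_or_eq with hx | hx
  · exact ⟨m₄, ℓ₄, h₄, e, hx⟩
  have hU := h₄.isLevel
  have hxU := h₄.mem_level.2 ⟨x, hx, rfl⟩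
  -- A point with the same word lies both above and below `x`, so the dropped word belongs to `x`
  -- alone.
  have hcell : ∀ p, ℓ₄ x = ℓ₄ p → p = x := fun p hp =>
    le_antisymm (b₄ x p hx hp le_rfl) (a₄ x p hx hp le_rfl)
  have hd : (Step.leaf (ℓ₄ x)).Valid (level (initialSegments (Set.range ℓ₄)) m₄) := by
    refine ⟨hxU, fun u hu hne => ?_⟩
    rw [hU.related_iff hxU hu]
    obtain ⟨q, hq, rfl⟩ := h₄.mem_level.1 hu
    have hτ : ∀ p q, (ℓ₄ p).length = m₄ → (ℓ₄ q).length = m₄ → Below (ℓ₄ p) (ℓ₄ q) →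
        (x ≤ p → x ≤ q) ∧ (q ≤ x → p ≤ x) := fun p q hp hq hb =>
      c₃ p q (e₄.length_eq hp) (e₄.length_eq hq) (by
        rw [← e₄.2 p, ← e₄.2 q]; exact hb.take _ _)
    by_cases h1 : Below (ℓ₄ x) (ℓ₄ q)
    · exact .inr (.inl (c₄ x q hx hq (Ne.symm hne) ⟨le_rfl, (hτ x q hx hq h1).1 le_rfl⟩))
    · by_cases h2 : Below (ℓ₄ q) (ℓ₄ x)
      · exact .inr (.inr (.inl (c₄ q x hq hx hne ⟨(hτ q x hq hx h2).2 le_rfl, le_rfl⟩)))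
      · exact .inr (.inr (.inr ⟨h1, h2⟩))
  obtain ⟨ℓ₅, h₅, e₅, -, hl⟩ := h₄.extend hd (fun _ => .X)
    (fun p hp hne => ⟨fun h => hne (by rw [h]), rfl⟩) (fun p hp a ha => ⟨p, rfl, ha.2.symm⟩)
    (fun p q h => h.elim) (fun p q _ h => h)
    (fun p q hp hpq => by
      have h1 : ℓ₄ x = ℓ₄ p := by injection hp
      rw [hcell p h1, hcell q (h1.trans hpq)])
  exact ⟨m₄ + 1, ℓ₅, h₅, e.trans e₅, by rw [hl x rfl, hx]; exact Nat.lt_succ_self _⟩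

theorem zero (P : Type*) [PartialOrder P] : PartialCoding 0 fun _ : P => ([] : Word) :=
  ⟨fun _ => le_rfl, fun _ _ h => absurd h (not_sep_self _), fun _ _ _ => Below.refl _,
    fun _ h => absurd h (Nat.not_lt_zero _), fun _ h => absurd h (Nat.not_lt_zero _)⟩

end PartialCoding

/-- Enumerate `P` and make its points final in turn. Final words never change again, so the limit
exists, and each level of its tree is already a level of some finite approximation. -/
theorem exists_isPosetTypeEmbedding (P : Type*) [PartialOrder P] [Countable P] [Nonempty P] :
    ∃ ψ : P → Word, IsPosetTypeEmbedding ψ := by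
  obtain ⟨x, hx⟩ := exists_surjective_nat P
  let σ : ℕ → Type _ := fun _ => {s : ℕ × (P → Word) // PartialCoding s.1 s.2}
  obtain ⟨f, -, hf⟩ := exists_dependent_seq (σ := σ) ⟨(0, fun _ => []), PartialCoding.zero P⟩
    (r := fun i s t => Extends s.1.1 s.1.2 t.1.1 t.1.2 ∧ (t.1.2 (x i)).length < t.1.1)
    (by
      rintro i ⟨⟨m, ℓ⟩, h⟩
      obtain ⟨m', ℓ', h1, h2, h3⟩ := h.exists_final (x i)
      exact ⟨⟨(m', ℓ'), h1⟩, h2, h3⟩)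
  set m : ℕ → ℕ := fun n => (f n).1.1 with hm
  set ℓ : ℕ → P → Word := fun n => (f n).1.2 with hℓ
  have hcod : ∀ n, PartialCoding (m n) (ℓ n) := fun n => (f n).2
  have hext : ∀ n k, n ≤ k → Extends (m n) (ℓ n) (m k) (ℓ k) := by
    intro n k hnk
    induction k, hnk using Nat.le_induction with
    | base => exact ⟨le_rfl, fun p => List.take_of_length_le ((hcod n).length_le p)⟩
    | succ k _ ih => exact ih.trans (hf k).1
  choose i hi using hx
  -- Stage `i p` treats the point `p`, whose word is final from the next stage on.
  set ψ : P → Word := fun p => ℓ (i p + 1) p with hψ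
  have hfin : ∀ p, (ℓ (i p + 1) p).length < m (i p + 1) := by
    intro p
    have := (hf (i p)).2
    rw [hi] at this
    exact this
  have hψn : ∀ p n, i p + 1 ≤ n → ℓ n p = ψ p := fun p n hn =>
    (hext _ _ hn).eq_of_length_lt (hfin p)
  have htake : ∀ n p, (ψ p).take (m n) = ℓ n p := by
    intro n p
    rcases le_total n (i p + 1) with hn | hn
    · exact (hext _ _ hn).2 p
    · rw [hψn p n hn, List.take_of_length_le]
      exact (hfin p).le.trans (hext _ _ hn).1
  have hpair : ∀ p q, q ≠ p →
      (p < q → Sep (ψ p) (ψ q)) ∧ (q < p → Sep (ψ q) (ψ p)) ∧ ¬ ψ p <+: ψ q := by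
    intro p q hqp
    have h1 := (hext (i p + 1) _ (le_max_left (i p + 1) (i q + 1))).1
    have := (hcod (max (i p + 1) (i q + 1))).final p
      (by rw [hψn p _ (le_max_left _ _)]; exact (hfin p).trans_le h1) q hqp
    rwa [hψn p _ (le_max_left _ _), hψn q _ (le_max_right _ _)] at this
  have hlt : ∀ p q, Sep (ψ p) (ψ q) → p < q := by
    intro p q h
    refine (hcod (max (i p + 1) (i q + 1))).lt_of_sep p q ?_
    rwa [hψn p _ (le_max_left _ _), hψn q _ (le_max_right _ _)]
  have hbelow : ∀ p q, p ≤ q → Below (ψ p) (ψ q) := by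
    intro p q h
    have := (hcod (max (i p + 1) (i q + 1))).below p q h
    rwa [hψn p _ (le_max_left _ _), hψn q _ (le_max_right _ _)] at this
  have hinj : Function.Injective ψ := by
    intro p q hpq
    by_contra hne
    exact (hpair p q (Ne.symm hne)).2.2 (by rw [hpq])
  refine ⟨ψ, hinj, fun p q => ?_, ⟨(initialSegments_idem _).symm, fun k hk => ?_⟩, fun p => ?_⟩
  · constructor
    · intro hpq
      rcases hpq.eq_or_lt with rfl | hpq'
      · exact .inl rfl
      · exact .inr (((hpair p q hpq'.ne').1 hpq').prec (hbelow p q hpq))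
    · rintro (h | h)
      · exact (hinj h).le
      · exact (hlt p q h.sep).le
  · rw [existsUnique_holds_iff]
    obtain ⟨u, hu⟩ := id hk
    obtain ⟨_, ⟨p, rfl⟩, hkp, -⟩ := mem_level_initialSegments.1 hu
    have hkm : k < m (i p + 1) := hkp.trans_lt (hfin p)
    rw [level_initialSegments_range_congr (htake (i p + 1)) hkm.le] at hk ⊢
    rw [level_initialSegments_range_congr (htake (i p + 1)) (show k + 1 ≤ _ from hkm)]
    exact (hcod _).step k hkm hk
  · rw [leaves_initialSegments_of_antichain]
    · exact ⟨p, rfl⟩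
    · rintro _ ⟨p, rfl⟩ _ ⟨q, rfl⟩ h
      by_contra hne
      exact (hpair p q fun h => hne (by rw [h])).2.2 h

end PosetType

/-! ### The theorem -/

theorem theorem4 {P : Type*} [PartialOrder P] (hP : PosetType.IsGenericPartialOrder P) :
    (∃ ψ : P → PosetType.Word, PosetType.IsPosetTypeEmbedding ψ) ∧
    ∀ ψ : P → PosetType.Word, PosetType.IsPosetTypeEmbedding ψ →
      ∀ (A : Type*) [PartialOrder A] [Finite A] (f : P ↪o P),
        {S : Set PosetType.Word | ∃ g : A ↪o P, PosetType.color ψ (g.trans f) = S} =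
          PosetType.types A := by
  have := hP.countable
  have := hP.nonempty
  refine ⟨PosetType.exists_isPosetTypeEmbedding P, fun ψ hψ A _ _ f => ?_⟩
  ext S
  constructor
  · rintro ⟨g, rfl⟩
    exact PosetType.color_mem_types hψ (g.trans f)
  · exact PosetType.exists_color_eq hP hψ f
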